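/- Let $(X,\mathcal X)$ be a measurable space, let $\mu$ be a complex measure on it, and let $|\mu|$ be its total variation. Let $u$ be a symmetric measurable function on $X\times X$ whose values are complex numbers, except that the real part of $u$ may also take the value $+\infty$. Put $$\zeta(x,y)=e^{-u(x,y)}-1,$$ with $\zeta(x,y)=-1$ where $\operatorname{Re}u(x,y)=+\infty$, and let $\overline u(x,y)=u(x,y)$ where $\operatorname{Re}u(x,y)\neq+\infty$ and $\overline u(x,y)=1$ where $\operatorname{Re}u(x,y)=+\infty$. Let $a,b:X\to[0,\infty)$ be measurable functions such that: (i) for every $n$ and for $|\mu|^{\otimes n}$-almost all $(x_1,\dots,x_n)$, $\ \prod_{1\le i<j\le n}|1+\zeta(x_i,x_j)|\le\prod_{i=1}^n e^{b(x_i)}$; (ii) either $\int d|\mu|(y)\,|\zeta(x,y)|\,e^{a(y)+2b(y)}\le a(x)$ for $|\mu|$-almost all $x$, or $\int d|\mu|(y)\,|\overline u(x,y)|\,e^{a(y)+b(y)}\le a(x)$ for $|\mu|$-almost all $x$; (iii) $\int d|\mu|(y)\,e^{a(y)+2b(y)}<\infty$. For $n\ge1$ let $$\varphi(x_1,\dots,x_n)=\frac1{n!}\sum_{G\in\mathcal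 C_n}\ \prod_{\{i,j\}\in G}\zeta(x_i,x_j),$$ where $\mathcal C_n$ is the set of connected graphs (unoriented, without loops) on the vertex set $\{1,\dots,n\}$; thus $\varphi(x_1)=1$. Define $$Z=\sum_{n\ge0}\frac1{n!}\int d\mu(x_1)\cdots\int d\mu(x_n)\prod_{1\le i<j\le n}(1+\zeta(x_i,x_j)),$$ $$Z(x_1)=\sum_{n\ge1}\frac1{(n-1)!}\int d\mu(x_2)\cdots\int d\mu(x_n)\prod_{1\le i<j\le n}(1+\zeta(x_i,x_j)),$$ $$Z(x_1,x_2)=\sum_{n\ge2}\frac1{(n-2)!}\int d\mu(x_3)\cdots\int d\mu(x_n)\prod_{1\le i<j\le n}(1+\zeta(x_i,x_j)),$$ $$\hat Z(x_1)=\sum_{n\ge1}n\int d\mu(x_2)\cdots\int d\mu(x_n)\,\varphi(x_1,\dots,x_n),$$ $$\hat Z(x_1,x_2)=\sum_{n\ge2}n(n-1)\int d\mu(x_3)\cdots\int d\mu(x_n)\,\varphi(x_1,\dots,x_n),$$ where a term without integrals is the value of its integrand (in particular, the term $n=0$ of $Z$ and the term $n=1$ of $Z(x_1)$ are $1$). Then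 every integrand in $Z$ is $|\mu|^{\otimes n}$-integrable, the series $Z$ converges absolutely, and $Z\neq0$. For $|\mu|$-almost all $x_1$, all integrands in $Z(x_1)$ and $\hat Z(x_1)$ are integrable with respect to the corresponding power of $|\mu|$, both series converge absolutely (as series of complex numbers), and $$\frac{Z(x_1)}{Z}=\hat Z(x_1).$$ For $|\mu|\otimes|\mu|$-almost all $(x_1,x_2)$, all integrands in $Z(x_1,x_2)$ and $\hat Z(x_1,x_2)$ are integrable with respect to the corresponding power of $|\mu|$, both series converge absolutely (as series of complex numbers), and $$\frac{Z(x_1,x_2)}{Z}=\hat Z(x_1)\,\hat Z(x_2)+\hat Z(x_1,x_2).$$ In particular, for $|\mu|\otimes|\mu|$-almost all $(x_1,x_2)$, the truncated two-point correlation function is $$\frac{Z(x_1,x_2)}{Z}-\frac{Z(x_1)\,Z(x_2)}{Z^2}=\hat Z(x_1,x_2).$$ -/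

import Mathlib

open MeasureTheory
open scoped ENNReal

noncomputable section

namespace ClusterExpansion

/-- A measurable symmetric pair interaction `u` on `X × X`, given by its real part, which may take
the value `+∞` (but not `-∞`), and its imaginary part. -/
structure PairInteraction (X : Type*) [MeasurableSpace X] where
  re : X → X → EReal
  im : X → X → ℝ
  re_ne_bot : ∀ x y, re x y ≠ ⊥
  re_symm : ∀ x y, re x y = re y x
  im_symm : ∀ x y, im x y = im y x
  measurable_re : Measurable fun p : X × X => re p.1 p.2
  measurable_im : Measurable fun p : X × X => im p.1 p.2

variable {X : Type*} [MeasurableSpace X]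

namespace PairInteraction

/-- The complex number `u(x,y)` when `Re u(x,y)` is finite. -/
def val (u : PairInteraction X) (x y : X) : ℂ :=
  ((u.re x y).toReal : ℂ) + (u.im x y : ℂ) * Complex.I

open Classical in
/-- `ζ(x,y) = exp(-u(x,y)) - 1`, equal to `-1` where `Re u(x,y) = +∞`. -/
def zeta (u : PairInteraction X) (x y : X) : ℂ :=
  if u.re x y = ⊤ then -1 else Complex.exp (-u.val x y) - 1

open Classical in
/-- `ū(x,y)`: equal to `u(x,y)` where `Re u(x,y)` is finite, and to `1` where it is `+∞`. -/
def ubar (u : PairInteraction X) (x y : X) : ℂ :=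
  if u.re x y = ⊤ then 1 else u.val x y

/-- `∏_{i<j} (1 + ζ(x_i, x_j))`. -/
def weight (u : PairInteraction X) {n : ℕ} (x : Fin n → X) : ℂ :=
  ∏ p : Fin n × Fin n with p.1 < p.2, (1 + u.zeta (x p.1) (x p.2))

open Classical in
/-- `φ(x_1, …, x_n) = (1/n!) ∑_{G} ∏_{{i,j} ∈ G} ζ(x_i, x_j)`, the sum being over the connected
graphs `G` on `n` labelled vertices. The edges of `G` are enumerated as the pairs `i < j` that are
adjacent in `G`. For `n = 1` the value is `1`. -/
def phi (u : PairInteraction X) {n : ℕ} (x : Fin n → X) : ℂ :=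
  (1 / (n.factorial : ℂ)) *
    ∑ G : SimpleGraph (Fin n) with G.Connected,
      ∏ p : Fin n × Fin n with p.1 < p.2 ∧ G.Adj p.1 p.2, u.zeta (x p.1) (x p.2)

end PairInteraction

/-- The iterated integral `∫ dμ(x_1) ⋯ ∫ dμ(x_n) F(x_1, …, x_n)` of a complex function against a
complex measure; for `n = 0` it is the value of `F` at the empty tuple. -/
def iterInt (μ : ComplexMeasure X) : (n : ℕ) → ((Fin n → X) → ℂ) → ℂ
  | 0, F => F ![]
  | n + 1, F =>
      VectorMeasure.integral μ (fun x => iterInt μ n fun y => F (Matrix.vecCons x y))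
        (ContinuousLinearMap.mul ℝ ℂ)

/-- The product measure `|μ| ⊗ ⋯ ⊗ |μ|` on `n`-tuples, `|μ|` being the total variation of `μ`. -/
def absPi (μ : ComplexMeasure X) (n : ℕ) : Measure (Fin n → X) :=
  Measure.pi fun _ => μ.variation

/-- Stability: for every `n` and almost all `x_1, …, x_n`,
`∏_{i<j} |1 + ζ(x_i, x_j)| ≤ ∏_i exp(b(x_i))`. -/
def Stable (μ : ComplexMeasure X) (u : PairInteraction X) (b : X → ℝ) : Prop :=
  ∀ n : ℕ, ∀ᵐ x ∂(absPi μ n),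
    ∏ p : Fin n × Fin n with p.1 < p.2, ‖1 + u.zeta (x p.1) (x p.2)‖ ≤ ∏ i, Real.exp (b (x i))

/-- For almost all `x`, `∫ d|μ|(y) |ζ(x,y)| exp(a(y) + 2 b(y)) ≤ a(x)`. -/
def ZetaCriterion (μ : ComplexMeasure X) (u : PairInteraction X) (a b : X → ℝ) : Prop :=
  ∀ᵐ x ∂μ.variation,
    ∫⁻ y, ENNReal.ofReal (‖u.zeta x y‖ * Real.exp (a y + 2 * b y)) ∂μ.variation
      ≤ ENNReal.ofReal (a x)

/-- For almost all `x`, `∫ d|μ|(y) |ū(x,y)| exp(a(y) + b(y)) ≤ a(x)`. -/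
def UbarCriterion (μ : ComplexMeasure X) (u : PairInteraction X) (a b : X → ℝ) : Prop :=
  ∀ᵐ x ∂μ.variation,
    ∫⁻ y, ENNReal.ofReal (‖u.ubar x y‖ * Real.exp (a y + b y)) ∂μ.variation
      ≤ ENNReal.ofReal (a x)

/-! In the series below `n` is the number of points that are integrated, so that the total number
of points is `n`, `n + 1` or `n + 2`. -/

/-- Terms of the partition function `Z`. -/
def ZTerm (μ : ComplexMeasure X) (u : PairInteraction X) (n : ℕ) : ℂ :=
  (1 / (n.factorial : ℂ)) * iterInt μ n fun y => u.weight y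

/-- Terms of the unnormalized one-point correlation function `Z(x₁)`. -/
def ZTerm₁ (μ : ComplexMeasure X) (u : PairInteraction X) (x₁ : X) (n : ℕ) : ℂ :=
  (1 / (n.factorial : ℂ)) * iterInt μ n fun y => u.weight (Matrix.vecCons x₁ y)

/-- Terms of the unnormalized two-point correlation function `Z(x₁, x₂)`. -/
def ZTerm₂ (μ : ComplexMeasure X) (u : PairInteraction X) (x₁ x₂ : X) (n : ℕ) : ℂ :=
  (1 / (n.factorial : ℂ)) *
    iterInt μ n fun y => u.weight (Matrix.vecCons x₁ (Matrix.vecCons x₂ y))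

/-- Terms of the cluster function `Ẑ(x₁)`. -/
def clusterTerm₁ (μ : ComplexMeasure X) (u : PairInteraction X) (x₁ : X) (n : ℕ) : ℂ :=
  ((n : ℂ) + 1) * iterInt μ n fun y => u.phi (Matrix.vecCons x₁ y)

/-- Terms of the cluster function `Ẑ(x₁, x₂)`. -/
def clusterTerm₂ (μ : ComplexMeasure X) (u : PairInteraction X) (x₁ x₂ : X) (n : ℕ) : ℂ :=
  ((n : ℂ) + 2) * ((n : ℂ) + 1) *
    iterInt μ n fun y => u.phi (Matrix.vecCons x₁ (Matrix.vecCons x₂ y))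

/-- The partition function `Z`. -/
def Z (μ : ComplexMeasure X) (u : PairInteraction X) : ℂ := ∑' n, ZTerm μ u n

/-- The unnormalized one-point correlation function `Z(x₁)`. -/
def Z₁ (μ : ComplexMeasure X) (u : PairInteraction X) (x₁ : X) : ℂ := ∑' n, ZTerm₁ μ u x₁ n

/-- The unnormalized two-point correlation function `Z(x₁, x₂)`. -/
def Z₂ (μ : ComplexMeasure X) (u : PairInteraction X) (x₁ x₂ : X) : ℂ :=
  ∑' n, ZTerm₂ μ u x₁ x₂ n

/-- The cluster function `Ẑ(x₁)`. -/
def Zhat₁ (μ : ComplexMeasure X) (u : PairInteraction X) (x₁ : X) : ℂ :=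
  ∑' n, clusterTerm₁ μ u x₁ n

/-- The cluster function `Ẑ(x₁, x₂)`. -/
def Zhat₂ (μ : ComplexMeasure X) (u : PairInteraction X) (x₁ x₂ : X) : ℂ :=
  ∑' n, clusterTerm₂ μ u x₁ x₂ n

/-- The integrals and the series that define `Z` converge absolutely. -/
def ConvZ (μ : ComplexMeasure X) (u : PairInteraction X) : Prop :=
  (∀ n, Integrable (fun y : Fin n → X => u.weight y) (absPi μ n)) ∧ Summable (ZTerm μ u)

/-- The integrals and the series that define `Z(x₁)` and `Ẑ(x₁)` converge absolutely. -/
def Conv₁ (μ : ComplexMeasure X) (u : PairInteraction X) (x₁ : X) : Prop :=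
  (∀ n, Integrable (fun y : Fin n → X => u.weight (Matrix.vecCons x₁ y)) (absPi μ n)) ∧
  Summable (ZTerm₁ μ u x₁) ∧
  (∀ n, Integrable (fun y : Fin n → X => u.phi (Matrix.vecCons x₁ y)) (absPi μ n)) ∧
  Summable (clusterTerm₁ μ u x₁)

/-- The integrals and the series that define `Z(x₁, x₂)` and `Ẑ(x₁, x₂)` converge absolutely. -/
def Conv₂ (μ : ComplexMeasure X) (u : PairInteraction X) (x₁ x₂ : X) : Prop :=
  (∀ n, Integrable
    (fun y : Fin n → X => u.weight (Matrix.vecCons x₁ (Matrix.vecCons x₂ y))) (absPi μ n)) ∧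
  Summable (ZTerm₂ μ u x₁ x₂) ∧
  (∀ n, Integrable
    (fun y : Fin n → X => u.phi (Matrix.vecCons x₁ (Matrix.vecCons x₂ y))) (absPi μ n)) ∧
  Summable (clusterTerm₂ μ u x₁ x₂)

end ClusterExpansion

end

noncomputable section

namespace ClusterExpansion

open Finset

section SubsetSums

variable {V M : Type*} [DecidableEq V] [AddCommMonoid M]

lemma sum_powerset_sdiff_comm (Y : Finset V) (F : Finset V → Finset V → M) :
    ∑ A ∈ Y.powerset, ∑ B ∈ (Y \ A).powerset, F A B =
      ∑ B ∈ Y.powerset, ∑ A ∈ (Y \ B).powerset, F A B := by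
  refine sum_comm' fun A B => ?_
  simp only [mem_powerset, subset_sdiff]
  constructor
  · rintro ⟨h1, h2, h3⟩; exact ⟨⟨h1, h3.symm⟩, h2⟩
  · rintro ⟨⟨h1, h3⟩, h2⟩; exact ⟨h1, h2, h3.symm⟩

lemma sum_powerset_powerset (Y : Finset V) (F : Finset V → Finset V → M) :
    ∑ A ∈ Y.powerset, ∑ B ∈ A.powerset, F A B =
      ∑ B ∈ Y.powerset, ∑ C ∈ (Y \ B).powerset, F (B ∪ C) B := by
  rw [sum_sigma', sum_sigma']
  refine sum_nbij' (fun p => ⟨p.2, p.1 \ p.2⟩) (fun p => ⟨p.1 ∪ p.2, p.1⟩) ?_ ?_ ?_ ?_ ?_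
  · rintro ⟨A, B⟩ h
    simp only [mem_sigma, mem_powerset] at h ⊢
    exact ⟨h.2.trans h.1, sdiff_subset_sdiff h.1 subset_rfl⟩
  · rintro ⟨B, C⟩ h
    simp only [mem_sigma, mem_powerset] at h ⊢
    exact ⟨union_subset h.1 (h.2.trans sdiff_subset), subset_union_left⟩
  · rintro ⟨A, B⟩ h
    simp only [mem_sigma, mem_powerset] at h
    simp [union_sdiff_of_subset h.2]
  · rintro ⟨B, C⟩ h
    simp only [mem_sigma, mem_powerset, subset_sdiff] at h
    simp [union_sdiff_cancel_left h.2.2.symm]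
  · rintro ⟨A, B⟩ h
    simp only [mem_sigma, mem_powerset] at h
    simp [union_sdiff_of_subset h.2]

lemma sum_powerset_mem (Y : Finset V) (F : Finset V → V → M) :
    ∑ A ∈ Y.powerset, ∑ j ∈ A, F A j = ∑ j ∈ Y, ∑ A ∈ (Y.erase j).powerset, F (insert j A) j := by
  rw [sum_sigma', sum_sigma']
  refine sum_nbij' (fun p => ⟨p.2, p.1.erase p.2⟩) (fun p => ⟨insert p.1 p.2, p.1⟩) ?_ ?_ ?_ ?_ ?_
  · rintro ⟨A, j⟩ h
    simp only [mem_sigma, mem_powerset] at h ⊢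
    exact ⟨h.1 h.2, erase_subset_erase _ h.1⟩
  · rintro ⟨j, A⟩ h
    simp only [mem_sigma, mem_powerset] at h ⊢
    exact ⟨insert_subset h.1 (h.2.trans (erase_subset _ _)), mem_insert_self _ _⟩
  · rintro ⟨A, j⟩ h
    simp only [mem_sigma, mem_powerset] at h
    simp [insert_erase h.2]
  · rintro ⟨j, A⟩ h
    simp only [mem_sigma, mem_powerset, subset_erase] at h
    simp [erase_insert h.2.2]
  · rintro ⟨A, j⟩ h
    simp only [mem_sigma, mem_powerset] at h
    simp [insert_erase h.2]

lemma sum_powerset_filter_mem {X : Finset V} {r : V} (hr : r ∈ X) (F : Finset V → M) :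
    ∑ A ∈ X.powerset with r ∈ A, F A = ∑ A ∈ (X.erase r).powerset, F (insert r A) := by
  refine sum_nbij' (fun A => A.erase r) (fun A => insert r A) ?_ ?_ ?_ ?_ ?_
  · intro A h
    simp only [mem_filter, mem_powerset] at h ⊢
    exact erase_subset_erase _ h.1
  · intro A h
    simp only [mem_filter, mem_powerset] at h ⊢
    exact ⟨insert_subset hr (h.trans (erase_subset _ _)), mem_insert_self _ _⟩
  · intro A h
    simp only [mem_filter] at h
    exact insert_erase h.2
  · intro A h
    simp only [mem_powerset, subset_erase] at h
    exact erase_insert h.2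
  · intro A h
    simp only [mem_filter] at h
    simp [insert_erase h.2]

end SubsetSums

section Pairs

variable {V : Type*} [LinearOrder V]

/-- The pairs `i < j` of elements of `A`. -/
def pairs (A : Finset V) : Finset (V × V) := {p ∈ A ×ˢ A | p.1 < p.2}

lemma mem_pairs {A : Finset V} {p : V × V} : p ∈ pairs A ↔ p.1 ∈ A ∧ p.2 ∈ A ∧ p.1 < p.2 := by
  simp [pairs, and_assoc]

@[simp] lemma pairs_empty : pairs (∅ : Finset V) = ∅ := by simp [pairs]

lemma pairs_mono {A B : Finset V} (h : A ⊆ B) : pairs A ⊆ pairs B := fun _ hp =>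
  mem_pairs.2 ⟨h (mem_pairs.1 hp).1, h (mem_pairs.1 hp).2.1, (mem_pairs.1 hp).2.2⟩

lemma disjoint_pairs {A B : Finset V} (h : Disjoint A B) : Disjoint (pairs A) (pairs B) :=
  Finset.disjoint_left.2 fun _ hA hB =>
    Finset.disjoint_left.1 h (mem_pairs.1 hA).1 (mem_pairs.1 hB).1

lemma pairs_insert {A : Finset V} {i : V} (hi : i ∉ A) :
    pairs (insert i A) = A.image (fun j => (min i j, max i j)) ∪ pairs A := by
  ext ⟨p, q⟩
  simp only [mem_pairs, mem_insert, mem_union, mem_image, Prod.mk.injEq]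
  constructor
  · rintro ⟨rfl | hp, rfl | hq, hpq⟩
    · exact absurd hpq (lt_irrefl _)
    · exact Or.inl ⟨q, hq, min_eq_left hpq.le, max_eq_right hpq.le⟩
    · exact Or.inl ⟨p, hp, min_eq_right hpq.le, max_eq_left hpq.le⟩
    · exact Or.inr ⟨hp, hq, hpq⟩
  · rintro (⟨j, hj, rfl, rfl⟩ | ⟨hp, hq, hpq⟩)
    · have hij : i ≠ j := fun h => hi (h ▸ hj)
      rcases lt_or_gt_of_ne hij with h | h
      · simp [min_eq_left h.le, max_eq_right h.le, hj, h]
      · simp [min_eq_right h.le, max_eq_left h.le, hj, h]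
    · exact ⟨Or.inr hp, Or.inr hq, hpq⟩

variable {M : Type*} [CommMonoid M]

@[to_additive]
lemma prod_pairs_insert {f : V → V → M} (hf : ∀ i j, f i j = f j i) {A : Finset V} {i : V}
    (hi : i ∉ A) :
    ∏ p ∈ pairs (insert i A), f p.1 p.2 = (∏ j ∈ A, f i j) * ∏ p ∈ pairs A, f p.1 p.2 := by
  have hd : Disjoint (A.image (fun j => (min i j, max i j))) (pairs A) := by
    rw [Finset.disjoint_left]
    rintro _ h h'
    obtain ⟨j, -, rfl⟩ := mem_image.1 h
    obtain ⟨h1, h2, -⟩ := mem_pairs.1 h'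
    rcases le_total i j with hij | hij
    · rw [min_eq_left hij] at h1; exact hi h1
    · rw [max_eq_left hij] at h2; exact hi h2
  rw [pairs_insert hi, prod_union hd, prod_image]
  · congr 1
    refine prod_congr rfl fun j _ => ?_
    rcases le_total i j with hij | hij
    · simp [hij]
    · simp [hij, hf i j]
  · intro j hj k hk hjk
    simp only [Prod.mk.injEq] at hjk
    rcases le_total i j with h1 | h1 <;> rcases le_total i k with h2 | h2 <;>
      simp_all

@[to_additive]
lemma prod_pairs_union {f : V → V → M} (hf : ∀ i j, f i j = f j i) {A B : Finset V}
    (h : Disjoint A B) :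
    ∏ p ∈ pairs (A ∪ B), f p.1 p.2 =
      (∏ p ∈ pairs A, f p.1 p.2) * (∏ p ∈ pairs B, f p.1 p.2) * ∏ i ∈ A, ∏ j ∈ B, f i j := by
  induction A using Finset.induction_on with
  | empty => simp
  | insert i A hi ih =>
    rw [disjoint_insert_left] at h
    have hi' : i ∉ A ∪ B := by simp [hi, h.1]
    rw [insert_union, prod_pairs_insert hf hi', prod_pairs_insert hf hi, ih h.2,
      prod_union h.2, prod_insert hi]
    ac_rfl

lemma prod_prod_erase {f : V → V → M} (hf : ∀ i j, f i j = f j i) (A : Finset V) :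
    ∏ i ∈ A, ∏ j ∈ A.erase i, f i j = (∏ p ∈ pairs A, f p.1 p.2) ^ 2 := by
  induction A using Finset.induction_on with
  | empty => simp
  | insert i A hi ih =>
    have h : ∀ k ∈ A, ∏ j ∈ (insert i A).erase k, f k j = f i k * ∏ j ∈ A.erase k, f k j := by
      intro k hk
      have hik : i ≠ k := fun h => hi (h ▸ hk)
      rw [erase_insert_of_ne hik, prod_insert (by simp [hi]), hf]
    rw [prod_insert hi, erase_insert hi, prod_congr rfl h, prod_mul_distrib, ih,
      prod_pairs_insert hf hi, mul_pow, sq (∏ j ∈ A, f i j), mul_assoc]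

lemma prod_pairs_map {V' : Type*} [LinearOrder V'] (e : V' ↪o V) (f : V → V → M)
    (A : Finset V') :
    ∏ p ∈ pairs (A.map e.toEmbedding), f p.1 p.2 = ∏ p ∈ pairs A, f (e p.1) (e p.2) := by
  symm
  refine prod_nbij (fun p => (e p.1, e p.2)) ?_ ?_ ?_ ?_
  · intro p hp
    simpa [mem_pairs] using hp
  · intro p _ q _ h
    simpa [Prod.ext_iff] using h
  · rintro ⟨p, q⟩ hp
    simp only [mem_coe, mem_pairs, mem_map, RelEmbedding.coe_toEmbedding] at hp
    obtain ⟨⟨i, hi, rfl⟩, ⟨j, hj, rfl⟩, hij⟩ := hp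
    exact ⟨(i, j), by simpa [mem_pairs, hi, hj] using hij, rfl⟩
  · simp

end Pairs

section EdgeGraph

variable {V : Type*}

/-- The graph with edges `{i, j}` for `(i, j) ∈ E`. -/
def edgeGraph (E : Finset (V × V)) : SimpleGraph V := SimpleGraph.fromRel fun i j => (i, j) ∈ E

/-- Any two vertices of `A` are joined by a path with edges in `E`. -/
def Connects (E : Finset (V × V)) (A : Finset V) : Prop :=
  ∀ i ∈ A, ∀ j ∈ A, (edgeGraph E).Reachable i j

lemma edgeGraph_mono {E F : Finset (V × V)} (h : E ⊆ F) : edgeGraph E ≤ edgeGraph F := by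
  intro i j hij
  simp only [edgeGraph, SimpleGraph.fromRel_adj] at hij ⊢
  exact ⟨hij.1, hij.2.imp (@h _) (@h _)⟩

lemma reachable_mono {E F : Finset (V × V)} (h : E ⊆ F) {i j : V}
    (hij : (edgeGraph E).Reachable i j) : (edgeGraph F).Reachable i j :=
  hij.mono (edgeGraph_mono h)

end EdgeGraph

section Mayer

variable {V : Type*} [LinearOrder V]

/-- `∏_{i<j} (1 + ζ i j)` over pairs of elements of `A`. -/
def boltz (ζ : V → V → ℂ) (A : Finset V) : ℂ := ∏ p ∈ pairs A, (1 + ζ p.1 p.2)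

open Classical in
/-- The sum over connected graphs on `A` of the products of `ζ` over edges. -/
def mayer (ζ : V → V → ℂ) (A : Finset V) : ℂ :=
  ∑ E ∈ (pairs A).powerset with Connects E A, ∏ p ∈ E, ζ p.1 p.2

@[simp] lemma boltz_empty (ζ : V → V → ℂ) : boltz ζ ∅ = 1 := by simp [boltz]

lemma reachable_inter_pairs {E : Finset (V × V)} {X A : Finset V} {r : V} (hE : E ⊆ pairs X)
    (hr : r ∈ A) (hA : ∀ v ∈ X, (edgeGraph E).Reachable r v → v ∈ A) {v : V}
    (h : (edgeGraph E).Reachable r v) : v ∈ A ∧ (edgeGraph (E ∩ pairs A)).Reachable r v := by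
  rw [SimpleGraph.reachable_iff_reflTransGen] at h
  induction h with
  | refl => exact ⟨hr, SimpleGraph.Reachable.refl _⟩
  | @tail b c hb hbc ih =>
    have hrc : (edgeGraph E).Reachable r c := by
      rw [SimpleGraph.reachable_iff_reflTransGen]; exact hb.tail hbc
    have hcA : c ∈ A := by
      refine hA c ?_ hrc
      simp only [edgeGraph, SimpleGraph.fromRel_adj] at hbc
      rcases hbc.2 with h | h
      · exact (mem_pairs.1 (hE h)).2.1
      · exact (mem_pairs.1 (hE h)).1
    refine ⟨hcA, ih.2.trans (SimpleGraph.Adj.reachable ?_)⟩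
    simp only [edgeGraph, SimpleGraph.fromRel_adj, mem_inter] at hbc ⊢
    refine ⟨hbc.1, hbc.2.imp (fun h => ⟨h, ?_⟩) (fun h => ⟨h, ?_⟩)⟩
    · exact mem_pairs.2 ⟨ih.1, hcA, (mem_pairs.1 (hE h)).2.2⟩
    · exact mem_pairs.2 ⟨hcA, ih.1, (mem_pairs.1 (hE h)).2.2⟩

lemma mem_of_reachable_union {E F : Finset (V × V)} {A B : Finset V} {r : V} (hE : E ⊆ pairs A)
    (hF : F ⊆ pairs B) (hAB : Disjoint A B) (hr : r ∈ A) {v : V}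
    (h : (edgeGraph (E ∪ F)).Reachable r v) : v ∈ A := by
  rw [SimpleGraph.reachable_iff_reflTransGen] at h
  induction h with
  | refl => exact hr
  | @tail b c hb hbc ih =>
    simp only [edgeGraph, SimpleGraph.fromRel_adj, mem_union] at hbc
    rcases hbc.2 with (h | h) | (h | h)
    · exact (mem_pairs.1 (hE h)).2.1
    · exact absurd (mem_pairs.1 (hF h)).1 (Finset.disjoint_left.1 hAB ih)
    · exact (mem_pairs.1 (hE h)).1
    · exact absurd (mem_pairs.1 (hF h)).2.1 (Finset.disjoint_left.1 hAB ih)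

open Classical in
/-- Grouping the graphs on `X` according to the connected component of `r`. -/
lemma boltz_eq_sum_mayer (ζ : V → V → ℂ) {X : Finset V} {r : V} (hr : r ∈ X) :
    boltz ζ X = ∑ A ∈ X.powerset with r ∈ A, mayer ζ A * boltz ζ (X \ A) := by
  have hmaps : ∀ E ∈ (pairs X).powerset,
      X.filter (fun v => (edgeGraph E).Reachable r v) ∈ X.powerset.filter (fun A => r ∈ A) := by
    intro E _
    simp [hr]
  rw [boltz, prod_one_add, ← sum_fiberwise_of_maps_to hmaps]
  refine sum_congr rfl fun A hA => ?_
  simp only [mem_filter, mem_powerset] at hA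
  obtain ⟨hAX, hrA⟩ := hA
  have hdisj : Disjoint A (X \ A) := disjoint_sdiff
  have hsub : ∀ E ⊆ pairs X, X.filter (fun v => (edgeGraph E).Reachable r v) = A →
      E ⊆ pairs A ∪ pairs (X \ A) := by
    intro E hE hEA p hp
    obtain ⟨h1, h2, h3⟩ := mem_pairs.1 (hE hp)
    have hadj : (edgeGraph E).Adj p.1 p.2 := by
      simp only [edgeGraph, SimpleGraph.fromRel_adj]
      exact ⟨h3.ne, Or.inl hp⟩
    have hiff : p.1 ∈ A ↔ p.2 ∈ A := by
      rw [← hEA]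
      simp only [mem_filter, h1, h2, true_and]
      exact ⟨fun h => h.trans hadj.reachable, fun h => h.trans hadj.symm.reachable⟩
    simp only [mem_union, mem_pairs, mem_sdiff]
    tauto
  rw [mayer, boltz, prod_one_add, sum_mul_sum, ← sum_product']
  refine sum_nbij' (fun E => (E ∩ pairs A, E ∩ pairs (X \ A))) (fun p => p.1 ∪ p.2) ?_ ?_ ?_ ?_ ?_
  · intro E hE
    simp only [mem_filter, mem_powerset] at hE
    obtain ⟨hE, hEA⟩ := hE
    simp only [mem_product, mem_filter, mem_powerset, inter_subset_right, and_true, true_and]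
    have key : ∀ v ∈ A, (edgeGraph (E ∩ pairs A)).Reachable r v := fun v hv => by
      refine (reachable_inter_pairs hE hrA (fun v hv h => ?_) ?_).2
      · rw [← hEA]; simp [hv, h]
      · rw [← hEA] at hv; simp only [mem_filter] at hv; exact hv.2
    exact fun i hi j hj => (key i hi).symm.trans (key j hj)
  · rintro ⟨E, F⟩ h
    simp only [mem_product, mem_filter, mem_powerset] at h ⊢
    obtain ⟨⟨hE, hc⟩, hF⟩ := h
    refine ⟨union_subset (hE.trans (pairs_mono hAX)) (hF.trans (pairs_mono sdiff_subset)), ?_⟩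
    ext v
    simp only [mem_filter]
    constructor
    · rintro ⟨_, h⟩
      exact mem_of_reachable_union hE hF hdisj hrA h
    · intro hv
      exact ⟨hAX hv, reachable_mono subset_union_left (hc r hrA v hv)⟩
  · intro E hE
    simp only [mem_filter, mem_powerset] at hE
    obtain ⟨hE, hEA⟩ := hE
    rw [← inter_union_distrib_left]
    exact inter_eq_left.2 (hsub E hE hEA)
  · rintro ⟨E, F⟩ h
    simp only [mem_product, mem_filter, mem_powerset] at h
    obtain ⟨⟨hE, -⟩, hF⟩ := h
    have hd := disjoint_pairs hdisj
    simp only [union_inter_distrib_right, inter_eq_left.2 hE, inter_eq_left.2 hF,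
      disjoint_iff_inter_eq_empty.1 (hd.symm.mono_left hF), union_empty,
      disjoint_iff_inter_eq_empty.1 (hd.mono_left hE), empty_union]
  · intro E hE
    simp only [mem_filter, mem_powerset] at hE
    obtain ⟨hE, hEA⟩ := hE
    rw [← prod_union ((disjoint_pairs hdisj).mono inter_subset_right inter_subset_right),
      ← inter_union_distrib_left]
    rw [inter_eq_left.2 (hsub E hE hEA)]

lemma sum_powerset_mem_eq_add {M : Type*} [AddCommMonoid M] {X : Finset V} {r : V} (hr : r ∈ X)
    (F : Finset V → M) :
    ∑ A ∈ X.powerset with r ∈ A, F A = F X + ∑ A ∈ X.ssubsets with r ∈ A, F A := by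
  have : X.powerset.filter (fun A => r ∈ A) = insert X (X.ssubsets.filter fun A => r ∈ A) := by
    ext A
    simp only [mem_filter, mem_powerset, mem_insert, mem_ssubsets, ssubset_iff_subset_ne]
    by_cases h : A = X
    · simp [h, hr]
    · simp [h]
  rw [this, sum_insert (by simp)]

lemma mayer_eq_sub (ζ : V → V → ℂ) {X : Finset V} {r : V} (hr : r ∈ X) :
    mayer ζ X = boltz ζ X - ∑ A ∈ X.ssubsets with r ∈ A, mayer ζ A * boltz ζ (X \ A) := by
  rw [boltz_eq_sum_mayer ζ hr, sum_powerset_mem_eq_add hr]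
  simp

/-- The recursion over the component of `r` determines `mayer` on the sets containing `r`. -/
lemma eq_mayer_of_forall {ζ : V → V → ℂ} {r : V} {f : Finset V → ℂ}
    (hf : ∀ X : Finset V, r ∈ X → boltz ζ X = ∑ A ∈ X.powerset with r ∈ A, f A * boltz ζ (X \ A))
    (X : Finset V) (hr : r ∈ X) : f X = mayer ζ X := by
  induction X using Finset.strongInduction with
  | H X ih =>
    have h := hf X hr
    rw [sum_powerset_mem_eq_add hr] at h
    have h' : ∑ A ∈ X.ssubsets with r ∈ A, f A * boltz ζ (X \ A) =
        ∑ A ∈ X.ssubsets with r ∈ A, mayer ζ A * boltz ζ (X \ A) := by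
      refine sum_congr rfl fun A hA => ?_
      simp only [mem_filter, mem_ssubsets] at hA
      rw [ih A hA.1 hA.2]
    rw [mayer_eq_sub ζ hr, h, h']
    simp

lemma boltz_map {V' : Type*} [LinearOrder V'] (e : V' ↪o V) (ζ : V → V → ℂ) (A : Finset V') :
    boltz ζ (A.map e.toEmbedding) = boltz (fun i j => ζ (e i) (e j)) A :=
  prod_pairs_map e (fun i j => 1 + ζ i j) A

lemma mayer_map {V' : Type*} [LinearOrder V'] (e : V' ↪o V) (ζ : V → V → ℂ) {A : Finset V'}
    (hA : A.Nonempty) :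
    mayer ζ (A.map e.toEmbedding) = mayer (fun i j => ζ (e i) (e j)) A := by
  obtain ⟨r, hr⟩ := hA
  refine eq_mayer_of_forall (r := r) (f := fun A => mayer ζ (A.map e.toEmbedding))
    (fun X hX => ?_) A hr
  rw [← boltz_map, boltz_eq_sum_mayer ζ (mem_map_of_mem _ hX)]
  symm
  refine sum_nbij (fun A => A.map e.toEmbedding) ?_ ?_ ?_ ?_
  · intro A hA
    simpa using hA
  · intro A _ B _ h
    exact map_injective _ h
  · intro B hB
    simp only [coe_filter, mem_powerset, Set.mem_ofPred_eq, subset_map_iff] at hB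
    obtain ⟨⟨A, hA, rfl⟩, hr⟩ := hB
    exact ⟨A, by simpa [hA] using hr, rfl⟩
  · intro A _
    rw [← boltz_map, Finset.map_sdiff]

lemma mayer_zero {X : Finset V} {r : V} (hr : r ∈ X) :
    mayer (fun _ _ => 0) X = if X = {r} then 1 else 0 := by
  symm
  refine eq_mayer_of_forall (r := r) (f := fun X => if X = {r} then 1 else 0) (fun Y hY => ?_) X hr
  simp only [boltz, add_zero, prod_const_one, mul_one]
  rw [sum_ite_eq' _ ({r} : Finset V)]
  simp [hY]

end Mayer

section PeelSum

variable {V S : Type*} [DecidableEq V] [CommSemiring S]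

/-- The solution of the recursion that removes the root `ι R` from a nonempty set of roots `R`,
and turns a subset `K` of the other vertices `Y` into roots. -/
def peelSum (ι : ∀ R : Finset V, R.Nonempty → R) (c : Finset V → V → S) (w : V → V → S)
    (R Y : Finset V) : S :=
  if h : R.Nonempty then
    c R (ι R h) * ∑ K ∈ Y.powerset.attach,
      (∏ k ∈ K.1, w (ι R h) k) * peelSum ι c w (R.erase (ι R h) ∪ K.1) (Y \ K.1)
  else if Y = ∅ then 1 else 0
termination_by #R + #Y
decreasing_by
  have h1 : #(R.erase (ι R h) ∪ K.1) ≤ #R - 1 + #K.1 := by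
    refine (card_union_le _ _).trans ?_
    rw [card_erase_of_mem (ι R h).2]
  have h2 := card_sdiff_of_subset (mem_powerset.1 K.2)
  have h3 := card_le_card (mem_powerset.1 K.2)
  have h4 := h.card_pos
  omega

lemma peelSum_empty (ι : ∀ R : Finset V, R.Nonempty → R) (c : Finset V → V → S) (w : V → V → S)
    (Y : Finset V) : peelSum ι c w ∅ Y = if Y = ∅ then 1 else 0 := by
  rw [peelSum]; simp

lemma peelSum_of_nonempty (ι : ∀ R : Finset V, R.Nonempty → R) (c : Finset V → V → S)
    (w : V → V → S) {R : Finset V} (h : R.Nonempty) (Y : Finset V) :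
    peelSum ι c w R Y = c R (ι R h) * ∑ K ∈ Y.powerset,
      (∏ k ∈ K, w (ι R h) k) * peelSum ι c w (R.erase (ι R h) ∪ K) (Y \ K) := by
  rw [peelSum, dif_pos h, ← sum_attach Y.powerset]

lemma card_erase_union_add_card_sdiff_lt {R Y K : Finset V} {i : V} (hi : i ∈ R) (hK : K ⊆ Y) :
    #(R.erase i ∪ K) + #(Y \ K) < #R + #Y := by
  have h1 : #(R.erase i ∪ K) ≤ #R - 1 + #K := by
    refine (card_union_le _ _).trans ?_
    rw [card_erase_of_mem hi]
  have h2 := card_sdiff_of_subset hK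
  have h3 := card_le_card hK
  have h4 := card_pos.2 ⟨i, hi⟩
  omega

lemma disjoint_erase_union_sdiff {R Y K : Finset V} (h : Disjoint R Y) (i : V) :
    Disjoint (R.erase i ∪ K) (Y \ K) :=
  disjoint_union_left.2 ⟨h.mono (erase_subset _ _) sdiff_subset, disjoint_sdiff⟩

/-- Induction that removes a root and turns a set of other vertices into roots. -/
lemma peel_induction {P : Finset V → Finset V → Prop} (h0 : ∀ Y, P ∅ Y)
    (h1 : ∀ R Y, R.Nonempty → Disjoint R Y →
      (∀ i ∈ R, ∀ K ⊆ Y, P (R.erase i ∪ K) (Y \ K)) → P R Y)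
    (R Y : Finset V) (hRY : Disjoint R Y) : P R Y := by
  suffices ∀ n, ∀ R Y : Finset V, Disjoint R Y → #R + #Y = n → P R Y from this _ R Y hRY rfl
  intro n
  induction n using Nat.strong_induction_on with
  | _ n ih =>
    intro R Y hRY hn
    rcases R.eq_empty_or_nonempty with rfl | hR
    · exact h0 Y
    · refine h1 R Y hR hRY fun i hi K hK => ?_
      exact ih _ (hn ▸ card_erase_union_add_card_sdiff_lt hi hK) _ _
        (disjoint_erase_union_sdiff hRY i) rfl

end PeelSum

section Forest

variable {V S : Type*} [LinearOrder V] [CommSemiring S]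

/-- The weighted sum over the forests on `R ∪ Y` such that each tree contains exactly one element
of `R`; an edge from a parent `i` to a child `k` has weight `w i k`. -/
def forest (w : V → V → S) (R Y : Finset V) : S :=
  peelSum (fun R h => ⟨R.min' h, R.min'_mem h⟩) (fun _ _ => 1) w R Y

lemma forest_empty_left (w : V → V → S) (Y : Finset V) :
    forest w ∅ Y = if Y = ∅ then 1 else 0 := peelSum_empty _ _ _ _

lemma forest_eq_min (w : V → V → S) {R : Finset V} (h : R.Nonempty) (Y : Finset V) :
    forest w R Y = ∑ K ∈ Y.powerset,
      (∏ k ∈ K, w (R.min' h) k) * forest w (R.erase (R.min' h) ∪ K) (Y \ K) := by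
  rw [forest, peelSum_of_nonempty _ _ _ h, one_mul]
  rfl

/-- The children of any root `i` can be summed over first. -/
lemma forest_eq_sum (w : V → V → S) {R Y : Finset V} (hRY : Disjoint R Y) {i : V} (hi : i ∈ R) :
    forest w R Y = ∑ K ∈ Y.powerset, (∏ k ∈ K, w i k) * forest w (R.erase i ∪ K) (Y \ K) := by
  refine peel_induction (P := fun R Y => ∀ i : V, i ∈ R → forest w R Y =
    ∑ K ∈ Y.powerset, (∏ k ∈ K, w i k) * forest w (R.erase i ∪ K) (Y \ K)) ?_ ?_ R Y hRY i hi
  · intro Y i hi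
    simp at hi
  · intro R Y hR hRY ih i hi
    rw [forest_eq_min w hR]
    generalize hm : R.min' hR = m
    have hmR : m ∈ R := hm ▸ R.min'_mem hR
    by_cases hmi : m = i
    · rw [hmi]
    have expand : ∀ a ∈ R, ∀ b ∈ R, a ≠ b → ∑ K ∈ Y.powerset, (∏ k ∈ K, w a k) *
        forest w (R.erase a ∪ K) (Y \ K) = ∑ K ∈ Y.powerset, ∑ L ∈ (Y \ K).powerset,
          (∏ k ∈ K, w a k) * (∏ k ∈ L, w b k) *
            forest w ((R.erase a).erase b ∪ (K ∪ L)) (Y \ (K ∪ L)) := by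
      intro a ha b hb hab
      refine sum_congr rfl fun K hK => ?_
      rw [mem_powerset] at hK
      have hbK : b ∉ K := fun h => Finset.disjoint_left.1 hRY hb (hK h)
      rw [ih a ha K hK b (mem_union_left _ (mem_erase.2 ⟨hab.symm, hb⟩)), mul_sum]
      refine sum_congr rfl fun L _ => ?_
      rw [erase_union_distrib, erase_eq_of_notMem hbK, union_assoc, sdiff_sdiff_left, mul_assoc]
      rfl
    rw [expand m hmR i hi hmi, expand i hi m hmR (Ne.symm hmi), sum_powerset_sdiff_comm]
    refine sum_congr rfl fun K _ => sum_congr rfl fun L _ => ?_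
    rw [erase_right_comm, union_comm K L, mul_comm (∏ k ∈ K, w i k)]

lemma forest_empty_right (w : V → V → S) (R : Finset V) : forest w R ∅ = 1 := by
  refine peel_induction (P := fun R Y => Y = ∅ → forest w R Y = 1) ?_ ?_ R ∅ (by simp) rfl
  · rintro Y rfl
    simp [forest_empty_left]
  · rintro R Y ⟨i, hi⟩ hRY ih rfl
    rw [forest_eq_sum w hRY hi]
    simpa using ih i hi ∅ subset_rfl (by simp)

lemma forest_map {V' : Type*} [LinearOrder V'] (e : V' ↪ V) (w : V → V → S) {R Y : Finset V'}
    (hRY : Disjoint R Y) :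
    forest w (R.map e) (Y.map e) = forest (fun i j => w (e i) (e j)) R Y := by
  refine peel_induction (P := fun R Y => forest w (R.map e) (Y.map e) =
    forest (fun i j => w (e i) (e j)) R Y) ?_ ?_ R Y hRY
  · intro Y
    simp [forest_empty_left]
  · rintro R Y ⟨i, hi⟩ hRY ih
    rw [forest_eq_sum w ((disjoint_map e).2 hRY) (mem_map_of_mem e hi), forest_eq_sum _ hRY hi]
    symm
    refine sum_nbij (fun A => A.map e) ?_ ?_ ?_ ?_
    · intro A hA
      simpa using hA
    · intro A _ B _ h
      exact map_injective _ h
    · intro B hB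
      simp only [mem_coe, mem_powerset, subset_map_iff] at hB
      obtain ⟨A, hA, rfl⟩ := hB
      exact ⟨A, by simpa using hA, rfl⟩
    · intro K hK
      rw [mem_powerset] at hK
      rw [← ih i hi K hK, prod_map, map_union, map_erase, Finset.map_sdiff]

lemma map_forest {S' : Type*} [CommSemiring S'] (φ : S →+* S') (w : V → V → S) {R Y : Finset V}
    (hRY : Disjoint R Y) : φ (forest w R Y) = forest (fun i j => φ (w i j)) R Y := by
  refine peel_induction (P := fun R Y => φ (forest w R Y) = forest (fun i j => φ (w i j)) R Y)
    ?_ ?_ R Y hRY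
  · intro Y
    simp only [forest_empty_left]
    split_ifs <;> simp
  · rintro R Y ⟨i, hi⟩ hRY ih
    rw [forest_eq_sum w hRY hi, forest_eq_sum _ hRY hi, map_sum]
    refine sum_congr rfl fun K hK => ?_
    rw [map_mul, map_prod, ih i hi K (mem_powerset.1 hK)]

lemma forest_union (w : V → V → S) {R Y : Finset V} (hRY : Disjoint R Y) {R' : Finset V}
    (hR : Disjoint R' R) (hY : Disjoint R' Y) :
    forest w (R ∪ R') Y = ∑ B ∈ Y.powerset, forest w R (Y \ B) * forest w R' B := by
  revert hR hY
  refine peel_induction (P := fun R Y => Disjoint R' R → Disjoint R' Y →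
    forest w (R ∪ R') Y = ∑ B ∈ Y.powerset, forest w R (Y \ B) * forest w R' B) ?_ ?_ R Y hRY
  · intro Y _ _
    rw [empty_union, sum_eq_single Y]
    · simp [forest_empty_left]
    · intro B hB hBY
      rw [mem_powerset] at hB
      rw [forest_empty_left, if_neg, zero_mul]
      exact fun h => hBY (hB.antisymm (sdiff_eq_empty_iff_subset.1 h))
    · simp
  · rintro R Y ⟨i, hi⟩ hRY ih hR hY
    have hiR' : i ∉ R' := fun h => Finset.disjoint_left.1 hR h hi
    rw [forest_eq_sum w (disjoint_union_left.2 ⟨hRY, hY⟩) (mem_union_left _ hi)]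
    have h1 : ∀ K ∈ Y.powerset, (∏ k ∈ K, w i k) * forest w ((R ∪ R').erase i ∪ K) (Y \ K) =
        ∑ B ∈ (Y \ K).powerset, (∏ k ∈ K, w i k) *
          (forest w (R.erase i ∪ K) ((Y \ B) \ K) * forest w R' B) := by
      intro K hK
      rw [mem_powerset] at hK
      have hu : (R ∪ R').erase i ∪ K = (R.erase i ∪ K) ∪ R' := by
        rw [erase_union_distrib, erase_eq_of_notMem hiR', union_right_comm]
      rw [hu, ih i hi K hK (disjoint_union_right.2 ⟨hR.mono_right (erase_subset _ _),
        hY.mono_right hK⟩) (hY.mono_right sdiff_subset), mul_sum]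
      refine sum_congr rfl fun B _ => ?_
      rw [sdiff_right_comm]
    rw [sum_congr rfl h1, sum_powerset_sdiff_comm]
    refine sum_congr rfl fun B _ => ?_
    rw [forest_eq_sum w (hRY.mono_right sdiff_subset) hi, sum_mul]
    exact sum_congr rfl fun K _ => (mul_assoc _ _ _).symm

/-- The forest sum with one marked edge, whose weight is `f` instead of `w`: the marked edge joins
`v` to its child `j`, and `B` is the set of descendants of `j`. -/
def markedForest (f w : V → V → S) (R Y : Finset V) : S :=
  ∑ B ∈ Y.powerset, ∑ j ∈ B, ∑ v ∈ R ∪ (Y \ B),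
    f v j * (forest w R (Y \ B) * forest w {j} (B.erase j))

lemma markedForest_empty_left (f w : V → V → S) (Y : Finset V) : markedForest f w ∅ Y = 0 := by
  refine sum_eq_zero fun B hB => sum_eq_zero fun j hj => sum_eq_zero fun v hv => ?_
  rw [empty_union] at hv
  rw [forest_empty_left, if_neg (ne_empty_of_mem hv)]
  simp

lemma markedForest_eq_sum (f w : V → V → S) {R Y : Finset V} (hRY : Disjoint R Y) {i : V}
    (hi : i ∈ R) :
    markedForest f w R Y = ∑ K ∈ Y.powerset,
      ((∑ k ∈ K, f i k * ∏ l ∈ K.erase k, w i l) * forest w (R.erase i ∪ K) (Y \ K) +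
        (∏ k ∈ K, w i k) * markedForest f w (R.erase i ∪ K) (Y \ K)) := by
  have hiY : i ∉ Y := Finset.disjoint_left.1 hRY hi
  have hsplit : ∀ B ∈ Y.powerset, ∑ j ∈ B, ∑ v ∈ R ∪ (Y \ B),
      f v j * (forest w R (Y \ B) * forest w {j} (B.erase j)) =
      (∑ j ∈ B, f i j * (forest w R (Y \ B) * forest w {j} (B.erase j))) +
      ∑ K ∈ (Y \ B).powerset, (∏ k ∈ K, w i k) * ∑ j ∈ B, ∑ v ∈ (R.erase i ∪ K) ∪ ((Y \ K) \ B),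
        f v j * (forest w (R.erase i ∪ K) ((Y \ K) \ B) * forest w {j} (B.erase j)) := by
    intro B _
    have hR : R ∪ (Y \ B) = insert i (R.erase i ∪ (Y \ B)) := by
      rw [← insert_union, insert_erase hi]
    have hni : i ∉ R.erase i ∪ (Y \ B) := by simp [hiY]
    simp_rw [hR, sum_insert hni, sum_add_distrib]
    congr 1
    have h1 : ∀ K ∈ (Y \ B).powerset, R.erase i ∪ K ∪ ((Y \ K) \ B) = R.erase i ∪ (Y \ B) := by
      intro K hK
      rw [mem_powerset] at hK
      rw [union_assoc, sdiff_right_comm, union_sdiff_of_subset hK]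
    have h2 : ∀ K ∈ (Y \ B).powerset, (∏ k ∈ K, w i k) *
        ∑ j ∈ B, ∑ v ∈ (R.erase i ∪ K) ∪ ((Y \ K) \ B),
          f v j * (forest w (R.erase i ∪ K) ((Y \ K) \ B) * forest w {j} (B.erase j)) =
        ∑ j ∈ B, ∑ v ∈ R.erase i ∪ (Y \ B), f v j * (((∏ k ∈ K, w i k) *
          forest w (R.erase i ∪ K) ((Y \ B) \ K)) * forest w {j} (B.erase j)) := by
      intro K hK
      rw [h1 K hK, mul_sum]
      refine sum_congr rfl fun j _ => ?_
      rw [mul_sum]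
      refine sum_congr rfl fun v _ => ?_
      rw [sdiff_right_comm]
      ac_rfl
    rw [sum_congr rfl h2, sum_comm (s := (Y \ B).powerset)]
    refine sum_congr rfl fun j _ => ?_
    rw [sum_comm (s := (Y \ B).powerset)]
    refine sum_congr rfl fun v _ => ?_
    rw [forest_eq_sum w (hRY.mono_right sdiff_subset) hi, sum_mul, mul_sum]
  rw [markedForest, sum_congr rfl hsplit, sum_add_distrib, sum_add_distrib]
  congr 1
  · simp_rw [sum_mul]
    rw [sum_powerset_mem Y fun B j => f i j * (forest w R (Y \ B) * forest w {j} (B.erase j)),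
      sum_powerset_mem Y fun K k =>
        f i k * (∏ l ∈ K.erase k, w i l) * forest w (R.erase i ∪ K) (Y \ K)]
    refine sum_congr rfl fun j hj => ?_
    have hjY' : Disjoint {j} (Y.erase j) := by simp
    have hij : i ≠ j := fun h => hiY (h ▸ hj)
    have h1 : ∀ B ∈ (Y.erase j).powerset, f i j * (forest w R (Y \ insert j B) *
        forest w {j} ((insert j B).erase j)) = ∑ K ∈ (Y.erase j \ B).powerset,
          f i j * (∏ k ∈ K, w i k) *
            (forest w (R.erase i ∪ K) ((Y.erase j \ K) \ B) * forest w {j} B) := by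
      intro B hB
      rw [mem_powerset, subset_erase] at hB
      have hs : Y \ insert j B = Y.erase j \ B := by
        ext v; simp only [mem_sdiff, mem_insert, mem_erase]; tauto
      rw [erase_insert hB.2, hs, forest_eq_sum w
        (hRY.mono_right (sdiff_subset.trans (erase_subset _ _))) hi, sum_mul, mul_sum]
      refine sum_congr rfl fun K _ => ?_
      rw [sdiff_right_comm]
      ac_rfl
    rw [sum_congr rfl h1, sum_powerset_sdiff_comm]
    refine sum_congr rfl fun K hK => ?_
    rw [mem_powerset, subset_erase] at hK
    have hs : Y \ insert j K = Y.erase j \ K := by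
      ext v; simp only [mem_sdiff, mem_insert, mem_erase]; tauto
    have hu : R.erase i ∪ insert j K = (R.erase i ∪ K) ∪ {j} := by
      ext v; simp only [mem_union, mem_insert, mem_erase, mem_singleton]; tauto
    have hjR : j ∉ R := fun h => Finset.disjoint_left.1 hRY h hj
    rw [erase_insert hK.2, hs, hu, forest_union w, mul_sum]
    · refine (disjoint_erase_union_sdiff ?_ i)
      exact hRY.mono_right (erase_subset _ _)
    · simp [hjR, hK.2]
    · simp
  · rw [sum_powerset_sdiff_comm]
    refine sum_congr rfl fun K _ => ?_
    rw [markedForest, mul_sum]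

end Forest

section KirkwoodSalsburg

variable {V : Type*} [LinearOrder V]

lemma forest_nonneg {w : V → V → ℝ} (hw : ∀ i j, 0 ≤ w i j) {R Y : Finset V}
    (hRY : Disjoint R Y) : 0 ≤ forest w R Y := by
  refine peel_induction (P := fun R Y => 0 ≤ forest w R Y) ?_ ?_ R Y hRY
  · intro Y
    rw [forest_empty_left]
    split_ifs <;> norm_num
  · rintro R Y ⟨i, hi⟩ hRY ih
    rw [forest_eq_sum w hRY hi]
    exact sum_nonneg fun K hK => mul_nonneg (prod_nonneg fun k _ => hw i k)
      (ih i hi K (mem_powerset.1 hK))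

/-- The sum over the graphs on `R ∪ Y` such that each vertex is connected to an element of `R`,
computed with the Kirkwood–Salsburg recursion. -/
def kirkwoodSalsburg (ι : ∀ R : Finset V, R.Nonempty → R) (ζ : V → V → ℂ) (R Y : Finset V) : ℂ :=
  peelSum ι (fun R i => ∏ j ∈ R.erase i, (1 + ζ i j)) ζ R Y

lemma boltz_insert {ζ : V → V → ℂ} (hζ : ∀ i j, ζ i j = ζ j i) {A : Finset V} {i : V}
    (hi : i ∉ A) : boltz ζ (insert i A) = (∏ j ∈ A, (1 + ζ i j)) * boltz ζ A :=
  prod_pairs_insert (f := fun i j => 1 + ζ i j) (fun i j => by rw [hζ]) hi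

lemma boltz_union_eq_sum (ι : ∀ R : Finset V, R.Nonempty → R) {ζ : V → V → ℂ}
    (hζ : ∀ i j, ζ i j = ζ j i) {R Y : Finset V} (hRY : Disjoint R Y) :
    boltz ζ (R ∪ Y) = ∑ K ∈ Y.powerset, kirkwoodSalsburg ι ζ R K * boltz ζ (Y \ K) := by
  refine peel_induction (P := fun R Y => boltz ζ (R ∪ Y) =
    ∑ K ∈ Y.powerset, kirkwoodSalsburg ι ζ R K * boltz ζ (Y \ K)) ?_ ?_ R Y hRY
  · intro Y
    rw [sum_eq_single ∅]
    · simp [kirkwoodSalsburg, peelSum_empty]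
    · intro B _ hB
      simp [kirkwoodSalsburg, peelSum_empty, hB]
    · simp
  · rintro R Y hR hRY ih
    obtain ⟨i, hi, hι⟩ : ∃ i ∈ R, (ι R hR : V) = i := ⟨ι R hR, (ι R hR).2, rfl⟩
    have hiY : i ∉ Y := Finset.disjoint_left.1 hRY hi
    have hd : Disjoint (R.erase i) Y := hRY.mono_left (erase_subset _ _)
    have h1 : R ∪ Y = insert i (R.erase i ∪ Y) := by rw [← insert_union, insert_erase hi]
    have h2 : ∀ K ∈ Y.powerset, kirkwoodSalsburg ι ζ R K * boltz ζ (Y \ K) =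
        ∑ L ∈ K.powerset, (∏ j ∈ R.erase i, (1 + ζ i j)) * ((∏ k ∈ L, ζ i k) *
          (kirkwoodSalsburg ι ζ (R.erase i ∪ L) (K \ L) * boltz ζ (Y \ K))) := by
      intro K _
      rw [kirkwoodSalsburg, peelSum_of_nonempty _ _ _ hR, hι, mul_assoc, sum_mul, mul_sum]
      exact sum_congr rfl fun L _ => by rw [kirkwoodSalsburg]; ring
    rw [sum_congr rfl h2, sum_powerset_powerset, h1, boltz_insert hζ (by simp [hiY]),
      prod_union hd, prod_one_add (s := Y), mul_assoc, sum_mul, mul_sum]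
    refine sum_congr rfl fun K hK => ?_
    rw [mem_powerset] at hK
    have h3 : R.erase i ∪ Y = (R.erase i ∪ K) ∪ (Y \ K) := by
      rw [union_assoc, union_sdiff_of_subset hK]
    rw [h3, ih i hi K hK, mul_sum, mul_sum]
    refine sum_congr rfl fun L hL => ?_
    rw [mem_powerset, subset_sdiff] at hL
    rw [union_sdiff_cancel_left hL.2.symm, sdiff_sdiff_left]
    rfl

lemma mayer_eq_kirkwoodSalsburg (ι : ∀ R : Finset V, R.Nonempty → R) {ζ : V → V → ℂ}
    (hζ : ∀ i j, ζ i j = ζ j i) {X : Finset V} {r : V} (hr : r ∈ X) :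
    mayer ζ X = kirkwoodSalsburg ι ζ {r} (X.erase r) := by
  symm
  refine eq_mayer_of_forall (f := fun X => kirkwoodSalsburg ι ζ {r} (X.erase r))
    (fun X hr => ?_) X hr
  have h := boltz_union_eq_sum ι hζ (R := {r}) (Y := X.erase r) (by simp)
  rw [← insert_eq, insert_erase hr] at h
  rw [h, sum_powerset_filter_mem hr]
  refine sum_congr rfl fun K hK => ?_
  rw [mem_powerset, subset_erase] at hK
  have hs : X \ insert r K = X.erase r \ K := by
    ext v; simp only [mem_sdiff, mem_insert, mem_erase]; tauto
  rw [erase_insert hK.2, hs]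

lemma exists_prod_le_exp_two_mul {ζ : V → V → ℂ} (hζ : ∀ i j, ζ i j = ζ j i) {b : V → ℝ}
    {R : Finset V} (hR : R.Nonempty)
    (hst : ∏ p ∈ pairs R, ‖1 + ζ p.1 p.2‖ ≤ ∏ i ∈ R, Real.exp (b i)) :
    ∃ i ∈ R, ∏ j ∈ R.erase i, ‖1 + ζ i j‖ ≤ Real.exp (2 * b i) := by
  by_contra! hcon
  have h1 : ∏ i ∈ R, Real.exp (2 * b i) < ∏ i ∈ R, ∏ j ∈ R.erase i, ‖1 + ζ i j‖ :=
    prod_lt_prod_of_nonempty (fun i _ => Real.exp_pos _) hcon hR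
  have h2 : ∏ i ∈ R, Real.exp (2 * b i) = (∏ i ∈ R, Real.exp (b i)) ^ 2 := by
    rw [← prod_pow]
    refine prod_congr rfl fun i _ => ?_
    rw [sq, ← Real.exp_add, two_mul]
  rw [prod_prod_erase (f := fun i j => ‖1 + ζ i j‖) (fun i j => by rw [hζ]), h2] at h1
  exact absurd (pow_le_pow_left₀ (prod_nonneg fun _ _ => norm_nonneg _) hst 2) (not_le.2 h1)

lemma norm_kirkwoodSalsburg_le {ι : ∀ R : Finset V, R.Nonempty → R} {ζ : V → V → ℂ} {b : V → ℝ}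
    (hι : ∀ R h, ∏ j ∈ R.erase (ι R h), ‖1 + ζ (ι R h) j‖ ≤ Real.exp (2 * b (ι R h)))
    {R Y : Finset V} (hRY : Disjoint R Y) :
    ‖kirkwoodSalsburg ι ζ R Y‖ ≤
      (∏ i ∈ R ∪ Y, Real.exp (2 * b i)) * forest (fun i j => ‖ζ i j‖) R Y := by
  refine peel_induction (P := fun R Y => ‖kirkwoodSalsburg ι ζ R Y‖ ≤
      (∏ i ∈ R ∪ Y, Real.exp (2 * b i)) * forest (fun i j => ‖ζ i j‖) R Y) ?_ ?_ R Y hRY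
  · intro Y
    rw [kirkwoodSalsburg, peelSum_empty, forest_empty_left]
    split_ifs with h
    · simp [h]
    · simp
  · intro R Y hR hRY ih
    obtain ⟨i, hi, hιi⟩ : ∃ i ∈ R, (ι R hR : V) = i := ⟨ι R hR, (ι R hR).2, rfl⟩
    have hiY : i ∉ Y := Finset.disjoint_left.1 hRY hi
    have hc := hι R hR
    rw [hιi] at hc
    rw [kirkwoodSalsburg, peelSum_of_nonempty _ _ _ hR, hιi, forest_eq_sum _ hRY hi, norm_mul,
      norm_prod]
    have h1 : R ∪ Y = insert i (R.erase i ∪ Y) := by rw [← insert_union, insert_erase hi]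
    rw [h1, prod_insert (by simp [hiY]), mul_assoc]
    refine mul_le_mul hc ?_ (norm_nonneg _) (Real.exp_pos _).le
    rw [mul_sum]
    refine (norm_sum_le _ _).trans (sum_le_sum fun K hK => ?_)
    rw [mem_powerset] at hK
    have h3 : R.erase i ∪ Y = (R.erase i ∪ K) ∪ (Y \ K) := by
      rw [union_assoc, union_sdiff_of_subset hK]
    rw [norm_mul, norm_prod, h3, mul_left_comm]
    exact mul_le_mul_of_nonneg_left (ih i hi K hK) (prod_nonneg fun _ _ => norm_nonneg _)

/-- The tree bound on connected graph sums that follows from the Kirkwood–Salsburg recursion. -/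
theorem norm_mayer_le_forest_zeta {ζ : V → V → ℂ} (hζ : ∀ i j, ζ i j = ζ j i) {b : V → ℝ}
    (hst : ∀ R : Finset V, ∏ p ∈ pairs R, ‖1 + ζ p.1 p.2‖ ≤ ∏ i ∈ R, Real.exp (b i))
    {X : Finset V} {r : V} (hr : r ∈ X) :
    ‖mayer ζ X‖ ≤
      (∏ i ∈ X, Real.exp (2 * b i)) * forest (fun i j => ‖ζ i j‖) {r} (X.erase r) := by
  choose ι hιR hι using fun (R : Finset V) (h : R.Nonempty) =>
    exists_prod_le_exp_two_mul hζ h (hst R)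
  have h := norm_kirkwoodSalsburg_le (ι := fun R h => ⟨ι R h, hιR R h⟩) hι
    (R := {r}) (Y := X.erase r) (by simp)
  rwa [← mayer_eq_kirkwoodSalsburg _ hζ hr, ← insert_eq, insert_erase hr] at h

end KirkwoodSalsburg

section MarkedForest

variable {V : Type*} [LinearOrder V]

lemma markedForest_add_mul (f g : V → V → ℝ) (c : ℝ) (w : V → V → ℝ) (R Y : Finset V) :
    markedForest (fun i j => f i j + c * g i j) w R Y =
      markedForest f w R Y + c * markedForest g w R Y := by
  simp only [markedForest, add_mul, sum_add_distrib, mul_sum, mul_assoc]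

lemma hasDerivAt_forest {w : ℝ → V → V → ℝ} {f : V → V → ℝ} {t : ℝ}
    (hw : ∀ i j, HasDerivAt (fun t => w t i j) (f i j) t) {R Y : Finset V} (hRY : Disjoint R Y) :
    HasDerivAt (fun t => forest (w t) R Y) (markedForest f (w t) R Y) t := by
  refine peel_induction (P := fun R Y =>
    HasDerivAt (fun t => forest (w t) R Y) (markedForest f (w t) R Y) t) ?_ ?_ R Y hRY
  · intro Y
    simp_rw [forest_empty_left, markedForest_empty_left]
    exact hasDerivAt_const _ _
  · rintro R Y ⟨i, hi⟩ hRY ih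
    simp_rw [fun t => forest_eq_sum (w t) hRY hi]
    rw [markedForest_eq_sum f (w t) hRY hi]
    refine HasDerivAt.fun_sum fun K hK => ?_
    have h1 := HasDerivAt.fun_finsetProd (u := K) (f := fun k t => w t i k)
      (f' := fun k => f i k) (x := t) (fun k _ => hw i k)
    refine (h1.mul (ih i hi K (mem_powerset.1 hK))).congr_deriv ?_
    simp only [smul_eq_mul, mul_comm (f i _)]

lemma markedForest_le {f w κ : V → V → ℝ} (hw : ∀ i j, 0 ≤ w i j) (hκ0 : ∀ i j, 0 ≤ κ i j)
    (hκ : ∀ i j, κ i j = κ j i) (hf : ∀ i j, f i j ≤ κ i j * w i j) {R Y : Finset V}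
    (hRY : Disjoint R Y) :
    markedForest f w R Y ≤ (∑ p ∈ pairs (R ∪ Y), κ p.1 p.2) * forest w R Y := by
  refine peel_induction (P := fun R Y =>
    markedForest f w R Y ≤ (∑ p ∈ pairs (R ∪ Y), κ p.1 p.2) * forest w R Y) ?_ ?_ R Y hRY
  · intro Y
    rw [markedForest_empty_left, forest_empty_left]
    have := sum_nonneg (s := pairs (∅ ∪ Y)) fun p _ => hκ0 p.1 p.2
    split_ifs
    · rwa [mul_one]
    · rw [mul_zero]
  · rintro R Y ⟨i, hi⟩ hRY ih
    have hiY : i ∉ Y := Finset.disjoint_left.1 hRY hi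
    have h1 : R ∪ Y = insert i (R.erase i ∪ Y) := by rw [← insert_union, insert_erase hi]
    rw [markedForest_eq_sum f w hRY hi, forest_eq_sum w hRY hi, h1,
      sum_pairs_insert hκ (by simp [hiY]), mul_sum]
    refine sum_le_sum fun K hK => ?_
    rw [mem_powerset] at hK
    have h3 : R.erase i ∪ Y = (R.erase i ∪ K) ∪ (Y \ K) := by
      rw [union_assoc, union_sdiff_of_subset hK]
    have hP : 0 ≤ ∏ k ∈ K, w i k := prod_nonneg fun k _ => hw i k
    have hF : 0 ≤ forest w (R.erase i ∪ K) (Y \ K) :=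
      forest_nonneg hw (disjoint_erase_union_sdiff hRY i)
    rw [add_mul]
    refine add_le_add ?_ ?_
    · rw [← mul_assoc]
      refine mul_le_mul_of_nonneg_right ?_ hF
      calc ∑ k ∈ K, f i k * ∏ l ∈ K.erase k, w i l
          ≤ ∑ k ∈ K, κ i k * ∏ l ∈ K, w i l := by
            refine sum_le_sum fun k hk => ?_
            rw [← mul_prod_erase K (w i) hk, ← mul_assoc]
            exact mul_le_mul_of_nonneg_right (hf i k) (prod_nonneg fun l _ => hw i l)
        _ = (∑ k ∈ K, κ i k) * ∏ l ∈ K, w i l := by rw [sum_mul]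
        _ ≤ _ := by
            refine mul_le_mul_of_nonneg_right ?_ hP
            exact sum_le_sum_of_subset_of_nonneg (hK.trans subset_union_right)
              fun j _ _ => hκ0 i j
    · rw [mul_left_comm, h3]
      exact mul_le_mul_of_nonneg_left (ih i hi K hK) hP

end MarkedForest

section BrydgesKennedy

variable {V : Type*} [LinearOrder V]

/-- The Mayer function of the interaction `t u`. -/
def scaledZeta (u : V → V → ℂ) (t : ℝ) (i j : V) : ℂ := Complex.exp (-(t * u i j)) - 1

lemma boltz_scaledZeta (u : V → V → ℂ) (t : ℝ) (X : Finset V) :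
    boltz (scaledZeta u t) X = Complex.exp (-(t * ∑ p ∈ pairs X, u p.1 p.2)) := by
  simp only [boltz, scaledZeta, add_sub_cancel, mul_sum, ← sum_neg_distrib, Complex.exp_sum]

lemma hasDerivAt_boltz (u : V → V → ℂ) (t : ℝ) (X : Finset V) :
    HasDerivAt (fun t => boltz (scaledZeta u t) X)
      (-(∑ p ∈ pairs X, u p.1 p.2) * boltz (scaledZeta u t) X) t := by
  simp_rw [boltz_scaledZeta]
  have h : HasDerivAt (fun t : ℝ => -((t : ℂ) * ∑ p ∈ pairs X, u p.1 p.2))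
      (-(1 * ∑ p ∈ pairs X, u p.1 p.2)) t :=
    ((hasDerivAt_id t).ofReal_comp.mul_const _).neg
  refine h.cexp.congr_deriv ?_
  ring

/-- The right side of the evolution equation of `mayer (scaledZeta u t)`. -/
def mayerDeriv (u : V → V → ℂ) (m : Finset V → ℂ) (r : V) (X : Finset V) : ℂ :=
  -(∑ p ∈ pairs X, u p.1 p.2) * m X -
    ∑ B ∈ (X.erase r).powerset, ∑ j ∈ B, ∑ v ∈ X \ B, u v j * (m (X \ B) * m B)

lemma sum_mayerDeriv_mul_boltz {u : V → V → ℂ} (hu : ∀ i j, u i j = u j i) (ζ : V → V → ℂ)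
    {X : Finset V} {r : V} (hr : r ∈ X) :
    ∑ A ∈ X.powerset with r ∈ A, mayerDeriv u (mayer ζ) r A * boltz ζ (X \ A) =
      -(∑ p ∈ pairs X, u p.1 p.2) * boltz ζ X + ∑ A ∈ X.powerset with r ∈ A,
        mayer ζ A * ((∑ p ∈ pairs (X \ A), u p.1 p.2) * boltz ζ (X \ A)) := by
  have hcross : ∑ A ∈ X.powerset with r ∈ A, (∑ B ∈ (A.erase r).powerset, ∑ j ∈ B, ∑ v ∈ A \ B,
        u v j * (mayer ζ (A \ B) * mayer ζ B)) * boltz ζ (X \ A) =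
      ∑ A ∈ X.powerset with r ∈ A,
        (∑ v ∈ A, ∑ j ∈ X \ A, u v j) * (mayer ζ A * boltz ζ (X \ A)) := by
    rw [sum_powerset_filter_mem hr, sum_powerset_filter_mem hr]
    have h1 : ∀ A ∈ (X.erase r).powerset, (∑ B ∈ ((insert r A).erase r).powerset, ∑ j ∈ B,
          ∑ v ∈ insert r A \ B, u v j * (mayer ζ (insert r A \ B) * mayer ζ B)) *
            boltz ζ (X \ insert r A) =
        ∑ B ∈ A.powerset, (∑ j ∈ B, ∑ v ∈ insert r (A \ B),
          u v j * (mayer ζ (insert r (A \ B)) * mayer ζ B)) * boltz ζ (X.erase r \ A) := by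
      intro A hA
      rw [mem_powerset, subset_erase] at hA
      have hs : X \ insert r A = X.erase r \ A := by
        ext v; simp only [mem_sdiff, mem_insert, mem_erase]; tauto
      rw [erase_insert hA.2, sum_mul, hs]
      refine sum_congr rfl fun B hB => ?_
      rw [insert_sdiff_of_notMem _ fun h => hA.2 (mem_powerset.1 hB h)]
    rw [sum_congr rfl h1, sum_powerset_powerset, sum_powerset_sdiff_comm]
    refine sum_congr rfl fun C hC => ?_
    rw [mem_powerset, subset_erase] at hC
    have hs : X \ insert r C = X.erase r \ C := by
      ext v; simp only [mem_sdiff, mem_insert, mem_erase]; tauto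
    rw [hs]
    generalize X.erase r = X'
    have h2 : ∀ B ∈ (X' \ C).powerset, (∑ j ∈ B, ∑ v ∈ insert r ((B ∪ C) \ B), u v j *
          (mayer ζ (insert r ((B ∪ C) \ B)) * mayer ζ B)) * boltz ζ (X' \ (B ∪ C)) =
        ∑ j ∈ B, (∑ v ∈ insert r C, u v j) * mayer ζ (insert r C) *
          (mayer ζ B * boltz ζ ((X' \ C) \ B)) := by
      intro B hB
      rw [mem_powerset, subset_sdiff] at hB
      rw [union_sdiff_cancel_left hB.2, union_comm B C, sdiff_sdiff_left, sum_mul]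
      refine sum_congr rfl fun j _ => ?_
      rw [← sum_mul]
      simp only [sup_eq_union]
      ring
    rw [sum_congr rfl h2, sum_powerset_mem (X' \ C) fun B j =>
      (∑ v ∈ insert r C, u v j) * mayer ζ (insert r C) * (mayer ζ B * boltz ζ ((X' \ C) \ B)),
      sum_comm (s := insert r C), sum_mul]
    refine sum_congr rfl fun j hj => ?_
    rw [← mul_sum, ← sum_powerset_filter_mem hj fun B => mayer ζ B * boltz ζ ((X' \ C) \ B),
      ← boltz_eq_sum_mayer ζ hj, mul_assoc]
  simp only [mayerDeriv, sub_mul, sum_sub_distrib]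
  rw [hcross, boltz_eq_sum_mayer ζ hr, mul_sum, ← sum_sub_distrib, ← sum_add_distrib]
  refine sum_congr rfl fun A hA => ?_
  simp only [mem_filter, mem_powerset] at hA
  have h := sum_pairs_union hu (disjoint_sdiff (s := A) (t := X))
  rw [union_sdiff_of_subset hA.1] at h
  rw [h]
  ring

/-- The evolution equation of connected graph sums when the interaction is scaled. -/
lemma hasDerivAt_mayer {u : V → V → ℂ} (hu : ∀ i j, u i j = u j i) (t : ℝ) {r : V}
    (X : Finset V) (hr : r ∈ X) :
    HasDerivAt (fun t => mayer (scaledZeta u t) X)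
      (mayerDeriv u (mayer (scaledZeta u t)) r X) t := by
  induction X using Finset.strongInduction with
  | H X ih =>
    simp_rw [fun t => mayer_eq_sub (scaledZeta u t) hr]
    have h1 : HasDerivAt (fun t => ∑ A ∈ X.ssubsets with r ∈ A,
        mayer (scaledZeta u t) A * boltz (scaledZeta u t) (X \ A))
        (∑ A ∈ X.ssubsets with r ∈ A,
          (mayerDeriv u (mayer (scaledZeta u t)) r A * boltz (scaledZeta u t) (X \ A) +
          mayer (scaledZeta u t) A *
            (-(∑ p ∈ pairs (X \ A), u p.1 p.2) * boltz (scaledZeta u t) (X \ A)))) t := by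
      refine HasDerivAt.fun_sum fun A hA => ?_
      simp only [mem_filter, mem_ssubsets] at hA
      exact (ih A hA.1 hA.2).mul (hasDerivAt_boltz u t (X \ A))
    refine ((hasDerivAt_boltz u t X).sub h1).congr_deriv ?_
    have h2 := sum_mayerDeriv_mul_boltz hu (scaledZeta u t) hr
    rw [sum_powerset_mem_eq_add hr, sum_powerset_mem_eq_add hr] at h2
    simp only [sdiff_self, pairs_empty, sum_empty, mul_zero, zero_add, bot_eq_empty,
      boltz_empty, mul_one] at h2
    simp only [sum_add_distrib, neg_mul, mul_neg, sum_neg_distrib] at h2 ⊢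
    linear_combination -h2

lemma norm_mayerDeriv_cross_le (u : V → V → ℂ) {m : Finset V → ℂ} {r : V} {X : Finset V}
    (hr : r ∈ X) {w : V → V → ℝ} (hw : ∀ i j, 0 ≤ w i j) {b : V → ℝ}
    (hm : ∀ A ⊂ X, ∀ r ∈ A, ‖m A‖ ≤ Real.exp (∑ i ∈ A, b i) * forest w {r} (A.erase r)) :
    ‖∑ B ∈ (X.erase r).powerset, ∑ j ∈ B, ∑ v ∈ X \ B, u v j * (m (X \ B) * m B)‖ ≤
      Real.exp (∑ i ∈ X, b i) * markedForest (fun i j => ‖u i j‖) w {r} (X.erase r) := by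
  rw [markedForest, mul_sum]
  refine (norm_sum_le _ _).trans (sum_le_sum fun B hB => ?_)
  rw [mem_powerset, subset_erase] at hB
  have hX : {r} ∪ (X.erase r \ B) = X \ B := by
    ext v
    simp only [mem_union, mem_singleton, mem_sdiff, mem_erase]
    by_cases h : v = r
    · simp [h, hr, hB.2]
    · simp [h]
  rw [mul_sum, hX]
  refine (norm_sum_le _ _).trans (sum_le_sum fun j hj => ?_)
  rw [mul_sum]
  refine (norm_sum_le _ _).trans (sum_le_sum fun v _ => ?_)
  have h1 := hm (X \ B) (sdiff_ssubset hB.1 ⟨j, hj⟩) r (by simp [hr, hB.2])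
  have h2 := hm B ((ssubset_iff_of_subset hB.1).2 ⟨r, hr, hB.2⟩) j hj
  have he : (X \ B).erase r = X.erase r \ B := by
    ext v; simp only [mem_sdiff, mem_erase]; tauto
  have hb : ∑ i ∈ X, b i = ∑ i ∈ X \ B, b i + ∑ i ∈ B, b i := (sum_sdiff hB.1).symm
  rw [he] at h1
  have h3 := mul_le_mul h1 h2 (norm_nonneg _)
    (mul_nonneg (Real.exp_pos _).le (forest_nonneg hw (by simp)))
  rw [norm_mul, norm_mul, hb, Real.exp_add]
  exact (mul_le_mul_of_nonneg_left h3 (norm_nonneg (u v j))).trans_eq (by ring)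

/-- The tree bound for an interaction whose hard part has the finite strength `ρ`. -/
lemma norm_mayer_scaledZeta_le {u : V → V → ℂ} (hu : ∀ i j, u i j = u j i)
    {f κ : V → V → ℝ} (hf : ∀ i j, 0 ≤ f i j) (hκ0 : ∀ i j, 0 ≤ κ i j) (hκ : ∀ i j, κ i j = κ j i)
    {ρ C : ℝ} (hC : 0 ≤ C) (hρ : C < ρ) (hnorm : ∀ i j, ‖u i j‖ ≤ f i j + ρ * κ i j)
    (hκ1 : ∀ i j, κ i j ^ 2 = κ i j) {b : V → ℝ}
    (hst : ∀ X : Finset V, (ρ - C) * ∑ p ∈ pairs X, κ p.1 p.2 ≤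
      (∑ p ∈ pairs X, u p.1 p.2).re + ∑ i ∈ X, b i)
    (X : Finset V) {r : V} (hr : r ∈ X) {t : ℝ} (ht : t ∈ Set.Icc (0 : ℝ) 1) :
    ‖mayer (scaledZeta u t) X‖ ≤ Real.exp (t * ∑ i ∈ X, b i) *
      forest (fun i j => t * f i j + ρ / (ρ - C) * κ i j) {r} (X.erase r) := by
  induction X using Finset.strongInduction generalizing r t with
  | H X ih =>
    have hρC : 0 < ρ - C := sub_pos.2 hρ
    set c : ℝ := ρ / (ρ - C) with hc
    have hc0 : 0 ≤ c := div_nonneg (hC.trans hρ.le) hρC.le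
    have hρc : ρ = (ρ - C) * c := by rw [hc]; field_simp
    set w : ℝ → V → V → ℝ := fun t i j => t * f i j + c * κ i j with hw
    have hw0 : ∀ t ∈ Set.Icc (0 : ℝ) 1, ∀ i j, 0 ≤ w t i j := fun t ht i j =>
      add_nonneg (mul_nonneg ht.1 (hf i j)) (mul_nonneg hc0 (hκ0 i j))
    have hdisj : Disjoint {r} (X.erase r) := by simp
    set U : ℂ := ∑ p ∈ pairs X, u p.1 p.2 with hU
    set β : ℝ := ∑ i ∈ X, b i with hβ
    set m : ℝ → Finset V → ℂ := fun t => mayer (scaledZeta u t) with hm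
    have hderiv : ∀ t, HasDerivAt (fun t : ℝ => m t X * Complex.exp (t * U))
        (-(∑ B ∈ (X.erase r).powerset, ∑ j ∈ B, ∑ v ∈ X \ B, u v j * (m t (X \ B) * m t B)) *
          Complex.exp (t * U)) t := by
      intro t
      have h : HasDerivAt (fun t : ℝ => (t : ℂ) * U) (1 * U) t :=
        (hasDerivAt_id t).ofReal_comp.mul_const _
      refine ((hasDerivAt_mayer hu t X hr).mul h.cexp).congr_deriv ?_
      rw [mayerDeriv]
      ring
    have hforest : ∀ t, HasDerivAt (fun t => forest (w t) {r} (X.erase r))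
        (markedForest f (w t) {r} (X.erase r)) t := fun t => by
      refine hasDerivAt_forest (fun i j => ?_) hdisj
      exact (((hasDerivAt_id t).mul_const (f i j)).add_const _).congr_deriv (one_mul _)
    have hB : ∀ t, HasDerivAt (fun t : ℝ => Real.exp (t * (U.re + β)) *
          forest (w t) {r} (X.erase r))
        (Real.exp (t * (U.re + β)) * ((U.re + β) * forest (w t) {r} (X.erase r) +
          markedForest f (w t) {r} (X.erase r))) t := by
      intro t
      have h : HasDerivAt (fun t : ℝ => t * (U.re + β)) (1 * (U.re + β)) t :=
        (hasDerivAt_id t).mul_const _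
      refine (h.exp.mul (hforest t)).congr_deriv ?_
      ring
    have hexp : ∀ t : ℝ, ‖Complex.exp (t * U)‖ = Real.exp (t * U.re) := fun t => by
      rw [Complex.norm_exp, Complex.re_ofReal_mul]
    have key := image_norm_le_of_norm_deriv_right_le_deriv_boundary (a := 0) (b := 1)
      (f := fun t : ℝ => m t X * Complex.exp (t * U))
      (fun t _ => (hderiv t).continuousAt.continuousWithinAt)
      (fun t _ => (hderiv t).hasDerivWithinAt) ?_ hB ?_ ht
    · simp only [norm_mul, hexp, mul_add, Real.exp_add] at key
      have hp := Real.exp_pos (t * U.re)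
      nlinarith [key]
    · have h0 : scaledZeta u 0 = fun _ _ => 0 := by
        funext i j; simp [scaledZeta]
      simp only [hm, h0, mayer_zero hr]
      split_ifs with hX
      · simp [hX, forest_empty_right]
      · simpa using forest_nonneg (hw0 0 (by simp)) hdisj
    · intro t ht'
      have ht : t ∈ Set.Icc (0 : ℝ) 1 := ⟨ht'.1, ht'.2.le⟩
      have hF0 := forest_nonneg (hw0 t ht) hdisj
      have h1 := norm_mayerDeriv_cross_le u (m := m t) hr (hw0 t ht) (b := fun i => t * b i)
        fun A hA r hr => by
          rw [← mul_sum]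
          exact ih A hA hr ht
      rw [norm_mul, norm_neg, hexp]
      rw [← mul_sum] at h1
      have h2 : markedForest (fun i j => ‖u i j‖) (w t) {r} (X.erase r) ≤
          markedForest f (w t) {r} (X.erase r) +
            (ρ - C) * markedForest (fun i j => c * κ i j) (w t) {r} (X.erase r) := by
        rw [← markedForest_add_mul]
        refine sum_le_sum fun B hB => sum_le_sum fun j hj => sum_le_sum fun v _ => ?_
        rw [mem_powerset] at hB
        refine mul_le_mul_of_nonneg_right ?_ (mul_nonneg
          (forest_nonneg (hw0 t ht) (hdisj.mono_right sdiff_subset))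
          (forest_nonneg (hw0 t ht) (by simp)))
        change ‖u v j‖ ≤ f v j + (ρ - C) * (c * κ v j)
        rw [← mul_assoc, ← hρc]
        exact hnorm v j
      have h3 := markedForest_le (f := fun i j => c * κ i j) (hw0 t ht) hκ0 hκ (fun i j => by
        have := mul_nonneg (mul_nonneg ht.1 (hf i j)) (hκ0 i j)
        have h4 : κ i j * w t i j = t * f i j * κ i j + c * κ i j ^ 2 := by simp only [hw]; ring
        rw [h4, hκ1]
        linarith) hdisj
      rw [← insert_eq, insert_erase hr] at h3
      have h5 : markedForest (fun i j => ‖u i j‖) (w t) {r} (X.erase r) ≤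
          (U.re + β) * forest (w t) {r} (X.erase r) + markedForest f (w t) {r} (X.erase r) := by
        have h6 := mul_le_mul_of_nonneg_left h3 hρC.le
        have h7 := mul_le_mul_of_nonneg_right (hst X) hF0
        linarith
      calc _ ≤ Real.exp (t * β) * markedForest (fun i j => ‖u i j‖) (w t) {r} (X.erase r) *
            Real.exp (t * U.re) := mul_le_mul_of_nonneg_right h1 (Real.exp_pos _).le
        _ = Real.exp (t * (U.re + β)) *
            markedForest (fun i j => ‖u i j‖) (w t) {r} (X.erase r) := by
            rw [mul_add, Real.exp_add]; ring
        _ ≤ _ := mul_le_mul_of_nonneg_left h5 (Real.exp_pos _).le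

open Filter Topology

lemma tendsto_forest {α : Type*} {l : Filter α} {w : α → V → V → ℝ} {w' : V → V → ℝ}
    (hw : ∀ i j, Tendsto (fun a => w a i j) l (𝓝 (w' i j))) {R Y : Finset V}
    (hRY : Disjoint R Y) : Tendsto (fun a => forest (w a) R Y) l (𝓝 (forest w' R Y)) := by
  refine peel_induction (P := fun R Y =>
    Tendsto (fun a => forest (w a) R Y) l (𝓝 (forest w' R Y))) ?_ ?_ R Y hRY
  · intro Y
    simp_rw [forest_empty_left]
    exact tendsto_const_nhds
  · rintro R Y ⟨i, hi⟩ hRY ih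
    simp_rw [fun w => forest_eq_sum (V := V) (S := ℝ) w hRY hi]
    exact tendsto_finsetSum _ fun K hK => (tendsto_finsetProd _ fun k _ => hw i k).mul
      (ih i hi K (mem_powerset.1 hK))

lemma tendsto_mayer {α : Type*} {l : Filter α} {ζ : α → V → V → ℂ} {ζ' : V → V → ℂ}
    (hζ : ∀ i j, Tendsto (fun a => ζ a i j) l (𝓝 (ζ' i j))) (X : Finset V) :
    Tendsto (fun a => mayer (ζ a) X) l (𝓝 (mayer ζ' X)) :=
  tendsto_finsetSum _ fun _ _ => tendsto_finsetProd _ fun p _ => hζ p.1 p.2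

/-- The tree bound on connected graph sums for an interaction `z` with hard cores. -/
theorem norm_mayer_le_forest_hard [Fintype V] {z : V → V → ℂ} (hz : ∀ i j, z i j = z j i)
    {hard : V → V → Prop} [∀ i j, Decidable (hard i j)] (hh : ∀ i j, hard i j ↔ hard j i)
    {b : V → ℝ} (hb : ∀ i, 0 ≤ b i)
    (hst : ∀ X : Finset V, (∀ p ∈ pairs X, ¬ hard p.1 p.2) →
      0 ≤ (∑ p ∈ pairs X, z p.1 p.2).re + ∑ i ∈ X, b i)
    {X : Finset V} {r : V} (hr : r ∈ X) :
    ‖mayer (fun i j => if hard i j then -1 else Complex.exp (-z i j) - 1) X‖ ≤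
      (∏ i ∈ X, Real.exp (b i)) *
        forest (fun i j => if hard i j then 1 else ‖z i j‖) {r} (X.erase r) := by
  set C : ℝ := ∑ p ∈ pairs (univ : Finset V), ‖z p.1 p.2‖ with hC
  have hC0 : 0 ≤ C := sum_nonneg fun _ _ => norm_nonneg _
  set κ : V → V → ℝ := fun i j => if hard i j then 1 else 0 with hκ
  set f : V → V → ℝ := fun i j => if hard i j then 0 else ‖z i j‖ with hf
  set u : ℝ → V → V → ℂ := fun ρ i j => if hard i j then (ρ : ℂ) else z i j with hu
  have hκ0 : ∀ i j, 0 ≤ κ i j := fun i j => by simp only [hκ]; split_ifs <;> norm_num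
  have hstρ : ∀ ρ > C, ∀ X : Finset V, (ρ - C) * ∑ p ∈ pairs X, κ p.1 p.2 ≤
      (∑ p ∈ pairs X, u ρ p.1 p.2).re + ∑ i ∈ X, b i := by
    intro ρ hρ X
    by_cases hX : ∀ p ∈ pairs X, ¬ hard p.1 p.2
    · have h1 : ∑ p ∈ pairs X, κ p.1 p.2 = 0 := sum_eq_zero fun p hp => by simp [hκ, hX p hp]
      have h2 : ∑ p ∈ pairs X, u ρ p.1 p.2 = ∑ p ∈ pairs X, z p.1 p.2 :=
        sum_congr rfl fun p hp => by simp [hu, hX p hp]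
      rw [h1, h2, mul_zero]
      exact hst X hX
    · push Not at hX
      obtain ⟨q, hq, hqh⟩ := hX
      have h1 : 1 ≤ ∑ p ∈ pairs X, κ p.1 p.2 := by
        have := single_le_sum (f := fun p : V × V => κ p.1 p.2) (fun p _ => hκ0 p.1 p.2) hq
        simpa [hκ, hqh] using this
      have h2 : ρ * ∑ p ∈ pairs X, κ p.1 p.2 - ∑ p ∈ pairs X, ‖z p.1 p.2‖ ≤
          (∑ p ∈ pairs X, u ρ p.1 p.2).re := by
        rw [Complex.re_sum, mul_sum, ← sum_sub_distrib]
        refine sum_le_sum fun p _ => ?_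
        simp only [hκ, hu]
        split_ifs
        · simp
        · have := neg_le_of_abs_le (Complex.abs_re_le_norm (z p.1 p.2))
          linarith
      have h3 : ∑ p ∈ pairs X, ‖z p.1 p.2‖ ≤ C :=
        sum_le_sum_of_subset_of_nonneg (pairs_mono (subset_univ X)) fun _ _ _ => norm_nonneg _
      have h4 : 0 ≤ ∑ i ∈ X, b i := sum_nonneg fun i _ => hb i
      nlinarith [mul_le_mul_of_nonneg_left h1 hC0]
  have hbound : ∀ᶠ ρ in atTop, ‖mayer (scaledZeta (u ρ) 1) X‖ ≤ Real.exp (1 * ∑ i ∈ X, b i) *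
      forest (fun i j => 1 * f i j + ρ / (ρ - C) * κ i j) {r} (X.erase r) := by
    filter_upwards [eventually_gt_atTop C] with ρ hρ
    refine norm_mayer_scaledZeta_le (C := C) (fun i j => ?_) (fun i j => ?_) hκ0 (fun i j => ?_)
      hC0 hρ (fun i j => ?_) (fun i j => ?_) (hstρ ρ hρ) X hr (by simp)
    · simp only [hu, hh i j, hz i j]
    · simp only [hf]; split_ifs <;> simp
    · simp only [hκ, hh i j]
    · simp only [hu, hf, hκ]
      split_ifs
      · simp [abs_of_pos (hC0.trans_lt hρ)]
      · simp
    · simp only [hκ]; split_ifs <;> simp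
  have hlim1 : Tendsto (fun ρ => ‖mayer (scaledZeta (u ρ) 1) X‖) atTop
      (𝓝 ‖mayer (fun i j => if hard i j then -1 else Complex.exp (-z i j) - 1) X‖) := by
    refine (tendsto_mayer (fun i j => ?_) X).norm
    simp only [scaledZeta, hu]
    split_ifs
    · have h : Tendsto (fun ρ : ℝ => ((Real.exp (-ρ) : ℝ) : ℂ) - 1) atTop (𝓝 ((0 : ℝ) - 1)) :=
        ((Complex.continuous_ofReal.tendsto _).comp
          Real.tendsto_exp_neg_atTop_nhds_zero).sub_const 1
      simpa using h
    · simp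
  have hlim2 : Tendsto (fun ρ => Real.exp (1 * ∑ i ∈ X, b i) *
      forest (fun i j => 1 * f i j + ρ / (ρ - C) * κ i j) {r} (X.erase r)) atTop
      (𝓝 (Real.exp (1 * ∑ i ∈ X, b i) *
        forest (fun i j => if hard i j then 1 else ‖z i j‖) {r} (X.erase r))) := by
    refine (tendsto_forest (fun i j => ?_) (by simp)).const_mul _
    have h1 : Tendsto (fun ρ : ℝ => 1 + C / (ρ - C)) atTop (𝓝 (1 + 0)) :=
      ((tendsto_atTop_add_const_right _ (-C) tendsto_id).const_div_atTop C).const_add 1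
    have h2 : Tendsto (fun ρ : ℝ => ρ / (ρ - C)) atTop (𝓝 (1 + 0)) := by
      refine h1.congr' ?_
      filter_upwards [eventually_gt_atTop C] with ρ hρ
      have : ρ - C ≠ 0 := (sub_pos.2 hρ).ne'
      field_simp
      ring
    have h3 := (h2.mul_const (κ i j)).const_add (1 * f i j)
    convert h3 using 2
    simp only [hf, hκ]
    split_ifs <;> simp
  have := le_of_tendsto_of_tendsto hlim1 hlim2 hbound
  rwa [one_mul, Real.exp_sum] at this

end BrydgesKennedy

end ClusterExpansion

end

noncomputable section

namespace ClusterExpansion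

open Finset Filter Topology

section Marginals

lemma measurable_pair {V X E : Type*} [MeasurableSpace X] [MeasurableSpace E] {w : X → X → E}
    (hw : Measurable fun p : X × X => w p.1 p.2) (i j : V) :
    Measurable fun x : V → X => w (x i) (x j) :=
  hw.comp (f := fun x : V → X => (x i, x j))
    ((measurable_pi_apply i).prodMk (measurable_pi_apply j))

variable {V X : Type*} [DecidableEq V] [MeasurableSpace X]

lemma lmarginal_congr_update (ν : Measure X) {s : Finset V} {f g : (V → X) → ℝ≥0∞} {x : V → X}
    (h : ∀ z : V → X, (∀ i ∉ s, z i = x i) → f z = g z) :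
    (∫⋯∫⁻_s, f ∂fun _ => ν) x = (∫⋯∫⁻_s, g ∂fun _ => ν) x :=
  lintegral_congr fun y => h _ fun i hi => by simp [Function.updateFinset, hi]

lemma lmarginal_const_mul (ν : Measure X) {s : Finset V} {f : (V → X) → ℝ≥0∞}
    (hf : Measurable f) (c : ℝ≥0∞) (x : V → X) :
    (∫⋯∫⁻_s, (fun z => c * f z) ∂fun _ => ν) x = c * (∫⋯∫⁻_s, f ∂fun _ => ν) x :=
  lintegral_const_mul c (hf.comp measurable_updateFinset)

lemma lmarginal_sum (ν : Measure X) {ι : Type*} (S : Finset ι) {s : Finset V}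
    {f : ι → (V → X) → ℝ≥0∞} (hf : ∀ k ∈ S, Measurable (f k)) (x : V → X) :
    (∫⋯∫⁻_s, (fun z => ∑ k ∈ S, f k z) ∂fun _ => ν) x =
      ∑ k ∈ S, (∫⋯∫⁻_s, f k ∂fun _ => ν) x :=
  lintegral_finsetSum S fun k hk => (hf k hk).comp measurable_updateFinset

lemma lmarginal_prod (ν : Measure X) [SigmaFinite ν] {g : X → ℝ≥0∞} (hg : Measurable g)
    (s : Finset V) (x : V → X) :
    (∫⋯∫⁻_s, (fun z => ∏ k ∈ s, g (z k)) ∂fun _ => ν) x = (∫⁻ y, g y ∂ν) ^ #s := by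
  induction s using Finset.induction_on with
  | empty => simp
  | insert i s hi ih =>
    have hm : ∀ s : Finset V, Measurable fun z : V → X => ∏ k ∈ s, g (z k) := fun s =>
      Finset.measurable_fun_prod _ fun k _ => hg.comp (measurable_pi_apply k)
    rw [lmarginal_insert' _ (hm _) hi, card_insert_of_notMem hi, pow_succ', ← ih,
      ← lmarginal_const_mul ν (hm s)]
    congr 1
    funext z
    rw [← lintegral_mul_const _ hg]
    refine lintegral_congr fun y => ?_
    rw [prod_insert hi, Function.update_self]
    congr 1
    refine prod_congr rfl fun k hk => ?_
    rw [Function.update_of_ne (ne_of_mem_of_not_mem hk hi)]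

end Marginals

section ForestIntegral

variable {V X : Type*} [LinearOrder V] [MeasurableSpace X]

lemma forest_mul_child {S : Type*} [CommSemiring S] (w : V → V → S) (g : V → S) {R Y : Finset V}
    (hRY : Disjoint R Y) :
    forest (fun i j => w i j * g j) R Y = (∏ j ∈ Y, g j) * forest w R Y := by
  refine peel_induction (P := fun R Y =>
    forest (fun i j => w i j * g j) R Y = (∏ j ∈ Y, g j) * forest w R Y) ?_ ?_ R Y hRY
  · intro Y
    simp only [forest_empty_left]
    split_ifs with h <;> simp [h]
  · rintro R Y ⟨i, hi⟩ hRY ih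
    rw [forest_eq_sum _ hRY hi, forest_eq_sum _ hRY hi, mul_sum]
    refine sum_congr rfl fun K hK => ?_
    rw [mem_powerset] at hK
    rw [ih i hi K hK, prod_mul_distrib, ← prod_sdiff hK]
    ring

lemma measurable_forest {w : X → X → ℝ≥0∞} (hw : Measurable fun p : X × X => w p.1 p.2)
    {R Y : Finset V} (hRY : Disjoint R Y) :
    Measurable fun x : V → X => forest (fun i j => w (x i) (x j)) R Y := by
  refine peel_induction (P := fun R Y =>
    Measurable fun x : V → X => forest (fun i j => w (x i) (x j)) R Y) ?_ ?_ R Y hRY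
  · intro Y
    simp_rw [forest_empty_left]
    exact measurable_const
  · rintro R Y ⟨i, hi⟩ hRY ih
    simp_rw [fun w => forest_eq_sum (V := V) (S := ℝ≥0∞) w hRY hi]
    refine Finset.measurable_fun_sum _ fun K hK => Measurable.mul ?_
      (ih i hi K (mem_powerset.1 hK))
    exact Finset.measurable_fun_prod _ fun k _ => measurable_pair hw i k

lemma one_add_mul_pow_le_exp {ε α : ℝ} (hε : 0 ≤ ε) (hα : 0 ≤ α) {n : ℕ} (hn : ε * n ≤ 1)
    {I : ℝ≥0∞} (hI : I ≤ ENNReal.ofReal α) :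
    (1 + ENNReal.ofReal ε * I) ^ n ≤ ENNReal.ofReal (Real.exp α) := by
  have h1 : 1 + ENNReal.ofReal ε * I ≤ ENNReal.ofReal (Real.exp (ε * α)) := by
    calc 1 + ENNReal.ofReal ε * I ≤ 1 + ENNReal.ofReal ε * ENNReal.ofReal α := by gcongr
      _ = ENNReal.ofReal (1 + ε * α) := by
        rw [← ENNReal.ofReal_mul hε, ENNReal.ofReal_add zero_le_one (mul_nonneg hε hα),
          ENNReal.ofReal_one]
      _ ≤ _ := ENNReal.ofReal_le_ofReal (by linarith [Real.add_one_le_exp (ε * α)])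
  calc (1 + ENNReal.ofReal ε * I) ^ n ≤ ENNReal.ofReal (Real.exp (ε * α)) ^ n := by gcongr
    _ = ENNReal.ofReal (Real.exp (n * (ε * α))) := by
      rw [← ENNReal.ofReal_pow (Real.exp_pos _).le, Real.exp_nat_mul]
    _ ≤ _ := ENNReal.ofReal_le_ofReal (Real.exp_le_exp.2 (by nlinarith))

/-- A discrete form of the sum over all forests rooted at `R` under a Kotecký–Preiss type
criterion: each vertex of `L` is used with the factor `ε ≤ 1 / #L`. -/
lemma sum_lmarginal_forest_le {ν : Measure X} [SigmaFinite ν] {w : X → X → ℝ≥0∞}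
    (hw : Measurable fun p : X × X => w p.1 p.2) {a : X → ℝ} (ha : Measurable a)
    (ha0 : ∀ x, 0 ≤ a x)
    (hcrit : ∀ x, ∫⁻ y, w x y * ENNReal.ofReal (Real.exp (a y)) ∂ν ≤ ENNReal.ofReal (a x))
    {ε : ℝ} (hε : 0 ≤ ε) {R L : Finset V} (hRL : Disjoint R L) (hL : ε * #L ≤ 1) (x : V → X) :
    ∑ Y ∈ L.powerset, ENNReal.ofReal ε ^ #Y *
      (∫⋯∫⁻_Y, (fun x => forest (fun i j => w (x i) (x j)) R Y) ∂fun _ => ν) x ≤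
      ∏ i ∈ R, ENNReal.ofReal (Real.exp (a (x i))) := by
  revert hL x
  have hwm : ∀ (i : V) (K : Finset V), Measurable fun x : V → X => ∏ k ∈ K, w (x i) (x k) :=
    fun i K => Finset.measurable_fun_prod _ fun k _ => measurable_pair hw i k
  refine peel_induction (P := fun R L => ε * #L ≤ 1 → ∀ x : V → X,
    ∑ Y ∈ L.powerset, ENNReal.ofReal ε ^ #Y *
      (∫⋯∫⁻_Y, (fun x => forest (fun i j => w (x i) (x j)) R Y) ∂fun _ => ν) x ≤
      ∏ i ∈ R, ENNReal.ofReal (Real.exp (a (x i)))) ?_ ?_ R L hRL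
  · intro L _ x
    rw [sum_eq_single ∅]
    · simp [forest_empty_left]
    · intro Y _ hY
      simp [forest_empty_left, hY, lmarginal]
    · simp
  · rintro R L ⟨i, hi⟩ hRL ih hL x
    have hiL : i ∉ L := Finset.disjoint_left.1 hRL hi
    set e : X → ℝ≥0∞ := fun y => ENNReal.ofReal (Real.exp (a y)) with he
    have hem : Measurable e := (ha.exp).ennreal_ofReal
    have hstep : ∀ Y ∈ L.powerset, ENNReal.ofReal ε ^ #Y *
        (∫⋯∫⁻_Y, (fun x => forest (fun i j => w (x i) (x j)) R Y) ∂fun _ => ν) x =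
        ∑ K ∈ Y.powerset, ENNReal.ofReal ε ^ #Y *
          (∫⋯∫⁻_K, (fun z => (∏ k ∈ K, w (z i) (z k)) * (∫⋯∫⁻_(Y \ K), (fun x =>
            forest (fun i j => w (x i) (x j)) (R.erase i ∪ K) (Y \ K)) ∂fun _ => ν) z)
            ∂fun _ => ν) x := by
      intro Y hY
      rw [mem_powerset] at hY
      have hRY := hRL.mono_right hY
      have hiY : i ∉ Y := fun h => hiL (hY h)
      have hm : ∀ K : Finset V, Measurable fun x : V → X =>
          forest (fun i j => w (x i) (x j)) (R.erase i ∪ K) (Y \ K) := fun K =>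
        measurable_forest hw (disjoint_erase_union_sdiff hRY i)
      simp_rw [fun w => forest_eq_sum (V := V) (S := ℝ≥0∞) w hRY hi]
      rw [lmarginal_sum ν _ fun K _ => (hwm i K).fun_mul (hm K), mul_sum]
      refine sum_congr rfl fun K hK => ?_
      rw [mem_powerset] at hK
      congr 1
      conv_lhs => rw [← union_sdiff_of_subset hK]
      rw [lmarginal_union _ _ (by
        rw [union_sdiff_of_subset hK]; exact (hwm i K).fun_mul (hm K)) disjoint_sdiff]
      congr 1
      funext z
      rw [union_sdiff_of_subset hK, ← lmarginal_const_mul ν (hm K)]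
      refine lmarginal_congr_update ν fun z' hz' => ?_
      rw [hz' i (by simp [hiY])]
      congr 1
      exact prod_congr rfl fun k hk => by rw [hz' k (by simp [hk])]
    rw [sum_congr rfl hstep, sum_powerset_powerset]
    have hK : ∀ K ∈ L.powerset, ∑ Z ∈ (L \ K).powerset, ENNReal.ofReal ε ^ #(K ∪ Z) *
          (∫⋯∫⁻_K, (fun z => (∏ k ∈ K, w (z i) (z k)) * (∫⋯∫⁻_((K ∪ Z) \ K), (fun x =>
            forest (fun i j => w (x i) (x j)) (R.erase i ∪ K) ((K ∪ Z) \ K)) ∂fun _ => ν) z)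
            ∂fun _ => ν) x ≤
        (∏ j ∈ R.erase i, e (x j)) * (ENNReal.ofReal ε * ∫⁻ y, w (x i) y * e y ∂ν) ^ #K := by
      intro K hK
      rw [mem_powerset] at hK
      have hiK : i ∉ K := fun h => hiL (hK h)
      have hd := disjoint_erase_union_sdiff (K := K) hRL i
      have hmf : ∀ Z ∈ (L \ K).powerset, Measurable fun z : V → X => (∫⋯∫⁻_Z, (fun x =>
          forest (fun i j => w (x i) (x j)) (R.erase i ∪ K) Z) ∂fun _ => ν) z := fun Z hZ =>
        (measurable_forest hw (hd.mono_right (mem_powerset.1 hZ))).lmarginal _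
      calc _ = ∑ Z ∈ (L \ K).powerset, (∫⋯∫⁻_K, (fun z => ENNReal.ofReal ε ^ #K *
              ((∏ k ∈ K, w (z i) (z k)) * (ENNReal.ofReal ε ^ #Z * (∫⋯∫⁻_Z, (fun x =>
                forest (fun i j => w (x i) (x j)) (R.erase i ∪ K) Z) ∂fun _ => ν) z)))
              ∂fun _ => ν) x := by
            refine sum_congr rfl fun Z hZ => ?_
            have hm := hmf Z hZ
            rw [mem_powerset, subset_sdiff] at hZ
            rw [union_sdiff_cancel_left hZ.2.symm, card_union_of_disjoint hZ.2.symm,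
              ← lmarginal_const_mul ν ((hwm i K).fun_mul hm), pow_add]
            congr 1
            funext z
            ring
        _ = (∫⋯∫⁻_K, (fun z => ENNReal.ofReal ε ^ #K * ((∏ k ∈ K, w (z i) (z k)) *
              ∑ Z ∈ (L \ K).powerset, ENNReal.ofReal ε ^ #Z * (∫⋯∫⁻_Z, (fun x =>
                forest (fun i j => w (x i) (x j)) (R.erase i ∪ K) Z) ∂fun _ => ν) z))
              ∂fun _ => ν) x := by
            rw [← lmarginal_sum ν _ fun Z hZ =>
              ((hwm i K).fun_mul ((hmf Z hZ).const_mul _)).const_mul _]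
            simp_rw [mul_sum]
        _ ≤ (∫⋯∫⁻_K, (fun z => ENNReal.ofReal ε ^ #K * ((∏ k ∈ K, w (z i) (z k)) *
              ∏ j ∈ R.erase i ∪ K, e (z j))) ∂fun _ => ν) x := by
            refine lmarginal_mono (fun z => ?_) x
            refine mul_le_mul_right (mul_le_mul_right (ih i hi K hK ?_ z) _) _
            refine le_trans (mul_le_mul_of_nonneg_left ?_ hε) hL
            exact_mod_cast card_le_card sdiff_subset
        _ = (∫⋯∫⁻_K, (fun z => (∏ j ∈ R.erase i, e (x j)) * (ENNReal.ofReal ε ^ #K *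
              ∏ k ∈ K, (w (x i) (z k) * e (z k)))) ∂fun _ => ν) x := by
            refine lmarginal_congr_update ν fun z hz => ?_
            have hdK : Disjoint (R.erase i) K := hRL.mono (erase_subset _ _) hK
            have hR : ∏ j ∈ R.erase i, e (z j) = ∏ j ∈ R.erase i, e (x j) :=
              prod_congr rfl fun j hj => by rw [hz j (Finset.disjoint_left.1 hdK hj)]
            rw [hz i hiK, prod_union hdK, prod_mul_distrib, hR]
            ring
        _ = _ := by
            have hwx : Measurable fun y => w (x i) y * e y :=
              (hw.comp measurable_prodMk_left).mul hem
            have hp : Measurable fun z : V → X => ∏ k ∈ K, (w (x i) (z k) * e (z k)) :=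
              Finset.measurable_fun_prod _ fun k _ => hwx.comp (measurable_pi_apply k)
            rw [lmarginal_const_mul ν (hp.const_mul _), lmarginal_const_mul ν hp,
              lmarginal_prod ν hwx, mul_pow]
    refine (sum_le_sum hK).trans ?_
    rw [← mul_sum, ← prod_erase_mul R (fun j => e (x j)) hi]
    refine mul_le_mul_right ?_ _
    have : ∑ K ∈ L.powerset, (ENNReal.ofReal ε * ∫⁻ y, w (x i) y * e y ∂ν) ^ #K =
        (1 + ENNReal.ofReal ε * ∫⁻ y, w (x i) y * e y ∂ν) ^ #L := by
      rw [← prod_const, prod_one_add]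
      simp
    rw [this]
    exact one_add_mul_pow_le_exp hε (ha0 _) hL (hcrit (x i))

end ForestIntegral

end ClusterExpansion

end

noncomputable section

namespace ClusterExpansion

open Finset Filter Topology

section TreeIntegral

variable {X : Type*} [MeasurableSpace X]

/-- The integral over the labelled trees on `m + 1` points, the first of which is fixed. -/
def treeIntegral (ν : Measure X) (w : X → X → ℝ≥0∞) (m : ℕ) (x₀ : X) : ℝ≥0∞ :=
  ∫⁻ y : Fin m → X, forest (fun i j : Fin (m + 1) =>
    w (Matrix.vecCons x₀ y i) (Matrix.vecCons x₀ y j)) {0} (univ.erase 0) ∂Measure.pi fun _ => ν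

lemma measurable_vecCons (m : ℕ) :
    Measurable fun p : X × (Fin m → X) => (Matrix.vecCons p.1 p.2 : Fin (m + 1) → X) := by
  refine measurable_pi_iff.2 fun i => ?_
  refine Fin.cases ?_ (fun k => ?_) i
  · exact measurable_fst
  · exact (measurable_pi_apply k).comp measurable_snd

lemma lmarginal_forest_eq_treeIntegral (ν : Measure X) [SigmaFinite ν] {w : X → X → ℝ≥0∞}
    (hw : Measurable fun p : X × X => w p.1 p.2) {N : ℕ} {Y : Finset (Fin (N + 1))}
    (hY : 0 ∉ Y) (x₀ : X) :
    (∫⋯∫⁻_Y, (fun x => forest (fun i j => w (x i) (x j)) {0} Y) ∂fun _ => ν) (fun _ => x₀) =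
      treeIntegral ν w #Y x₀ := by
  set e₀ := Y.orderEmbOfFin rfl with he₀
  have he₀Y : ∀ k, e₀ k ∈ Y := fun k => Y.orderEmbOfFin_mem rfl k
  let e : Fin (#Y + 1) ↪ Fin (N + 1) := ⟨Matrix.vecCons 0 e₀, by
    refine (Fin.cons_injective_iff (x₀ := 0) (x := e₀)).2 ⟨?_, e₀.injective⟩
    rintro ⟨k, hk⟩
    exact hY (hk ▸ he₀Y k)⟩
  have hR : ({0} : Finset (Fin (N + 1))) = ({0} : Finset (Fin (#Y + 1))).map e := by
    rw [map_singleton]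
    rfl
  have hYe : Y = (univ.erase (0 : Fin (#Y + 1))).map e := by
    ext v
    simp only [Finset.mem_map, mem_erase, mem_univ, and_true]
    constructor
    · intro hv
      obtain ⟨k, hk⟩ : v ∈ Set.range e₀ := by rw [he₀, range_orderEmbOfFin]; exact hv
      exact ⟨k.succ, Fin.succ_ne_zero k, hk⟩
    · rintro ⟨k, hk, rfl⟩
      obtain ⟨l, rfl⟩ := Fin.exists_succ_eq.2 hk
      exact he₀Y l
  set g : (Fin #Y → X) → ℝ≥0∞ := fun y => forest (fun i j : Fin (#Y + 1) =>
    w (Matrix.vecCons x₀ y i) (Matrix.vecCons x₀ y j)) {0} (univ.erase 0) with hg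
  have hgm : Measurable g := (measurable_forest hw (by simp)).comp
    ((measurable_vecCons #Y).comp measurable_prodMk_left)
  have key := lmarginal_image (μ := fun _ : Fin (N + 1) => ν) e₀.injective univ hgm
    (fun _ => x₀)
  rw [he₀, image_orderEmbOfFin_univ, lmarginal_univ] at key
  rw [treeIntegral, ← hg]
  refine Eq.trans (lmarginal_congr_update ν fun z hz => ?_) key
  have h1 := forest_map e (fun i j => w (z i) (z j)) (R := {0}) (Y := univ.erase 0) (by simp)
  rw [← hR, ← hYe] at h1
  rw [h1, Function.comp_apply, hg]
  have hz' : ∀ i, z (e i) = Matrix.vecCons x₀ (z ∘' ⇑(Y.orderEmbOfFin rfl)) i := by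
    intro i
    refine Fin.cases ?_ (fun k => ?_) i
    · exact hz 0 hY
    · rfl
  simp only [hz']

lemma tendsto_choose_div_pow (m : ℕ) :
    Tendsto (fun N : ℕ => (N.choose m : ℝ) * (1 / (N : ℝ)) ^ m) atTop
      (𝓝 (1 / (m.factorial : ℝ))) := by
  have hm : (m.factorial : ℝ) ≠ 0 := by exact_mod_cast m.factorial_ne_zero
  have h := isEquivalent_choose m
  rw [Asymptotics.isEquivalent_iff_tendsto_one] at h
  · have h2 := h.mul_const (1 / (m.factorial : ℝ))
    rw [one_mul] at h2
    refine h2.congr' ?_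
    filter_upwards [eventually_gt_atTop 0] with N hN
    have hN' : (N : ℝ) ≠ 0 := by exact_mod_cast hN.ne'
    simp only [Pi.div_apply, one_div, inv_pow]
    field_simp
  · filter_upwards [eventually_gt_atTop 0] with N hN
    have hN' : (N : ℝ) ≠ 0 := by exact_mod_cast hN.ne'
    positivity

/-- The sum over all trees rooted at `x₀` under a Kotecký–Preiss type criterion. -/
theorem tsum_treeIntegral_le {ν : Measure X} [SigmaFinite ν] {w : X → X → ℝ≥0∞}
    (hw : Measurable fun p : X × X => w p.1 p.2) {a : X → ℝ} (ha : Measurable a)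
    (ha0 : ∀ x, 0 ≤ a x)
    (hcrit : ∀ x, ∫⁻ y, w x y * ENNReal.ofReal (Real.exp (a y)) ∂ν ≤ ENNReal.ofReal (a x))
    (x₀ : X) :
    ∑' m : ℕ, ENNReal.ofReal (1 / (m.factorial : ℝ)) * treeIntegral ν w m x₀ ≤
      ENNReal.ofReal (Real.exp (a x₀)) := by
  have hfin : ∀ N : ℕ, 0 < N → ∑ m ∈ range (N + 1),
      ENNReal.ofReal ((N.choose m : ℝ) * (1 / (N : ℝ)) ^ m) * treeIntegral ν w m x₀ ≤
      ENNReal.ofReal (Real.exp (a x₀)) := by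
    intro N hN
    have hN' : (N : ℝ) ≠ 0 := by exact_mod_cast hN.ne'
    have h := sum_lmarginal_forest_le (V := Fin (N + 1)) (ν := ν) hw ha ha0 hcrit
      (ε := 1 / N) (by positivity) (R := {0}) (L := univ.erase 0) (by simp)
      (by simp [hN']) (fun _ => x₀)
    rw [prod_singleton] at h
    refine le_trans (le_of_eq ?_) h
    have h1 : ∀ Y ∈ (univ.erase (0 : Fin (N + 1))).powerset,
        ENNReal.ofReal (1 / (N : ℝ)) ^ #Y *
          (∫⋯∫⁻_Y, (fun x => forest (fun i j => w (x i) (x j)) {0} Y) ∂fun _ => ν)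
            (fun _ => x₀) =
        ENNReal.ofReal (1 / (N : ℝ)) ^ #Y * treeIntegral ν w #Y x₀ := by
      intro Y hY
      rw [mem_powerset, subset_erase] at hY
      rw [lmarginal_forest_eq_treeIntegral ν hw hY.2]
    rw [sum_congr rfl h1, sum_powerset_apply_card
      (fun m => ENNReal.ofReal (1 / (N : ℝ)) ^ m * treeIntegral ν w m x₀)]
    simp only [card_erase_of_mem (mem_univ _), card_univ, Fintype.card_fin, Nat.add_sub_cancel]
    refine sum_congr rfl fun m _ => ?_
    rw [nsmul_eq_mul, ENNReal.ofReal_mul (by positivity), ENNReal.ofReal_natCast,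
      ENNReal.ofReal_pow (by positivity), mul_assoc]
  refine ENNReal.tsum_le_of_sum_range_le fun M => ?_
  have hlim : Tendsto (fun N : ℕ => ∑ m ∈ range M,
      ENNReal.ofReal ((N.choose m : ℝ) * (1 / (N : ℝ)) ^ m) * treeIntegral ν w m x₀) atTop
      (𝓝 (∑ m ∈ range M, ENNReal.ofReal (1 / (m.factorial : ℝ)) * treeIntegral ν w m x₀)) := by
    refine tendsto_finsetSum _ fun m _ => ENNReal.Tendsto.mul_const
      (ENNReal.tendsto_ofReal (tendsto_choose_div_pow m)) (Or.inl ?_)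
    have := m.factorial_pos
    simp only [ne_eq, ENNReal.ofReal_eq_zero, not_le]
    positivity
  refine le_of_tendsto hlim ?_
  filter_upwards [eventually_gt_atTop 0, eventually_ge_atTop M] with N hN hM
  exact (sum_le_sum_of_subset (range_subset_range.2 (by omega))).trans (hfin N hN)

end TreeIntegral

end ClusterExpansion

end

noncomputable section

namespace ClusterExpansion

open Filter Topology

section Density

variable {X : Type*} [MeasurableSpace X]

instance (μ : ComplexMeasure X) [IsFiniteMeasure μ.variation] (n : ℕ) :
    IsFiniteMeasure (absPi μ n) := by
  unfold absPi; infer_instance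

lemma exists_withDensity_eq (μ : ComplexMeasure X) [IsFiniteMeasure μ.variation] :
    ∃ h : X → ℂ, Measurable h ∧ Integrable h μ.variation ∧ μ.variation.withDensityᵥ h = μ := by
  have hac := (ComplexMeasure.absolutelyContinuous_ennreal_iff μ _).1 μ.absolutelyContinuous
  set ν := μ.variation with hν
  set s := ComplexMeasure.re μ
  set t := ComplexMeasure.im μ
  have hs : ν.withDensityᵥ (s.rnDeriv ν) = s := SignedMeasure.withDensityᵥ_rnDeriv_eq s ν hac.1
  have ht : ν.withDensityᵥ (t.rnDeriv ν) = t := SignedMeasure.withDensityᵥ_rnDeriv_eq t ν hac.2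
  have his := SignedMeasure.integrable_rnDeriv s ν
  have hit := SignedMeasure.integrable_rnDeriv t ν
  have hi : Integrable (fun x => (s.rnDeriv ν x : ℂ) + (t.rnDeriv ν x : ℂ) * Complex.I) ν :=
    his.ofReal.add (hit.ofReal.mul_const _)
  refine ⟨_, ?_, hi, ?_⟩
  · have h1 := SignedMeasure.measurable_rnDeriv s ν
    have h2 := SignedMeasure.measurable_rnDeriv t ν
    fun_prop
  · ext E hE
    rw [withDensityᵥ_apply hi hE]
    have h1 := congrArg (fun σ : SignedMeasure X => σ E) hs
    have h2 := congrArg (fun σ : SignedMeasure X => σ E) ht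
    simp only [withDensityᵥ_apply his hE, withDensityᵥ_apply hit hE] at h1 h2
    rw [integral_add his.ofReal.restrict (hit.ofReal.mul_const _).restrict,
      integral_mul_const, integral_complex_ofReal, integral_complex_ofReal, h1, h2]
    exact Complex.re_add_im (μ E)

/-- The polar decomposition of a complex measure. -/
lemma exists_density (μ : ComplexMeasure X) [IsFiniteMeasure μ.variation] :
    ∃ h : X → ℂ, Measurable h ∧ (∀ x, ‖h x‖ = 1) ∧ ∀ f : X → ℂ, Integrable f μ.variation →
      VectorMeasure.integral μ f (ContinuousLinearMap.mul ℝ ℂ) =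
        ∫ x, f x * h x ∂μ.variation := by
  obtain ⟨g, hgm, hgi, hg⟩ := exists_withDensity_eq μ
  have hvar := Measure.variation_withDensityᵥ hgi
  rw [hg] at hvar
  have h1 : (fun x => ‖g x‖ₑ) =ᵐ[μ.variation] fun _ => 1 := by
    refine (withDensity_eq_iff (by fun_prop) (by fun_prop) ?_).1 ?_
    · exact hgi.2.ne
    · rw [← hvar]; simp
  classical
  set h : X → ℂ := fun x => if ‖g x‖ = 1 then g x else 1 with hh
  have hgh : g =ᵐ[μ.variation] h := by
    filter_upwards [h1] with x hx
    have : ‖g x‖ = 1 := by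
      rw [← ofReal_norm, ← ENNReal.ofReal_one] at hx
      exact (ENNReal.ofReal_eq_ofReal_iff (norm_nonneg _) zero_le_one).1 hx
    simp [hh, this]
  have hhm : Measurable h := Measurable.ite (measurableSet_eq_fun hgm.norm measurable_const) hgm
    measurable_const
  have hh1 : ∀ x, ‖h x‖ = 1 := fun x => by
    simp only [hh]; split_ifs with h <;> simp [h]
  have hbdd : ∀ f : X → ℂ, Integrable f μ.variation →
      Integrable (fun x => f x * h x) μ.variation := fun f hf =>
    hf.mul_bdd (c := 1) hhm.aestronglyMeasurable (Eventually.of_forall fun x => (hh1 x).le)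
  refine ⟨h, hhm, hh1, fun f hf => ?_⟩
  refine Integrable.induction (P := fun f => VectorMeasure.integral μ f
    (ContinuousLinearMap.mul ℝ ℂ) = ∫ x, f x * h x ∂μ.variation) ?_ ?_ ?_ ?_ hf
  · intro c s hs _
    have h2 : ∫ x, s.indicator (fun _ => c) x * h x ∂μ.variation = c * μ s := by
      have h3 : ∀ x, s.indicator (fun _ => c) x * h x = s.indicator (fun x => c * h x) x := by
        intro x
        by_cases hx : x ∈ s <;> simp [hx]
      simp_rw [h3]
      rw [integral_indicator hs, integral_const_mul]
      congr 1
      conv_rhs => rw [← hg, withDensityᵥ_apply hgi hs]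
      exact integral_congr_ae (ae_restrict_of_ae hgh.symm)
    rw [h2, VectorMeasure.integral_indicator hs, VectorMeasure.setIntegral_const]
    simp
  · intro f₁ f₂ _ hf₁ hf₂ h₁ h₂
    rw [VectorMeasure.integral_add hf₁ hf₂, h₁, h₂, ← integral_add (hbdd _ hf₁) (hbdd _ hf₂)]
    simp [add_mul]
  · refine isClosed_eq VectorMeasure.continuous_integral ?_
    have : ∀ f : X →₁[μ.variation] ℂ, ∫ x, f x * h x ∂μ.variation =
        ∫ x, f x * h x ∂μ.variation := fun _ => rfl
    refine LipschitzWith.continuous (K := 1) (LipschitzWith.of_dist_le_mul fun f₁ f₂ => ?_)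
    have i₁ := L1.integrable_coeFn f₁
    have i₂ := L1.integrable_coeFn f₂
    rw [dist_eq_norm, ← integral_sub (hbdd _ i₁) (hbdd _ i₂), NNReal.coe_one, one_mul,
      dist_eq_norm, L1.norm_eq_integral_norm]
    refine (norm_integral_le_integral_norm _).trans (le_of_eq (integral_congr_ae ?_))
    filter_upwards [Lp.coeFn_sub f₁ f₂] with x hx
    rw [hx, Pi.sub_apply, ← sub_mul, norm_mul, hh1, mul_one]
  · intro f₁ f₂ hf _ h₁
    rw [← VectorMeasure.integral_congr_ae hf, h₁]
    refine integral_congr_ae ?_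
    filter_upwards [hf] with x hx
    rw [hx]

lemma integrable_mul_prod {n : ℕ} {h : X → ℂ} (hh : Measurable h) (h1 : ∀ x, ‖h x‖ = 1)
    {m : Measure (Fin n → X)} {F : (Fin n → X) → ℂ} (hF : Integrable F m) :
    Integrable (fun y => F y * ∏ i, h (y i)) m := by
  refine hF.mul_bdd (c := 1) (Measurable.aestronglyMeasurable ?_) (Eventually.of_forall fun y => ?_)
  · exact Finset.measurable_fun_prod _ fun i _ => hh.comp (measurable_pi_apply i)
  · simp [norm_prod, h1]

lemma coe_piFinSuccAbove_symm (n : ℕ) :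
    ⇑(MeasurableEquiv.piFinSuccAbove (fun _ : Fin (n + 1) => X) 0).symm =
      fun p : X × (Fin n → X) => (Matrix.vecCons p.1 p.2 : Fin (n + 1) → X) := by
  funext p
  exact Fin.insertNth_zero' p.1 p.2

lemma measurePreserving_vecCons (ν : Measure X) [SigmaFinite ν] (n : ℕ) :
    MeasurePreserving (fun p : X × (Fin n → X) => (Matrix.vecCons p.1 p.2 : Fin (n + 1) → X))
      (ν.prod (Measure.pi fun _ => ν)) (Measure.pi fun _ => ν) := by
  have h := (measurePreserving_piFinSuccAbove (fun _ : Fin (n + 1) => ν) 0).symm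
  rwa [coe_piFinSuccAbove_symm] at h

lemma measurableEmbedding_vecCons (n : ℕ) :
    MeasurableEmbedding (fun p : X × (Fin n → X) =>
      (Matrix.vecCons p.1 p.2 : Fin (n + 1) → X)) := by
  have h := (MeasurableEquiv.piFinSuccAbove (fun _ : Fin (n + 1) => X) 0).symm.measurableEmbedding
  rwa [coe_piFinSuccAbove_symm] at h

lemma iterInt_eq_integral {μ : ComplexMeasure X} [IsFiniteMeasure μ.variation] {h : X → ℂ}
    (hh : Measurable h) (h1 : ∀ x, ‖h x‖ = 1)
    (hμ : ∀ f : X → ℂ, Integrable f μ.variation →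
      VectorMeasure.integral μ f (ContinuousLinearMap.mul ℝ ℂ) = ∫ x, f x * h x ∂μ.variation)
    (n : ℕ) {F : (Fin n → X) → ℂ} (hF : Integrable F (absPi μ n)) :
    iterInt μ n F = ∫ y, F y * ∏ i, h (y i) ∂absPi μ n := by
  induction n with
  | zero =>
    rw [iterInt, absPi, Measure.pi_of_empty _ ![], integral_dirac]
    simp
  | succ n ih =>
    have hmp := measurePreserving_vecCons μ.variation n
    have hme := measurableEmbedding_vecCons (X := X) n
    have hF' := (hmp.integrable_comp_emb hme).2 hF
    have hG := (hmp.integrable_comp_emb hme).2 (integrable_mul_prod hh h1 hF)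
    have hae : (fun x => iterInt μ n fun y => F (Matrix.vecCons x y)) =ᵐ[μ.variation]
        fun x => ∫ y, F (Matrix.vecCons x y) * ∏ i, h (y i) ∂absPi μ n := by
      filter_upwards [hF'.prod_right_ae] with x hx
      exact ih hx
    have hG' : Integrable (fun p : X × (Fin n → X) => F (Matrix.vecCons p.1 p.2) *
        ∏ i, h (p.2 i)) (μ.variation.prod (absPi μ n)) := by
      refine hF'.mul_bdd (c := 1) (Measurable.aestronglyMeasurable ?_)
        (Eventually.of_forall fun y => by simp [norm_prod, h1])
      exact Finset.measurable_fun_prod _ fun i _ =>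
        hh.comp ((measurable_pi_apply i).comp measurable_snd)
    rw [iterInt, VectorMeasure.integral_congr_ae hae, hμ _ hG'.integral_prod_left]
    rw [show absPi μ (n + 1) = Measure.pi fun _ => μ.variation from rfl,
      ← hmp.integral_comp hme]
    change _ = ∫ p, ((fun y => F y * ∏ i, h (y i)) ∘
      fun p : X × (Fin n → X) => Matrix.vecCons p.1 p.2) p ∂_
    rw [integral_prod _ hG]
    refine integral_congr_ae (Eventually.of_forall fun x => ?_)
    simp only [Function.comp_apply]
    rw [← integral_mul_const]
    refine integral_congr_ae (Eventually.of_forall fun y => ?_)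
    simp only [Fin.prod_univ_succ, Matrix.cons_val_zero, Matrix.cons_val_succ]
    ring

end Density

end ClusterExpansion

end

noncomputable section

namespace ClusterExpansion

open Finset

section Convolution

variable {X : Type*} [MeasurableSpace X]

lemma measurePreserving_restrict_compl (ν : Measure X) [SigmaFinite ν] {n j l : ℕ}
    {A : Finset (Fin n)} (hj : #A = j) (hl : #Aᶜ = l) :
    MeasurePreserving (fun y : Fin n → X => (y ∘ A.orderEmbOfFin hj, y ∘ Aᶜ.orderEmbOfFin hl))
      (Measure.pi fun _ => ν) ((Measure.pi fun _ => ν).prod (Measure.pi fun _ => ν)) := by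
  have h1 := (measurePreserving_piCongrLeft (fun _ : Fin n => ν)
    (finSumEquivOfFinset hj hl)).symm
  have h2 := measurePreserving_sumPiEquivProdPi (fun _ : Fin j ⊕ Fin l => ν)
  exact h2.comp h1

lemma measurableEmbedding_restrict_compl {n j l : ℕ} {A : Finset (Fin n)} (hj : #A = j)
    (hl : #Aᶜ = l) : MeasurableEmbedding
      (fun y : Fin n → X => (y ∘ A.orderEmbOfFin hj, y ∘ Aᶜ.orderEmbOfFin hl)) :=
  ((MeasurableEquiv.piCongrLeft (fun _ : Fin n => X) (finSumEquivOfFinset hj hl)).symm.trans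
    (MeasurableEquiv.sumPiEquivProdPi fun _ : Fin j ⊕ Fin l => X)).measurableEmbedding

lemma prod_eq_prod_restrict_compl {n : ℕ} (A : Finset (Fin n)) (f : Fin n → ℂ) :
    ∏ i, f i = (∏ i, f (A.orderEmbOfFin rfl i)) * ∏ i, f (Aᶜ.orderEmbOfFin rfl i) := by
  rw [← (finSumEquivOfFinset (s := A) rfl rfl).prod_comp, Fintype.prod_sum_type]
  simp

variable {μ : ComplexMeasure X} [IsFiniteMeasure μ.variation]

lemma integrable_restrict_mul_compl {f g : ∀ n, (Fin n → X) → ℂ}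
    (hf : ∀ n, Integrable (f n) (absPi μ n)) (hg : ∀ n, Integrable (g n) (absPi μ n)) {n : ℕ}
    (A : Finset (Fin n)) :
    Integrable (fun y : Fin n → X => f #A (y ∘ A.orderEmbOfFin rfl) *
      g #Aᶜ (y ∘ Aᶜ.orderEmbOfFin rfl)) (absPi μ n) :=
  ((measurePreserving_restrict_compl μ.variation rfl rfl).integrable_comp_emb
    (measurableEmbedding_restrict_compl rfl rfl)).2 ((hf #A).mul_prod (hg #Aᶜ))

/-- Integrals of symmetric convolutions become Cauchy products. -/
lemma iterInt_convolution {f g : ∀ n, (Fin n → X) → ℂ}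
    (hf : ∀ n, Integrable (f n) (absPi μ n)) (hg : ∀ n, Integrable (g n) (absPi μ n)) (n : ℕ) :
    (1 / (n.factorial : ℂ)) * iterInt μ n (fun y => ∑ A ∈ univ.powerset,
        f #A (y ∘ A.orderEmbOfFin rfl) * g #Aᶜ (y ∘ Aᶜ.orderEmbOfFin rfl)) =
      ∑ p ∈ antidiagonal n, ((1 / (p.1.factorial : ℂ)) * iterInt μ p.1 (f p.1)) *
        ((1 / (p.2.factorial : ℂ)) * iterInt μ p.2 (g p.2)) := by
  obtain ⟨h, hh, h1, hμ⟩ := exists_density μ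
  have hI : ∀ A : Finset (Fin n), ∫ y, f #A (y ∘ A.orderEmbOfFin rfl) *
      g #Aᶜ (y ∘ Aᶜ.orderEmbOfFin rfl) * ∏ i, h (y i) ∂absPi μ n =
      iterInt μ #A (f #A) * iterInt μ (n - #A) (g (n - #A)) := by
    intro A
    have hc : #Aᶜ = n - #A := by rw [card_compl, Fintype.card_fin]
    rw [← hc, iterInt_eq_integral hh h1 hμ _ (hf _), iterInt_eq_integral hh h1 hμ _ (hg _),
      ← integral_prod_mul]
    rw [show (absPi μ #A).prod (absPi μ #Aᶜ) = (Measure.pi fun _ => μ.variation).prod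
      (Measure.pi fun _ => μ.variation) from rfl,
      ← (measurePreserving_restrict_compl μ.variation (A := A) rfl rfl).integral_comp
      (measurableEmbedding_restrict_compl rfl rfl)]
    refine integral_congr_ae (Filter.Eventually.of_forall fun y => ?_)
    simp only [prod_eq_prod_restrict_compl A fun i => h (y i), Function.comp_apply]
    ring
  rw [iterInt_eq_integral hh h1 hμ _
    (integrable_finsetSum _ fun A _ => integrable_restrict_mul_compl hf hg A)]
  simp_rw [sum_mul]
  rw [integral_finsetSum _ fun A _ => integrable_mul_prod hh h1
    (integrable_restrict_mul_compl hf hg A), sum_congr rfl fun A _ => hI A,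
    sum_powerset_apply_card
      (fun m => iterInt μ m (f m) * iterInt μ (n - m) (g (n - m))),
    Nat.sum_antidiagonal_eq_sum_range_succ_mk, mul_sum, card_univ, Fintype.card_fin]
  refine sum_congr rfl fun m hm => ?_
  have hmn : m ≤ n := by simpa [Nat.lt_succ_iff] using hm
  have hn : (n.factorial : ℂ) ≠ 0 := by exact_mod_cast n.factorial_ne_zero
  have hm0 : (m.factorial : ℂ) ≠ 0 := by exact_mod_cast m.factorial_ne_zero
  have hnm : ((n - m).factorial : ℂ) ≠ 0 := by exact_mod_cast (n - m).factorial_ne_zero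
  have hch : (n.choose m : ℂ) * m.factorial * (n - m).factorial = n.factorial := by
    exact_mod_cast Nat.choose_mul_factorial_mul_factorial hmn
  rw [nsmul_eq_mul, ← hch]
  rw [← hch] at hn
  have hch0 : (n.choose m : ℂ) ≠ 0 := fun h => hn (by rw [h]; ring)
  field_simp

end Convolution

section FinEmbeddings

/-- The order embedding that sends `0` to `0` and is `e` on the successors. -/
def consEmb {j n : ℕ} (e : Fin j ↪o Fin n) : Fin (j + 1) ↪o Fin (n + 1) :=
  OrderEmbedding.ofStrictMono (Fin.cons 0 fun k => (e k).succ) (by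
    intro a b hab
    induction b using Fin.cases with
    | zero => exact absurd hab (Fin.not_lt_zero a)
    | succ b =>
      induction a using Fin.cases with
      | zero => simp
      | succ a => simpa using hab)

@[simp] lemma consEmb_zero {j n : ℕ} (e : Fin j ↪o Fin n) : consEmb e 0 = 0 := rfl

@[simp] lemma consEmb_succ {j n : ℕ} (e : Fin j ↪o Fin n) (k : Fin j) :
    consEmb e k.succ = (e k).succ := rfl

lemma univ_map_consEmb {j n : ℕ} (e : Fin j ↪o Fin n) :
    univ.map (consEmb e).toEmbedding =
      insert 0 ((univ.map e.toEmbedding).map (Fin.succOrderEmb n).toEmbedding) := by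
  ext v
  refine Fin.cases ?_ (fun k => ?_) v
  · simpa using ⟨0, rfl⟩
  · simp [Fin.exists_fin_succ, Fin.succ_ne_zero, (Fin.succ_ne_zero _).symm]

lemma vecCons_comp_consEmb {X : Type*} {j n : ℕ} (e : Fin j ↪o Fin n) (x₀ : X) (y : Fin n → X)
    (i : Fin (j + 1)) :
    (Matrix.vecCons x₀ y : Fin (n + 1) → X) (consEmb e i) = Matrix.vecCons x₀ (y ∘ e) i := by
  refine Fin.cases ?_ (fun k => ?_) i <;> simp

lemma univ_sdiff_map_succ {n : ℕ} (B : Finset (Fin n)) :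
    univ \ B.map (Fin.succOrderEmb n).toEmbedding =
      insert 0 (Bᶜ.map (Fin.succOrderEmb n).toEmbedding) := by
  ext v
  refine Fin.cases ?_ (fun k => ?_) v <;> simp

lemma univ_sdiff_insert_zero {n : ℕ} (B : Finset (Fin n)) :
    univ \ insert 0 (B.map (Fin.succOrderEmb n).toEmbedding) =
      Bᶜ.map (Fin.succOrderEmb n).toEmbedding := by
  ext v
  refine Fin.cases ?_ (fun k => ?_) v <;> simp

lemma sum_powerset_map {V V' M : Type*} [AddCommMonoid M] (e : V ↪ V')
    (S : Finset V) (F : Finset V' → M) :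
    ∑ A ∈ (S.map e).powerset, F A = ∑ B ∈ S.powerset, F (B.map e) := by
  symm
  refine sum_nbij (fun A => A.map e) ?_ ?_ ?_ fun _ _ => rfl
  · intro A hA
    simpa using hA
  · intro A _ B _ h
    exact map_injective _ h
  · intro B hB
    simp only [mem_coe, mem_powerset, subset_map_iff] at hB
    obtain ⟨A, hA, rfl⟩ := hB
    exact ⟨A, by simpa using hA, rfl⟩

lemma sum_powerset_univ_zero_mem {M : Type*} [AddCommMonoid M] {n : ℕ}
    (F : Finset (Fin (n + 1)) → M) :
    ∑ A ∈ univ.powerset with 0 ∈ A, F A =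
      ∑ B ∈ univ.powerset, F (insert 0 (B.map (Fin.succOrderEmb n).toEmbedding)) := by
  have h : (univ : Finset (Fin (n + 1))).erase 0 = univ.map (Fin.succOrderEmb n).toEmbedding := by
    ext v
    refine Fin.cases ?_ (fun k => ?_) v <;> simp
  rw [sum_powerset_filter_mem (mem_univ _), h, sum_powerset_map]

lemma sum_powerset_univ_succ {M : Type*} [AddCommMonoid M] {n : ℕ}
    (F : Finset (Fin (n + 1)) → M) :
    ∑ A ∈ univ.powerset, F A = ∑ B ∈ univ.powerset, F (B.map (Fin.succOrderEmb n).toEmbedding) +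
      ∑ B ∈ univ.powerset, F (insert 0 (B.map (Fin.succOrderEmb n).toEmbedding)) := by
  have h : (univ : Finset (Fin (n + 1))) =
      insert 0 (univ.map (Fin.succOrderEmb n).toEmbedding) := by
    ext v
    refine Fin.cases ?_ (fun k => ?_) v <;> simp
  conv_lhs => rw [h]
  rw [sum_powerset_insert (by simp), sum_powerset_map, sum_powerset_map]

end FinEmbeddings

section Connected

variable {X : Type*} [MeasurableSpace X]

namespace PairInteraction

lemma zeta_symm (u : PairInteraction X) (x y : X) : u.zeta x y = u.zeta y x := by
  simp only [zeta, val, u.re_symm x y, u.im_symm x y]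

/-- The sum over connected graphs, without the factor `1 / n!`. -/
def conn (u : PairInteraction X) {n : ℕ} (x : Fin n → X) : ℂ :=
  mayer (fun i j => u.zeta (x i) (x j)) univ

lemma weight_eq_boltz (u : PairInteraction X) {n : ℕ} (x : Fin n → X) :
    u.weight x = boltz (fun i j => u.zeta (x i) (x j)) univ := by
  simp only [weight, boltz, pairs, univ_product_univ]

lemma phi_eq (u : PairInteraction X) {n : ℕ} (x : Fin (n + 1) → X) :
    u.phi x = (1 / ((n + 1).factorial : ℂ)) * u.conn x := by
  classical
  rw [phi, conn, mayer]
  congr 1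
  refine sum_nbij' (fun G => univ.filter fun p : Fin (n + 1) × Fin (n + 1) =>
    p.1 < p.2 ∧ G.Adj p.1 p.2) edgeGraph ?_ ?_ ?_ ?_ ?_
  · intro G hG
    have hEG : edgeGraph (univ.filter fun p : Fin (n + 1) × Fin (n + 1) =>
        p.1 < p.2 ∧ G.Adj p.1 p.2) = G := by
      ext i j
      simp only [edgeGraph, SimpleGraph.fromRel_adj, mem_filter, mem_univ, true_and]
      constructor
      · rintro ⟨_, h | h⟩
        · exact h.2
        · exact h.2.symm
      · intro h
        refine ⟨h.ne, (lt_or_gt_of_ne h.ne).imp (fun h' => ⟨h', h⟩) fun h' => ⟨h', h.symm⟩⟩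
    simp only [mem_filter, mem_univ, true_and] at hG
    simp only [mem_filter, mem_powerset]
    refine ⟨fun p hp => ?_, fun i _ j _ => ?_⟩
    · simp only [mem_filter, mem_univ, true_and] at hp
      simp [mem_pairs, hp.1]
    · rw [hEG]
      exact hG.preconnected i j
  · intro E hE
    simp only [mem_filter, mem_univ, true_and] at hE ⊢
    exact (SimpleGraph.connected_iff _).2
      ⟨fun i j => hE.2 i (mem_univ i) j (mem_univ j), inferInstance⟩
  · intro G hG
    ext i j
    simp only [edgeGraph, SimpleGraph.fromRel_adj, mem_filter, mem_univ, true_and]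
    constructor
    · rintro ⟨_, h | h⟩
      · exact h.2
      · exact h.2.symm
    · intro h
      refine ⟨h.ne, (lt_or_gt_of_ne h.ne).imp (fun h' => ⟨h', h⟩) fun h' => ⟨h', h.symm⟩⟩
  · intro E hE
    simp only [mem_filter, mem_powerset] at hE
    ext ⟨i, j⟩
    simp only [edgeGraph, SimpleGraph.fromRel_adj, mem_filter, mem_univ, true_and]
    constructor
    · rintro ⟨h1, _, h | h⟩
      · exact h
      · exact absurd (mem_pairs.1 (hE.1 h)).2.2 h1.asymm
    · intro h
      have h1 := (mem_pairs.1 (hE.1 h)).2.2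
      exact ⟨h1, h1.ne, Or.inl h⟩
  · intro G hG
    rfl

lemma mayer_univ_map (u : PairInteraction X) {j n : ℕ} (e : Fin (j + 1) ↪o Fin n)
    (x : Fin n → X) :
    mayer (fun i j => u.zeta (x i) (x j)) (univ.map e.toEmbedding) = u.conn (x ∘ e) :=
  mayer_map e _ univ_nonempty

lemma boltz_univ_map (u : PairInteraction X) {j n : ℕ} (e : Fin j ↪o Fin n) (x : Fin n → X) :
    boltz (fun i j => u.zeta (x i) (x j)) (univ.map e.toEmbedding) = u.weight (x ∘ e) := by
  rw [boltz_map, weight_eq_boltz]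
  rfl

lemma boltz_map_succ (u : PairInteraction X) {n : ℕ} (B : Finset (Fin n)) (x₀ : X)
    (y : Fin n → X) :
    boltz (fun i j => u.zeta (Matrix.vecCons x₀ y i : X) (Matrix.vecCons x₀ y j))
      (B.map (Fin.succOrderEmb n).toEmbedding) = u.weight (y ∘ B.orderEmbOfFin rfl) := by
  rw [boltz_map, ← boltz_univ_map u (B.orderEmbOfFin rfl) y, map_orderEmbOfFin_univ]
  rfl

lemma mayer_insert_zero_map_succ (u : PairInteraction X) {n : ℕ} (B : Finset (Fin n)) (x₀ : X)
    (y : Fin n → X) :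
    mayer (fun i j => u.zeta (Matrix.vecCons x₀ y i : X) (Matrix.vecCons x₀ y j))
      (insert 0 (B.map (Fin.succOrderEmb n).toEmbedding)) =
      u.conn (Matrix.vecCons x₀ (y ∘ B.orderEmbOfFin rfl)) := by
  have h := univ_map_consEmb (B.orderEmbOfFin rfl)
  rw [map_orderEmbOfFin_univ] at h
  rw [← h, mayer_univ_map]
  congr 1
  funext i
  exact vecCons_comp_consEmb _ _ _ i

/-- Summing over the cluster of the first point. -/
lemma weight_vecCons (u : PairInteraction X) {n : ℕ} (x₀ : X) (y : Fin n → X) :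
    u.weight (Matrix.vecCons x₀ y) = ∑ B ∈ univ.powerset,
      u.conn (Matrix.vecCons x₀ (y ∘ B.orderEmbOfFin rfl)) *
        u.weight (y ∘ Bᶜ.orderEmbOfFin rfl) := by
  rw [weight_eq_boltz, boltz_eq_sum_mayer _ (mem_univ 0), sum_powerset_univ_zero_mem]
  refine sum_congr rfl fun B _ => ?_
  rw [univ_sdiff_insert_zero, mayer_insert_zero_map_succ, boltz_map_succ]

/-- Summing over the cluster of the first point, which contains the second point or not. -/
lemma weight_vecCons_vecCons (u : PairInteraction X) {n : ℕ} (x₁ x₂ : X) (y : Fin n → X) :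
    u.weight (Matrix.vecCons x₁ (Matrix.vecCons x₂ y)) =
      ∑ B ∈ univ.powerset, u.conn (Matrix.vecCons x₁ (y ∘ B.orderEmbOfFin rfl)) *
        u.weight (Matrix.vecCons x₂ (y ∘ Bᶜ.orderEmbOfFin rfl)) +
      ∑ B ∈ univ.powerset,
        u.conn (Matrix.vecCons x₁ (Matrix.vecCons x₂ (y ∘ B.orderEmbOfFin rfl))) *
          u.weight (y ∘ Bᶜ.orderEmbOfFin rfl) := by
  rw [weight_eq_boltz, boltz_eq_sum_mayer _ (mem_univ 0), sum_powerset_univ_zero_mem,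
    sum_powerset_univ_succ]
  set z : Fin (n + 2) → X := Matrix.vecCons x₁ (Matrix.vecCons x₂ y) with hz
  congr 1 <;> refine sum_congr rfl fun B _ => ?_
  · rw [univ_sdiff_insert_zero]
    congr 1
    · have h := univ_map_consEmb ((B.orderEmbOfFin rfl).trans (Fin.succOrderEmb n))
      have h2 : univ.map ((B.orderEmbOfFin rfl).trans (Fin.succOrderEmb n)).toEmbedding =
          B.map (Fin.succOrderEmb n).toEmbedding := by
        conv_rhs => rw [← map_orderEmbOfFin_univ B rfl, map_map]
        rfl
      rw [h2] at h
      rw [← h, mayer_univ_map]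
      congr 1
      funext i
      exact vecCons_comp_consEmb _ _ _ i
    · have h := univ_map_consEmb (Bᶜ.orderEmbOfFin rfl)
      rw [map_orderEmbOfFin_univ, ← univ_sdiff_map_succ] at h
      rw [compl_eq_univ_sdiff, ← h, map_map,
        show (consEmb (Bᶜ.orderEmbOfFin rfl)).toEmbedding.trans
          (Fin.succOrderEmb (n + 1)).toEmbedding = ((consEmb (Bᶜ.orderEmbOfFin rfl)).trans
            (Fin.succOrderEmb (n + 1))).toEmbedding from rfl, boltz_univ_map]
      congr 1
      funext i
      exact vecCons_comp_consEmb _ x₂ y i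
  · rw [univ_sdiff_insert_zero]
    congr 1
    · have h := univ_map_consEmb (consEmb (B.orderEmbOfFin rfl))
      rw [univ_map_consEmb (B.orderEmbOfFin rfl), map_orderEmbOfFin_univ] at h
      rw [← h, mayer_univ_map]
      congr 1
      funext i
      refine (vecCons_comp_consEmb _ _ _ i).trans ?_
      congr 1
      funext k
      exact vecCons_comp_consEmb _ x₂ y k
    · rw [compl_eq_univ_sdiff, univ_sdiff_insert_zero]
      conv_lhs => rw [← map_orderEmbOfFin_univ Bᶜ rfl, map_map, map_map]
      exact boltz_univ_map u (((Bᶜ.orderEmbOfFin rfl).trans (Fin.succOrderEmb n)).trans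
        (Fin.succOrderEmb (n + 1))) z

end PairInteraction

end Connected

section CauchyProducts

variable {X : Type*} [MeasurableSpace X] {μ : ComplexMeasure X} [IsFiniteMeasure μ.variation]

lemma iterInt_const_mul (c : ℂ) {n : ℕ} {F : (Fin n → X) → ℂ} (hF : Integrable F (absPi μ n)) :
    iterInt μ n (fun y => c * F y) = c * iterInt μ n F := by
  obtain ⟨h, hh, h1, hμ⟩ := exists_density μ
  rw [iterInt_eq_integral hh h1 hμ _ hF, iterInt_eq_integral hh h1 hμ _ (hF.const_mul c),
    ← integral_const_mul]
  simp_rw [mul_assoc]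

lemma iterInt_add {n : ℕ} {F G : (Fin n → X) → ℂ} (hF : Integrable F (absPi μ n))
    (hG : Integrable G (absPi μ n)) :
    iterInt μ n (fun y => F y + G y) = iterInt μ n F + iterInt μ n G := by
  obtain ⟨h, hh, h1, hμ⟩ := exists_density μ
  rw [iterInt_eq_integral hh h1 hμ _ hF, iterInt_eq_integral hh h1 hμ _ hG,
    iterInt_eq_integral hh h1 hμ _ (hF.fun_add hG),
    ← integral_add (integrable_mul_prod hh h1 hF) (integrable_mul_prod hh h1 hG)]
  simp_rw [add_mul]

lemma clusterTerm₁_eq (u : PairInteraction X) (x₁ : X) {n : ℕ}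
    (h : Integrable (fun y : Fin n → X => u.conn (Matrix.vecCons x₁ y)) (absPi μ n)) :
    clusterTerm₁ μ u x₁ n =
      (1 / (n.factorial : ℂ)) * iterInt μ n fun y => u.conn (Matrix.vecCons x₁ y) := by
  have hn : (n.factorial : ℂ) ≠ 0 := by exact_mod_cast n.factorial_ne_zero
  have hn1 : (n : ℂ) + 1 ≠ 0 := by exact_mod_cast n.succ_ne_zero
  simp_rw [clusterTerm₁, PairInteraction.phi_eq]
  rw [iterInt_const_mul _ h, Nat.factorial_succ]
  push_cast
  field_simp

lemma clusterTerm₂_eq (u : PairInteraction X) (x₁ x₂ : X) {n : ℕ}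
    (h : Integrable (fun y : Fin n → X => u.conn (Matrix.vecCons x₁ (Matrix.vecCons x₂ y)))
      (absPi μ n)) :
    clusterTerm₂ μ u x₁ x₂ n = (1 / (n.factorial : ℂ)) *
      iterInt μ n fun y => u.conn (Matrix.vecCons x₁ (Matrix.vecCons x₂ y)) := by
  have hn : (n.factorial : ℂ) ≠ 0 := by exact_mod_cast n.factorial_ne_zero
  have hn1 : (n : ℂ) + 1 ≠ 0 := by exact_mod_cast n.succ_ne_zero
  have hn2 : (n : ℂ) + 2 ≠ 0 := by exact_mod_cast (n + 1).succ_ne_zero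
  simp_rw [clusterTerm₂, PairInteraction.phi_eq]
  rw [iterInt_const_mul _ h, Nat.factorial_succ, Nat.factorial_succ]
  push_cast
  rw [show (n : ℂ) + 1 + 1 = n + 2 by ring]
  field_simp

lemma ZTerm₁_eq_sum (u : PairInteraction X) (x₁ : X)
    (hW : ∀ n, Integrable (fun y : Fin n → X => u.weight y) (absPi μ n))
    (hC : ∀ n, Integrable (fun y : Fin n → X => u.conn (Matrix.vecCons x₁ y)) (absPi μ n))
    (n : ℕ) :
    ZTerm₁ μ u x₁ n = ∑ p ∈ antidiagonal n, clusterTerm₁ μ u x₁ p.1 * ZTerm μ u p.2 := by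
  simp_rw [ZTerm₁, PairInteraction.weight_vecCons]
  rw [iterInt_convolution (f := fun n y => u.conn (Matrix.vecCons x₁ y))
    (g := fun n y => u.weight y) hC hW]
  refine sum_congr rfl fun p _ => ?_
  rw [clusterTerm₁_eq u x₁ (hC p.1), ZTerm]

lemma ZTerm₂_eq_sum (u : PairInteraction X) (x₁ x₂ : X)
    (hW : ∀ n, Integrable (fun y : Fin n → X => u.weight y) (absPi μ n))
    (hW₂ : ∀ n, Integrable (fun y : Fin n → X => u.weight (Matrix.vecCons x₂ y)) (absPi μ n))
    (hC₁ : ∀ n, Integrable (fun y : Fin n → X => u.conn (Matrix.vecCons x₁ y)) (absPi μ n))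
    (hC₂ : ∀ n, Integrable (fun y : Fin n → X =>
      u.conn (Matrix.vecCons x₁ (Matrix.vecCons x₂ y))) (absPi μ n)) (n : ℕ) :
    ZTerm₂ μ u x₁ x₂ n =
      ∑ p ∈ antidiagonal n, clusterTerm₁ μ u x₁ p.1 * ZTerm₁ μ u x₂ p.2 +
      ∑ p ∈ antidiagonal n, clusterTerm₂ μ u x₁ x₂ p.1 * ZTerm μ u p.2 := by
  simp_rw [ZTerm₂, PairInteraction.weight_vecCons_vecCons]
  rw [iterInt_add
    (integrable_finsetSum _ fun A _ => integrable_restrict_mul_compl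
      (f := fun n y => u.conn (Matrix.vecCons x₁ y))
      (g := fun n y => u.weight (Matrix.vecCons x₂ y)) hC₁ hW₂ A)
    (integrable_finsetSum _ fun A _ => integrable_restrict_mul_compl
      (f := fun n y => u.conn (Matrix.vecCons x₁ (Matrix.vecCons x₂ y)))
      (g := fun n y => u.weight y) hC₂ hW A), mul_add,
    iterInt_convolution (f := fun n y => u.conn (Matrix.vecCons x₁ y))
      (g := fun n y => u.weight (Matrix.vecCons x₂ y)) hC₁ hW₂,
    iterInt_convolution (f := fun n y => u.conn (Matrix.vecCons x₁ (Matrix.vecCons x₂ y)))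
      (g := fun n y => u.weight y) hC₂ hW]
  congr 1 <;> refine sum_congr rfl fun p _ => ?_
  · rw [clusterTerm₁_eq u x₁ (hC₁ p.1), ZTerm₁]
  · rw [clusterTerm₂_eq u x₁ x₂ (hC₂ p.1), ZTerm]

end CauchyProducts

section PowerSeries

lemma hasDerivAt_tsum_mul_pow {z : ℕ → ℂ} (hz : ∀ r : ℝ, Summable fun n => ‖z n‖ * r ^ n) (w : ℂ) :
    HasDerivAt (fun w => ∑' n, z n * w ^ n) (∑' n, ((n + 1 : ℕ) : ℂ) * z (n + 1) * w ^ n) w := by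
  set R : ℝ := ‖w‖ + 1
  have hR : 1 ≤ R := by simp [R]
  have hsum : Summable fun n => ‖z n‖ * (2 * R) ^ n := hz _
  have hbound : ∀ n : ℕ, ∀ y ∈ Metric.ball (0 : ℂ) R,
      ‖z n * ((n : ℂ) * y ^ (n - 1))‖ ≤ ‖z n‖ * (2 * R) ^ n := fun n y hy => by
    rw [norm_mul, norm_mul, norm_pow, Complex.norm_natCast, mul_pow]
    have h1 : (n : ℝ) ≤ 2 ^ n := by exact_mod_cast n.lt_two_pow_self.le
    have h2 : ‖y‖ ^ (n - 1) ≤ R ^ n :=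
      (pow_le_pow_left₀ (norm_nonneg y) (by simpa using (mem_ball_zero_iff.1 hy).le) _).trans
        (pow_le_pow_right₀ hR (n.sub_le 1))
    gcongr
  have h := hasDerivAt_tsum_of_isPreconnected (g := fun n w => z n * w ^ n)
    (g' := fun n w => z n * ((n : ℂ) * w ^ (n - 1))) (y₀ := 0) (y := w) hsum Metric.isOpen_ball
    (convex_ball (0 : ℂ) R).isPreconnected (fun n y _ => (hasDerivAt_pow n y).const_mul (z n))
    hbound (Metric.mem_ball_self (by linarith))
    (summable_of_ne_finset_zero (s := {0}) fun n hn => by simp_all) (by simp [R])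
  have hs : Summable fun n : ℕ => z n * ((n : ℂ) * w ^ (n - 1)) :=
    Summable.of_norm_bounded hsum fun n => hbound n w (by simp [R])
  refine h.congr_deriv ?_
  rw [hs.tsum_eq_zero_add]
  simp only [Nat.cast_zero, zero_mul, mul_zero, zero_add, Nat.add_sub_cancel]
  exact tsum_congr fun n => by ring

/-- The solution of `f' = e f` with `f 0 = 1` is the exponential of a primitive of `e`; it does not
vanish on the closed unit disc if the coefficients of `e` are absolutely summable. -/
lemma tsum_mul_pow_ne_zero {z e : ℕ → ℂ} (hz : ∀ r : ℝ, Summable fun n => ‖z n‖ * r ^ n)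
    (he : Summable fun n => ‖e n‖) (hz0 : z 0 = 1)
    (hrec : ∀ n : ℕ, ((n + 1 : ℕ) : ℂ) * z (n + 1) = ∑ p ∈ antidiagonal n, e p.1 * z p.2)
    {w : ℂ} (hw : ‖w‖ ≤ 1) : ∑' n, z n * w ^ n ≠ 0 := by
  set F : ℂ → ℂ := fun w => ∑' n, z n * w ^ n
  set P : ℂ → ℂ := fun w => ∑' n, e n * (w ^ (n + 1) / ((n + 1 : ℕ) : ℂ))
  have hn1 : ∀ n : ℕ, ((n + 1 : ℕ) : ℂ) ≠ 0 := fun n => by exact_mod_cast n.succ_ne_zero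
  have hF : ∀ w, HasDerivAt F (∑' n, ((n + 1 : ℕ) : ℂ) * z (n + 1) * w ^ n) w :=
    hasDerivAt_tsum_mul_pow hz
  have hPd : ∀ w ∈ Metric.ball (0 : ℂ) 1, HasDerivAt P (∑' n, e n * w ^ n) w := fun w hw =>
    hasDerivAt_tsum_of_isPreconnected (y₀ := 0) he Metric.isOpen_ball
      (convex_ball (0 : ℂ) 1).isPreconnected
      (fun n y _ => by
        have h := ((hasDerivAt_pow (n + 1) y).div_const ((n + 1 : ℕ) : ℂ)).const_mul (e n)
        rwa [Nat.add_sub_cancel, mul_div_cancel_left₀ _ (hn1 n)] at h)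
      (fun n y hy => by
        rw [norm_mul, norm_pow]
        exact mul_le_of_le_one_right (norm_nonneg _)
          (pow_le_one₀ (norm_nonneg _) (mem_ball_zero_iff.1 hy).le))
      (Metric.mem_ball_self one_pos) (by simp [summable_zero]) hw
  have hPc : ContinuousOn P (Metric.closedBall 0 1) :=
    continuousOn_tsum (fun n => by fun_prop) he fun n y hy => by
      rw [norm_mul, norm_div, norm_pow, Complex.norm_natCast]
      refine mul_le_of_le_one_right (norm_nonneg _) (div_le_one_of_le₀ ?_ (by positivity))
      exact (pow_le_one₀ (norm_nonneg _) (mem_closedBall_zero_iff.1 hy)).trans (by simp)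
  have hFc : Continuous F := continuous_iff_continuousAt.2 fun w => (hF w).continuousAt
  have hd : ∀ w ∈ Metric.ball (0 : ℂ) 1,
      HasDerivAt (fun w => F w * Complex.exp (-P w)) 0 w := fun w hw => by
    have hw1 : ‖w‖ ≤ 1 := (mem_ball_zero_iff.1 hw).le
    have h1 : Summable fun n => ‖e n * w ^ n‖ :=
      Summable.of_nonneg_of_le (fun _ => norm_nonneg _) (fun n => by
        rw [norm_mul, norm_pow]
        exact mul_le_of_le_one_right (norm_nonneg _) (pow_le_one₀ (norm_nonneg _) hw1)) he
    have h2 : Summable fun n => ‖z n * w ^ n‖ := by simpa using hz ‖w‖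
    have hprod : (∑' n, e n * w ^ n) * F w = ∑' n, ((n + 1 : ℕ) : ℂ) * z (n + 1) * w ^ n := by
      rw [tsum_mul_tsum_eq_tsum_sum_antidiagonal_of_summable_norm h1 h2]
      refine tsum_congr fun n => ?_
      rw [hrec, sum_mul]
      refine sum_congr rfl fun p hp => ?_
      rw [← mem_antidiagonal.1 hp, pow_add]
      ring
    refine ((hF w).mul (hPd w hw).neg.cexp).congr_deriv ?_
    rw [← hprod]
    ring
  have hconst : Set.EqOn (fun w => F w * Complex.exp (-P w)) (fun _ => 1)
      (Metric.ball (0 : ℂ) 1) := fun w hw => by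
    have h := Metric.isOpen_ball.is_const_of_deriv_eq_zero (convex_ball (0 : ℂ) 1).isPreconnected
      (fun w hw => (hd w hw).differentiableAt.differentiableWithinAt)
      (fun w hw => (hd w hw).deriv) hw (Metric.mem_ball_self one_pos)
    have hF0 : F 0 = 1 := by
      simp only [F]
      rw [tsum_eq_single 0 fun n hn => by simp [hn]]
      simp [hz0]
    have hP0 : P 0 = 0 := by simp [P]
    simpa [hF0, hP0] using h
  have hclosed := hconst.of_subset_closure (t := Metric.closedBall 0 1)
    (hFc.continuousOn.mul (Complex.continuous_exp.comp_continuousOn hPc.neg)) continuousOn_const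
    Metric.ball_subset_closedBall (by rw [closure_ball _ one_ne_zero])
  exact left_ne_zero_of_mul_eq_one (hclosed (mem_closedBall_zero_iff.2 hw))

lemma eq_zero_of_tsum_mul_pow_eq_zero {c : ℕ → ℂ} (hc : Summable fun n => ‖c n‖)
    (h : ∀ w : ℂ, ‖w‖ ≤ 1 → ∑' n, c n * w ^ n = 0) : c = 0 := by
  have hp : HasFPowerSeriesAt (0 : ℂ → ℂ) (FormalMultilinearSeries.ofScalars ℂ c) 0 := by
    rw [hasFPowerSeriesAt_iff]
    filter_upwards [Metric.closedBall_mem_nhds (0 : ℂ) one_pos] with w hw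
    have hw1 := mem_closedBall_zero_iff.1 hw
    have hs : Summable fun n => c n * w ^ n := Summable.of_norm_bounded hc fun n => by
      rw [norm_mul, norm_pow]
      exact mul_le_of_le_one_right (norm_nonneg _) (pow_le_one₀ (norm_nonneg _) hw1)
    have := hs.hasSum
    rw [h w hw1] at this
    simpa [FormalMultilinearSeries.coeff_ofScalars, mul_comm] using this
  funext n
  rw [← FormalMultilinearSeries.coeff_ofScalars (p := c) (n := n), hp.eq_zero]
  rfl

/-- An entire function without zeros on the closed unit disc has a reciprocal with absolutely
summable Taylor coefficients. -/
lemma exists_summable_inverse {z : ℕ → ℂ} (hz : ∀ r : ℝ, Summable fun n => ‖z n‖ * r ^ n)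
    (hne : ∀ w : ℂ, ‖w‖ ≤ 1 → ∑' n, z n * w ^ n ≠ 0) :
    ∃ v : ℕ → ℂ, (Summable fun n => ‖v n‖) ∧ PowerSeries.mk z * PowerSeries.mk v = 1 := by
  set F : ℂ → ℂ := fun w => ∑' n, z n * w ^ n
  have hF : Differentiable ℂ F := fun w => (hasDerivAt_tsum_mul_pow hz w).differentiableAt
  obtain ⟨δ, hδ, hsub⟩ := (isCompact_closedBall (0 : ℂ) 1).exists_cthickening_subset_open
    (isOpen_compl_singleton.preimage hF.continuous : IsOpen (F ⁻¹' {0}ᶜ))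
    fun w hw => hne w (mem_closedBall_zero_iff.1 hw)
  rw [cthickening_closedBall hδ.le zero_le_one] at hsub
  set R : NNReal := ⟨δ + 1, by positivity⟩
  have hR : (1 : ℝ≥0∞) < R := by
    exact_mod_cast (show (1 : NNReal) < R from by
      rw [← NNReal.coe_lt_coe]
      change (1 : ℝ) < δ + 1
      linarith)
  have hp := DifferentiableOn.hasFPowerSeriesOnBall (R := R) (c := 0) (f := fun w => (F w)⁻¹)
    (fun w hw => ((hF w).inv (hsub hw)).differentiableWithinAt)
    (by exact_mod_cast (zero_lt_one.trans hR))
  set p := cauchyPowerSeries (fun w => (F w)⁻¹) 0 (R : ℝ)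
  have hv : Summable fun n => ‖p.coeff n‖ := by
    have := p.summable_norm_mul_pow (r := 1) (by exact_mod_cast hR.trans_le hp.r_le)
    simpa [FormalMultilinearSeries.norm_apply_eq_norm_coef] using this
  have hz1 : Summable fun n => ‖z n‖ := by simpa using hz 1
  refine ⟨p.coeff, hv, ?_⟩
  have hpow : ∀ {c : ℕ → ℂ}, (Summable fun n => ‖c n‖) → ∀ {w : ℂ}, ‖w‖ ≤ 1 →
      Summable fun n => ‖c n * w ^ n‖ := fun hc w hw =>
    Summable.of_nonneg_of_le (fun _ => norm_nonneg _) (fun n => by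
      rw [norm_mul, norm_pow]
      exact mul_le_of_le_one_right (norm_nonneg _) (pow_le_one₀ (norm_nonneg _) hw)) hc
  set c : ℕ → ℂ := fun n => ∑ q ∈ antidiagonal n, z q.1 * p.coeff q.2
  have hc : Summable fun n => ‖c n‖ := summable_norm_sum_mul_antidiagonal_of_summable_norm hz1 hv
  set d : ℕ → ℂ := fun n => if n = 0 then 1 else 0
  have hd : Summable fun n => ‖d n‖ :=
    summable_of_ne_finset_zero (s := {0}) fun n hn => by simp_all [d]
  have hcd : c - d = 0 := by
    refine eq_zero_of_tsum_mul_pow_eq_zero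
      (Summable.of_nonneg_of_le (fun _ => norm_nonneg _) (fun n => norm_sub_le _ _) (hc.add hd))
      fun w hw => ?_
    have hsum := (hp.hasSum (y := w) (by
      rw [Metric.eball_coe, mem_ball_zero_iff]
      change ‖w‖ < δ + 1
      linarith)).tsum_eq
    simp only [FormalMultilinearSeries.apply_eq_pow_smul_coeff, smul_eq_mul, zero_add] at hsum
    have hmul := tsum_mul_tsum_eq_tsum_sum_antidiagonal_of_summable_norm (hpow hz1 hw) (hpow hv hw)
    have hc1 : ∑' n, c n * w ^ n = 1 := by
      rw [← mul_inv_cancel₀ (hne w hw), ← hsum]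
      simp_rw [mul_comm (w ^ _) (p.coeff _)]
      rw [hmul]
      refine tsum_congr fun n => ?_
      rw [sum_mul]
      refine sum_congr rfl fun q hq => ?_
      rw [← mem_antidiagonal.1 hq, pow_add]
      ring
    simp only [Pi.sub_apply, sub_mul]
    rw [Summable.tsum_sub (hpow hc hw).of_norm (hpow hd hw).of_norm, hc1,
      tsum_eq_single 0 fun n hn => by simp [d, hn]]
    simp [d]
  ext n
  rw [PowerSeries.coeff_mul, PowerSeries.coeff_one]
  simp only [PowerSeries.coeff_mk]
  exact sub_eq_zero.1 (congrFun hcd n)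

lemma summable_norm_of_convolution {z v c d : ℕ → ℂ}
    (hv : Summable fun n => ‖v n‖) (hzv : PowerSeries.mk z * PowerSeries.mk v = 1)
    (hd : Summable fun n => ‖d n‖) (hc : ∀ n, d n = ∑ p ∈ antidiagonal n, c p.1 * z p.2) :
    Summable fun n => ‖c n‖ := by
  have h : PowerSeries.mk d = PowerSeries.mk c * PowerSeries.mk z := by
    ext n
    simp [PowerSeries.coeff_mul, hc]
  have h' : PowerSeries.mk c = PowerSeries.mk d * PowerSeries.mk v := by
    rw [h, mul_assoc, hzv, mul_one]
  have hcn : c = fun n => ∑ p ∈ antidiagonal n, d p.1 * v p.2 := by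
    funext n
    have := congrArg (PowerSeries.coeff n) h'
    simpa [PowerSeries.coeff_mul] using this
  rw [hcn]
  exact summable_norm_sum_mul_antidiagonal_of_summable_norm hd hv

lemma tsum_convolution {z c d : ℕ → ℂ} (hz : Summable fun n => ‖z n‖) (hcs : Summable fun n => ‖c n‖)
    (hc : ∀ n, d n = ∑ p ∈ antidiagonal n, c p.1 * z p.2) :
    ∑' n, d n = (∑' n, c n) * ∑' n, z n := by
  rw [tsum_mul_tsum_eq_tsum_sum_antidiagonal_of_summable_norm hcs hz]
  exact tsum_congr hc

end PowerSeries

section Measurability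

variable {X : Type*} [MeasurableSpace X]

namespace PairInteraction

lemma measurable_val (u : PairInteraction X) : Measurable fun p : X × X => u.val p.1 p.2 := by
  unfold val
  exact (Complex.measurable_ofReal.comp (measurable_ereal_toReal.comp u.measurable_re)).add
    ((Complex.measurable_ofReal.comp u.measurable_im).mul_const _)

lemma measurableSet_re_eq_top (u : PairInteraction X) :
    MeasurableSet {p : X × X | u.re p.1 p.2 = ⊤} :=
  u.measurable_re (measurableSet_singleton ⊤)

lemma measurable_zeta (u : PairInteraction X) : Measurable fun p : X × X => u.zeta p.1 p.2 := by
  unfold zeta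
  exact Measurable.ite u.measurableSet_re_eq_top measurable_const
    ((Complex.measurable_exp.comp u.measurable_val.neg).sub_const 1)

lemma measurable_ubar (u : PairInteraction X) : Measurable fun p : X × X => u.ubar p.1 p.2 := by
  unfold ubar
  exact Measurable.ite u.measurableSet_re_eq_top measurable_const u.measurable_val

lemma measurable_weight (u : PairInteraction X) (n : ℕ) :
    Measurable fun x : Fin n → X => u.weight x := by
  unfold weight
  exact Finset.measurable_fun_prod _ fun p _ =>
    (measurable_pair u.measurable_zeta p.1 p.2).const_add 1

lemma measurable_conn (u : PairInteraction X) (n : ℕ) :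
    Measurable fun x : Fin n → X => u.conn x := by
  unfold conn mayer
  exact Finset.measurable_fun_sum _ fun E _ => Finset.measurable_fun_prod _ fun p _ =>
    measurable_pair u.measurable_zeta p.1 p.2

lemma norm_one_add_zeta (u : PairInteraction X) {x y : X} (h : u.re x y ≠ ⊤) :
    ‖1 + u.zeta x y‖ = Real.exp (-(u.val x y).re) := by
  rw [zeta, if_neg h, add_sub_cancel, Complex.norm_exp, Complex.neg_re]

lemma val_symm (u : PairInteraction X) (x y : X) : u.val x y = u.val y x := by
  rw [val, val, u.re_symm, u.im_symm]

/-- Tree bound under the stability of all subconfigurations, with weights `|ū|`. -/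
lemma norm_conn_le_forest_ubar (u : PairInteraction X) {n : ℕ} {x : Fin (n + 1) → X} {b : X → ℝ}
    (hb : ∀ x, 0 ≤ b x)
    (hst : ∀ A : Finset (Fin (n + 1)), ∏ p ∈ pairs A, ‖1 + u.zeta (x p.1) (x p.2)‖ ≤
      ∏ i ∈ A, Real.exp (b (x i))) :
    ‖u.conn x‖ ≤ (∏ i, Real.exp (b (x i))) *
      forest (fun i j => ‖u.ubar (x i) (x j)‖) {0} (univ.erase 0) := by
  classical
  have h := norm_mayer_le_forest_hard (z := fun i j => u.val (x i) (x j))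
    (hard := fun i j => u.re (x i) (x j) = ⊤) (b := fun i => b (x i))
    (fun i j => u.val_symm _ _) (fun i j => by rw [u.re_symm]) (fun i => hb _)
    (fun A hA => by
      have hA' := hst A
      rw [prod_congr rfl fun p hp => u.norm_one_add_zeta (hA p hp), ← Real.exp_sum,
        ← Real.exp_sum, Real.exp_le_exp, sum_neg_distrib] at hA'
      rw [Complex.re_sum]
      linarith) (mem_univ (0 : Fin (n + 1)))
  have hubar : (fun i j => ‖u.ubar (x i) (x j)‖) =
      fun i j => if u.re (x i) (x j) = ⊤ then (1 : ℝ) else ‖u.val (x i) (x j)‖ := by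
    funext i j
    simp only [ubar]
    split_ifs <;> simp
  rw [hubar]
  simp only [conn, zeta]
  convert h

end PairInteraction

end Measurability

section Stability

variable {X : Type*} [MeasurableSpace X] {μ : ComplexMeasure X} [IsFiniteMeasure μ.variation]

lemma Stable.ae_forall_finset {u : PairInteraction X} {b : X → ℝ} (h : Stable μ u b) (n : ℕ) :
    ∀ᵐ x ∂absPi μ n, ∀ A : Finset (Fin n),
      ∏ p ∈ pairs A, ‖1 + u.zeta (x p.1) (x p.2)‖ ≤ ∏ i ∈ A, Real.exp (b (x i)) := by
  rw [ae_all_iff]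
  intro A
  have hq := Measure.quasiMeasurePreserving_fst.comp
    (measurePreserving_restrict_compl μ.variation (A := A) rfl rfl).quasiMeasurePreserving
  filter_upwards [hq.ae (h #A)] with x hx
  have hA := map_orderEmbOfFin_univ A rfl
  have h1 := prod_pairs_map (A.orderEmbOfFin rfl) (fun i j => ‖1 + u.zeta (x i) (x j)‖) univ
  have h2 := prod_map univ (A.orderEmbOfFin rfl).toEmbedding fun i => Real.exp (b (x i))
  rw [hA] at h1 h2
  rw [h1, h2]
  simp only [pairs, univ_product_univ]
  exact hx

/-- A pointwise tree bound by weights `κ` that satisfy the convergence criterion almost everywhere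
gives a tree bound by weights that satisfy it everywhere. -/
lemma exists_forest_bound {u : PairInteraction X} {a b : X → ℝ} (ha : Measurable a)
    (hb : Measurable b) (hb0 : ∀ x, 0 ≤ b x) {β : ℝ} (hβ : β ≤ 2) {κ : X → X → NNReal}
    (hκ : Measurable fun p : X × X => κ p.1 p.2)
    (hcrit : ∀ᵐ x ∂μ.variation, ∫⁻ y, (κ x y : ℝ≥0∞) * ENNReal.ofReal (Real.exp (β * b y)) *
      ENNReal.ofReal (Real.exp (a y)) ∂μ.variation ≤ ENNReal.ofReal (a x))
    (hconn : ∀ n, ∀ᵐ x ∂absPi μ (n + 1), ‖u.conn x‖ ≤ (∏ i, Real.exp (β * b (x i))) *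
      forest (fun i j => (κ (x i) (x j) : ℝ)) {0} (univ.erase 0)) :
    ∃ w : X → X → ℝ≥0∞, Measurable (fun p : X × X => w p.1 p.2) ∧
      (∀ x, ∫⁻ y, w x y * ENNReal.ofReal (Real.exp (a y)) ∂μ.variation ≤ ENNReal.ofReal (a x)) ∧
      ∀ n, ∀ᵐ x ∂absPi μ (n + 1), ‖u.conn x‖ₑ ≤ ENNReal.ofReal (Real.exp (2 * b (x 0))) *
        forest (fun i j => w (x i) (x j)) {0} (univ.erase 0) := by
  classical
  set g : X → NNReal := fun y => (Real.exp (β * b y)).toNNReal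
  have hg : Measurable g := by fun_prop
  set S : Set X := {x | ∫⁻ y, (κ x y : ℝ≥0∞) * (g y : ℝ≥0∞) *
    ENNReal.ofReal (Real.exp (a y)) ∂μ.variation ≤ ENNReal.ofReal (a x)}
  have hmeas : Measurable fun p : X × X => (κ p.1 p.2 : ℝ≥0∞) * (g p.2 : ℝ≥0∞) :=
    hκ.coe_nnreal_ennreal.mul (hg.comp measurable_snd).coe_nnreal_ennreal
  have hS : MeasurableSet S := measurableSet_le
    (Measurable.lintegral_prod_right' (f := fun p : X × X => (κ p.1 p.2 : ℝ≥0∞) * (g p.2 : ℝ≥0∞) *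
      ENNReal.ofReal (Real.exp (a p.2))) (hmeas.mul (by fun_prop))) (by fun_prop)
  have hSae : ∀ᵐ x ∂μ.variation, x ∈ S := hcrit
  refine ⟨fun x y => if x ∈ S then κ x y * g y else 0, ?_, fun x => ?_, fun n => ?_⟩
  · exact Measurable.ite (measurable_fst hS) hmeas measurable_const
  · by_cases hx : x ∈ S
    · simp only [if_pos hx]
      exact hx
    · simp [hx]
  · have hall : ∀ᵐ x ∂absPi μ (n + 1), ∀ i, x i ∈ S := ae_all_iff.2 fun i =>
      (Measure.quasiMeasurePreserving_eval (fun _ => μ.variation) i).ae hSae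
    filter_upwards [hall, hconn n] with x hx hc
    have hd : Disjoint ({0} : Finset (Fin (n + 1))) (univ.erase 0) := by simp
    simp only [hx, if_true]
    rw [forest_mul_child (fun i j => (κ (x i) (x j) : ℝ≥0∞)) (fun j => (g (x j) : ℝ≥0∞)) hd,
      ← mul_assoc]
    have hF := map_forest NNReal.toRealHom (fun i j => κ (x i) (x j)) hd
    have hF' : ((forest (fun i j => κ (x i) (x j)) {0} (univ.erase 0) : NNReal) : ℝ≥0∞) =
        forest (fun i j => (κ (x i) (x j) : ℝ≥0∞)) {0} (univ.erase 0) :=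
      map_forest ENNReal.ofNNRealHom (fun i j => κ (x i) (x j)) hd
    simp only [NNReal.coe_toRealHom] at hF
    rw [← hF] at hc
    rw [← hF', ← ofReal_norm]
    refine (ENNReal.ofReal_le_ofReal hc).trans ?_
    rw [ENNReal.ofReal_mul (prod_nonneg fun _ _ => (Real.exp_pos _).le), ENNReal.ofReal_coe_nnreal,
      ENNReal.ofReal_prod_of_nonneg fun _ _ => (Real.exp_pos _).le,
      ← mul_prod_erase univ _ (mem_univ 0)]
    gcongr
    · exact hb0 _
    · exact le_rfl

lemma exists_forest_bound_of_criterion {u : PairInteraction X} {a b : X → ℝ} (ha : Measurable a)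
    (hb : Measurable b) (hb0 : ∀ x, 0 ≤ b x) (hstable : Stable μ u b)
    (hcrit : ZetaCriterion μ u a b ∨ UbarCriterion μ u a b) :
    ∃ w : X → X → ℝ≥0∞, Measurable (fun p : X × X => w p.1 p.2) ∧
      (∀ x, ∫⁻ y, w x y * ENNReal.ofReal (Real.exp (a y)) ∂μ.variation ≤ ENNReal.ofReal (a x)) ∧
      ∀ n, ∀ᵐ x ∂absPi μ (n + 1), ‖u.conn x‖ₑ ≤ ENNReal.ofReal (Real.exp (2 * b (x 0))) *
        forest (fun i j => w (x i) (x j)) {0} (univ.erase 0) := by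
  have hofReal : ∀ (c : ℂ) (s t : ℝ), (‖c‖₊ : ℝ≥0∞) * ENNReal.ofReal (Real.exp s) *
      ENNReal.ofReal (Real.exp t) = ENNReal.ofReal (‖c‖ * Real.exp (t + s)) := fun c s t => by
    rw [ENNReal.ofReal_mul (norm_nonneg c), add_comm, Real.exp_add,
      ENNReal.ofReal_mul (Real.exp_pos s).le, mul_assoc, ofReal_norm]
    rfl
  rcases hcrit with hcrit | hcrit
  · refine exists_forest_bound (β := 2) (κ := fun x y => ‖u.zeta x y‖₊) ha hb hb0 le_rfl
      u.measurable_zeta.nnnorm ?_ fun n => ?_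
    · simp only [hofReal]
      exact hcrit
    · filter_upwards [hstable.ae_forall_finset (n + 1)] with x hx
      exact norm_mayer_le_forest_zeta (b := fun i => b (x i)) (fun i j => u.zeta_symm _ _) hx
        (mem_univ 0)
  · refine exists_forest_bound (β := 1) (κ := fun x y => ‖u.ubar x y‖₊) ha hb hb0 one_le_two
      u.measurable_ubar.nnnorm ?_ fun n => ?_
    · simp only [hofReal, one_mul]
      exact hcrit
    · filter_upwards [hstable.ae_forall_finset (n + 1)] with x hx
      simpa only [one_mul, coe_nnnorm] using u.norm_conn_le_forest_ubar hb0 hx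

/-- The total mass of the cluster terms. -/
theorem tsum_lintegral_conn_le {u : PairInteraction X} {a b : X → ℝ} (ha : Measurable a)
    (ha0 : ∀ x, 0 ≤ a x) (hb : Measurable b) (hb0 : ∀ x, 0 ≤ b x) (hstable : Stable μ u b)
    (hcrit : ZetaCriterion μ u a b ∨ UbarCriterion μ u a b) :
    ∑' n : ℕ, ENNReal.ofReal (1 / (n.factorial : ℝ)) *
        ∫⁻ x : Fin (n + 1) → X, ‖u.conn x‖ₑ ∂absPi μ (n + 1) ≤
      ∫⁻ y, ENNReal.ofReal (Real.exp (a y + 2 * b y)) ∂μ.variation := by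
  obtain ⟨w, hw, hwc, hconn⟩ := exists_forest_bound_of_criterion ha hb hb0 hstable hcrit
  have hf : ∀ n : ℕ, Measurable fun x : Fin (n + 1) → X =>
      forest (fun i j => w (x i) (x j)) {0} (univ.erase 0) := fun n =>
    measurable_forest hw (by simp)
  have hb2 : Measurable fun x => ENNReal.ofReal (Real.exp (2 * b x)) := by fun_prop
  have htree : ∀ n, Measurable (treeIntegral μ.variation w n) := fun n =>
    ((hf n).comp (measurable_vecCons n)).lintegral_prod_right'
  have hterm : ∀ n : ℕ, ∫⁻ x : Fin (n + 1) → X, ‖u.conn x‖ₑ ∂absPi μ (n + 1) ≤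
      ∫⁻ x, ENNReal.ofReal (Real.exp (2 * b x)) * treeIntegral μ.variation w n x ∂μ.variation := by
    intro n
    refine (lintegral_mono_ae (hconn n)).trans_eq ?_
    have hm : Measurable fun x : Fin (n + 1) → X => ENNReal.ofReal (Real.exp (2 * b (x 0))) *
        forest (fun i j => w (x i) (x j)) {0} (univ.erase 0) :=
      (hb2.comp (measurable_pi_apply 0)).mul (hf n)
    rw [absPi, ← (measurePreserving_vecCons μ.variation n).lintegral_comp hm]
    refine (lintegral_prod _ (hm.comp (measurable_vecCons n)).aemeasurable).trans ?_
    refine lintegral_congr fun x => ?_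
    simp only [Function.comp_apply, Matrix.cons_val_zero]
    exact lintegral_const_mul _ (((hf n).comp (measurable_vecCons n)).comp measurable_prodMk_left)
  calc _ ≤ ∑' n : ℕ, ENNReal.ofReal (1 / (n.factorial : ℝ)) * ∫⁻ x, ENNReal.ofReal
        (Real.exp (2 * b x)) * treeIntegral μ.variation w n x ∂μ.variation :=
        ENNReal.tsum_le_tsum fun n => mul_le_mul_right (hterm n) _
    _ = ∫⁻ x, ∑' n : ℕ, ENNReal.ofReal (1 / (n.factorial : ℝ)) * (ENNReal.ofReal
        (Real.exp (2 * b x)) * treeIntegral μ.variation w n x) ∂μ.variation := by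
        rw [lintegral_tsum fun n => ((hb2.fun_mul (htree n)).const_mul _).aemeasurable]
        exact tsum_congr fun n => (lintegral_const_mul _ (hb2.fun_mul (htree n))).symm
    _ ≤ _ := lintegral_mono fun x => by
        simp_rw [mul_left_comm _ (ENNReal.ofReal (Real.exp (2 * b x)))]
        rw [ENNReal.tsum_mul_left, add_comm, Real.exp_add, ENNReal.ofReal_mul (Real.exp_pos _).le]
        gcongr
        exact tsum_treeIntegral_le hw ha ha0 hwc x

end Stability

section Slices

variable {X : Type*} [MeasurableSpace X]

lemma measurePreserving_vecCons_vecCons (ν : Measure X) [SigmaFinite ν] (n : ℕ) :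
    MeasurePreserving (fun q : (X × X) × (Fin n → X) =>
        (Matrix.vecCons q.1.1 (Matrix.vecCons q.1.2 q.2) : Fin (n + 2) → X))
      ((ν.prod ν).prod (Measure.pi fun _ => ν)) (Measure.pi fun _ => ν) :=
  ((measurePreserving_vecCons ν (n + 1)).comp
    ((MeasurePreserving.id ν).prod (measurePreserving_vecCons ν n))).comp
    (measurePreserving_prodAssoc ν ν (Measure.pi fun _ => ν))

variable {μ : ComplexMeasure X} [IsFiniteMeasure μ.variation]

lemma ae_vecCons {n : ℕ} {P : (Fin (n + 1) → X) → Prop} (h : ∀ᵐ x ∂absPi μ (n + 1), P x) :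
    ∀ᵐ x₁ ∂μ.variation, ∀ᵐ y ∂absPi μ n, P (Matrix.vecCons x₁ y) :=
  Measure.ae_ae_of_ae_prod
    ((measurePreserving_vecCons μ.variation n).quasiMeasurePreserving.ae h)

lemma ae_vecCons_vecCons {n : ℕ} {P : (Fin (n + 2) → X) → Prop}
    (h : ∀ᵐ x ∂absPi μ (n + 2), P x) :
    ∀ᵐ p ∂μ.variation.prod μ.variation, ∀ᵐ y ∂absPi μ n,
      P (Matrix.vecCons p.1 (Matrix.vecCons p.2 y)) :=
  Measure.ae_ae_of_ae_prod
    ((measurePreserving_vecCons_vecCons μ.variation n).quasiMeasurePreserving.ae h)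

lemma ae_integrable_vecCons {n : ℕ} {F : (Fin (n + 1) → X) → ℂ}
    (hF : Integrable F (absPi μ (n + 1))) :
    ∀ᵐ x₁ ∂μ.variation, Integrable (fun y => F (Matrix.vecCons x₁ y)) (absPi μ n) :=
  ((measurePreserving_vecCons μ.variation n).integrable_comp_of_integrable hF).prod_right_ae

lemma ae_integrable_vecCons_vecCons {n : ℕ} {F : (Fin (n + 2) → X) → ℂ}
    (hF : Integrable F (absPi μ (n + 2))) :
    ∀ᵐ p ∂μ.variation.prod μ.variation,
      Integrable (fun y => F (Matrix.vecCons p.1 (Matrix.vecCons p.2 y))) (absPi μ n) :=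
  ((measurePreserving_vecCons_vecCons μ.variation n).integrable_comp_of_integrable hF).prod_right_ae

lemma integrable_iterInt_vecCons {n : ℕ} {F : (Fin (n + 1) → X) → ℂ}
    (hF : Integrable F (absPi μ (n + 1))) :
    Integrable (fun x => iterInt μ n fun y => F (Matrix.vecCons x y)) μ.variation := by
  obtain ⟨h, hh, h1, hμ⟩ := exists_density μ
  have hF' := (measurePreserving_vecCons μ.variation n).integrable_comp_of_integrable hF
  have hG : Integrable (fun p : X × (Fin n → X) => F (Matrix.vecCons p.1 p.2) *
      ∏ i, h (p.2 i)) (μ.variation.prod (absPi μ n)) := by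
    refine hF'.mul_bdd (c := 1) (Measurable.aestronglyMeasurable ?_)
      (Filter.Eventually.of_forall fun y => by simp [norm_prod, h1])
    exact Finset.measurable_fun_prod _ fun i _ =>
      hh.comp ((measurable_pi_apply i).comp measurable_snd)
  refine hG.integral_prod_left.congr ?_
  filter_upwards [ae_integrable_vecCons hF] with x hx
  exact (iterInt_eq_integral hh h1 hμ n hx).symm

lemma enorm_iterInt_le {n : ℕ} {F : (Fin n → X) → ℂ} (hF : Integrable F (absPi μ n)) :
    ‖iterInt μ n F‖ₑ ≤ ∫⁻ y, ‖F y‖ₑ ∂absPi μ n := by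
  obtain ⟨h, hh, h1, hμ⟩ := exists_density μ
  rw [iterInt_eq_integral hh h1 hμ _ hF]
  refine (enorm_integral_le_lintegral_enorm _).trans_eq (lintegral_congr fun y => ?_)
  rw [← ofReal_norm, ← ofReal_norm, norm_mul, norm_prod]
  simp [h1]

lemma norm_iterInt_le {n : ℕ} {F : (Fin n → X) → ℂ} (hF : Integrable F (absPi μ n)) :
    ‖iterInt μ n F‖ ≤ ∫ y, ‖F y‖ ∂absPi μ n := by
  obtain ⟨h, hh, h1, hμ⟩ := exists_density μ
  rw [iterInt_eq_integral hh h1 hμ _ hF]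
  refine (norm_integral_le_integral_norm _).trans_eq (integral_congr_ae ?_)
  exact Filter.Eventually.of_forall fun y => by simp [norm_prod, h1]

lemma integrable_prod_exp {b : X → ℝ} (hb : Integrable (fun x => Real.exp (b x)) μ.variation)
    (n : ℕ) : Integrable (fun y : Fin n → X => ∏ i, Real.exp (b (y i))) (absPi μ n) :=
  Integrable.fintype_prod fun _ => hb

lemma integrable_of_ae_le_prod_exp {b : X → ℝ}
    (hb : Integrable (fun x => Real.exp (b x)) μ.variation) {n : ℕ} {F : (Fin n → X) → ℂ}
    (hF : AEStronglyMeasurable F (absPi μ n)) {C : ℝ}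
    (h : ∀ᵐ y ∂absPi μ n, ‖F y‖ ≤ C * ∏ i, Real.exp (b (y i))) : Integrable F (absPi μ n) :=
  ((integrable_prod_exp hb n).const_mul C).mono' hF h

lemma norm_iterInt_le_pow {b : X → ℝ}
    (hb : Integrable (fun x => Real.exp (b x)) μ.variation) {n : ℕ} {F : (Fin n → X) → ℂ}
    (hF : AEStronglyMeasurable F (absPi μ n)) {C : ℝ}
    (h : ∀ᵐ y ∂absPi μ n, ‖F y‖ ≤ C * ∏ i, Real.exp (b (y i))) :
    ‖(1 / (n.factorial : ℂ)) * iterInt μ n F‖ ≤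
      C * ((∫ x, Real.exp (b x) ∂μ.variation) ^ n / (n.factorial : ℝ)) := by
  have hFi := integrable_of_ae_le_prod_exp hb hF h
  have h1 : ‖iterInt μ n F‖ ≤ C * (∫ x, Real.exp (b x) ∂μ.variation) ^ n := by
    refine (norm_iterInt_le hFi).trans
      ((integral_mono_ae hFi.norm ((integrable_prod_exp hb n).const_mul C) h).trans_eq ?_)
    rw [integral_const_mul, absPi,
      integral_fintype_prod_eq_pow (fun x => Real.exp (b x)), Fintype.card_fin]
  rw [norm_mul, norm_div, norm_one, Complex.norm_natCast, one_div, inv_mul_eq_div, ← mul_div_assoc]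
  gcongr

end Slices

section Correlations

variable {X : Type*} [MeasurableSpace X] {μ : ComplexMeasure X} {u : PairInteraction X}

lemma Stable.ae_norm_weight_le {b : X → ℝ} (h : Stable μ u b) (n : ℕ) :
    ∀ᵐ x ∂absPi μ n, ‖u.weight x‖ ≤ ∏ i, Real.exp (b (x i)) := by
  filter_upwards [h n] with x hx
  rwa [PairInteraction.weight, norm_prod]

lemma integrable_phi_of_conn {n m : ℕ} {T : (Fin n → X) → Fin (m + 1) → X}
    (h : Integrable (fun y => u.conn (T y)) (absPi μ n)) :
    Integrable (fun y => u.phi (T y)) (absPi μ n) := by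
  simp only [PairInteraction.phi_eq]
  exact h.const_mul _

variable [IsFiniteMeasure μ.variation]

lemma Stable.ae_norm_weight_vecCons_le {b : X → ℝ} (h : Stable μ u b) (n : ℕ) :
    ∀ᵐ x₁ ∂μ.variation, ∀ᵐ y ∂absPi μ n, ‖u.weight (Matrix.vecCons x₁ y)‖ ≤
      Real.exp (b x₁) * ∏ i, Real.exp (b (y i)) := by
  filter_upwards [ae_vecCons (h.ae_norm_weight_le (n + 1))] with x₁ hx₁
  filter_upwards [hx₁] with y hy
  simpa only [Fin.prod_univ_succ, Matrix.cons_val_zero, Matrix.cons_val_succ] using hy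

lemma Stable.ae_norm_weight_vecCons_vecCons_le {b : X → ℝ} (h : Stable μ u b) (n : ℕ) :
    ∀ᵐ p ∂μ.variation.prod μ.variation, ∀ᵐ y ∂absPi μ n,
      ‖u.weight (Matrix.vecCons p.1 (Matrix.vecCons p.2 y))‖ ≤
        Real.exp (b p.1) * Real.exp (b p.2) * ∏ i, Real.exp (b (y i)) := by
  filter_upwards [ae_vecCons_vecCons (h.ae_norm_weight_le (n + 2))] with p hp
  filter_upwards [hp] with y hy
  simpa only [Fin.prod_univ_succ, Matrix.cons_val_zero, Matrix.cons_val_succ, mul_assoc] using hy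

lemma summable_norm_of_le_pow_div_factorial {f : ℕ → ℂ} {B C : ℝ}
    (h : ∀ n : ℕ, ‖f n‖ ≤ C * (B ^ n / (n.factorial : ℝ))) : Summable fun n => ‖f n‖ :=
  Summable.of_nonneg_of_le (fun _ => norm_nonneg _) h
    ((Real.summable_pow_div_factorial B).mul_left C)

/-- The derivative of the partition function with respect to the activity is its product with the
sum of the integrated clusters. -/
lemma succ_mul_ZTerm (hW : ∀ n, Integrable (fun y : Fin n → X => u.weight y) (absPi μ n))
    (hC : ∀ n, Integrable (fun x : Fin (n + 1) → X => u.conn x) (absPi μ (n + 1))) (n : ℕ) :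
    ((n + 1 : ℕ) : ℂ) * ZTerm μ u (n + 1) = ∑ p ∈ antidiagonal n,
      ((1 / (p.1.factorial : ℂ)) * iterInt μ (p.1 + 1) fun x => u.conn x) * ZTerm μ u p.2 := by
  obtain ⟨h, hh, h1, hμ⟩ := exists_density μ
  have hC₁ : ∀ᵐ x ∂μ.variation, ∀ n,
      Integrable (fun y : Fin n → X => u.conn (Matrix.vecCons x y)) (absPi μ n) :=
    ae_all_iff.2 fun n => ae_integrable_vecCons (hC n)
  have hmul : ∀ {f : X → ℂ}, Integrable f μ.variation →
      Integrable (fun x => f x * h x) μ.variation := fun hf =>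
    hf.mul_bdd (c := 1) hh.aestronglyMeasurable (Filter.Eventually.of_forall fun x => (h1 x).le)
  have hcong : ∀ᵐ x ∂μ.variation,
      (1 / (n.factorial : ℂ)) * ((iterInt μ n fun y => u.weight (Matrix.vecCons x y)) * h x) =
      ∑ p ∈ antidiagonal n, ((1 / (p.1.factorial : ℂ)) * ZTerm μ u p.2) *
        ((iterInt μ p.1 fun y => u.conn (Matrix.vecCons x y)) * h x) := by
    filter_upwards [hC₁] with x hx
    have h2 := ZTerm₁_eq_sum u x hW hx n
    rw [ZTerm₁] at h2
    rw [← mul_assoc, h2, sum_mul]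
    refine sum_congr rfl fun p _ => ?_
    rw [clusterTerm₁_eq u x (hx p.1)]
    ring
  have hn : (n.factorial : ℂ) ≠ 0 := by exact_mod_cast n.factorial_ne_zero
  have hn1 : (n : ℂ) + 1 ≠ 0 := by exact_mod_cast n.succ_ne_zero
  calc ((n + 1 : ℕ) : ℂ) * ZTerm μ u (n + 1)
      = (1 / (n.factorial : ℂ)) * iterInt μ (n + 1) fun x => u.weight x := by
        rw [ZTerm, Nat.factorial_succ]
        push_cast
        field_simp
    _ = ∫ x, (1 / (n.factorial : ℂ)) *
          ((iterInt μ n fun y => u.weight (Matrix.vecCons x y)) * h x) ∂μ.variation := by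
        rw [iterInt, hμ _ (integrable_iterInt_vecCons (hW (n + 1))), integral_const_mul]
    _ = _ := by
        rw [integral_congr_ae hcong, integral_finsetSum _ fun p _ =>
          (hmul (integrable_iterInt_vecCons (hC p.1))).const_mul _]
        refine sum_congr rfl fun p _ => ?_
        rw [integral_const_mul, iterInt, hμ _ (integrable_iterInt_vecCons (hC p.1))]
        ring

lemma integrable_conn_and_summable {M : ℝ≥0∞} (hM : M < ∞)
    (h : ∑' n : ℕ, ENNReal.ofReal (1 / (n.factorial : ℝ)) *
        ∫⁻ x : Fin (n + 1) → X, ‖u.conn x‖ₑ ∂absPi μ (n + 1) ≤ M) :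
    (∀ n, Integrable (fun x : Fin (n + 1) → X => u.conn x) (absPi μ (n + 1))) ∧
    Summable fun n : ℕ =>
      ‖(1 / (n.factorial : ℂ)) * iterInt μ (n + 1) fun x => u.conn x‖ := by
  have hfin := (h.trans_lt hM).ne
  have hC : ∀ n, Integrable (fun x : Fin (n + 1) → X => u.conn x) (absPi μ (n + 1)) := fun n => by
    refine ⟨(u.measurable_conn (n + 1)).aestronglyMeasurable, ?_⟩
    have h1 := ENNReal.ne_top_of_tsum_ne_top hfin n
    refine lt_top_iff_ne_top.2 fun h2 => h1 ?_
    rw [h2, ENNReal.mul_top]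
    simpa using n.factorial_ne_zero
  refine ⟨hC, Summable.of_nonneg_of_le (fun _ => norm_nonneg _) (fun n => ?_)
    (ENNReal.summable_toReal hfin)⟩
  rw [← toReal_enorm]
  refine ENNReal.toReal_mono (ENNReal.ne_top_of_tsum_ne_top hfin n) ?_
  rw [enorm_mul]
  gcongr
  · rw [← ofReal_norm, norm_div, norm_one, Complex.norm_natCast]
  · exact enorm_iterInt_le (hC n)

end Correlations

end ClusterExpansion

end

open ClusterExpansion in
theorem theorem2 {X : Type*} [MeasurableSpace X] (μ : ComplexMeasure X)
    (u : ClusterExpansion.PairInteraction X) (a b : X → ℝ)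
    (ha : Measurable a) (ha0 : ∀ x, 0 ≤ a x) (hb : Measurable b) (hb0 : ∀ x, 0 ≤ b x)
    (hstable : ClusterExpansion.Stable μ u b)
    (hcrit : ClusterExpansion.ZetaCriterion μ u a b ∨ ClusterExpansion.UbarCriterion μ u a b)
    (hint : ∫⁻ y, ENNReal.ofReal (Real.exp (a y + 2 * b y)) ∂μ.variation < ∞) :
    ClusterExpansion.ConvZ μ u ∧ ClusterExpansion.Z μ u ≠ 0 ∧
    (∀ᵐ x₁ ∂μ.variation,
      ClusterExpansion.Conv₁ μ u x₁ ∧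
      ClusterExpansion.Z₁ μ u x₁ / ClusterExpansion.Z μ u = ClusterExpansion.Zhat₁ μ u x₁) ∧
    (∀ᵐ p ∂(μ.variation.prod μ.variation),
      ClusterExpansion.Conv₂ μ u p.1 p.2 ∧
      ClusterExpansion.Z₂ μ u p.1 p.2 / ClusterExpansion.Z μ u =
        ClusterExpansion.Zhat₁ μ u p.1 * ClusterExpansion.Zhat₁ μ u p.2 +
          ClusterExpansion.Zhat₂ μ u p.1 p.2 ∧
      ClusterExpansion.Z₂ μ u p.1 p.2 / ClusterExpansion.Z μ u -
          ClusterExpansion.Z₁ μ u p.1 * ClusterExpansion.Z₁ μ u p.2 /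
            ClusterExpansion.Z μ u ^ 2 =
        ClusterExpansion.Zhat₂ μ u p.1 p.2) := by
  have hfinite : IsFiniteMeasure μ.variation := ⟨by
    refine lt_of_le_of_lt ?_ hint
    rw [← lintegral_one]
    refine lintegral_mono fun y => ?_
    rw [← ENNReal.ofReal_one]
    exact ENNReal.ofReal_le_ofReal (Real.one_le_exp (by linarith [ha0 y, hb0 y]))⟩
  have hexp : Integrable (fun x => Real.exp (b x)) μ.variation := by
    refine ⟨by fun_prop, lt_of_le_of_lt (lintegral_mono fun y => ?_) hint⟩
    rw [← ofReal_norm, Real.norm_eq_abs, Real.abs_exp]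
    exact ENNReal.ofReal_le_ofReal (Real.exp_le_exp.2 (by linarith [ha0 y, hb0 y]))
  set B : ℝ := ∫ x, Real.exp (b x) ∂μ.variation
  have hweight : ∀ n, ∀ᵐ y ∂absPi μ n, ‖u.weight y‖ ≤ 1 * ∏ i, Real.exp (b (y i)) := fun n => by
    simpa only [one_mul] using hstable.ae_norm_weight_le n
  have hW : ∀ n, Integrable (fun y : Fin n → X => u.weight y) (absPi μ n) := fun n =>
    integrable_of_ae_le_prod_exp hexp (u.measurable_weight n).aestronglyMeasurable (hweight n)
  have hZ : ∀ n, ‖ZTerm μ u n‖ ≤ 1 * (B ^ n / (n.factorial : ℝ)) := fun n =>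
    norm_iterInt_le_pow hexp (u.measurable_weight n).aestronglyMeasurable (hweight n)
  have hZs := summable_norm_of_le_pow_div_factorial hZ
  have hZr : ∀ r : ℝ, Summable fun n => ‖ZTerm μ u n‖ * r ^ n := fun r => by
    refine Summable.of_norm_bounded (Real.summable_pow_div_factorial (B * |r|)) fun n => ?_
    rw [norm_mul, norm_norm, norm_pow, Real.norm_eq_abs, mul_pow, mul_div_right_comm]
    gcongr
    simpa only [one_mul] using hZ n
  obtain ⟨hC, he⟩ := integrable_conn_and_summable hint
    (tsum_lintegral_conn_le ha ha0 hb hb0 hstable hcrit)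
  have hne : ∀ w : ℂ, ‖w‖ ≤ 1 → ∑' n, ZTerm μ u n * w ^ n ≠ 0 := fun w hw =>
    tsum_mul_pow_ne_zero hZr he (by simp [ZTerm, iterInt, PairInteraction.weight])
      (succ_mul_ZTerm hW hC) hw
  have hZ0 : Z μ u ≠ 0 := by simpa [Z] using hne 1 (by simp)
  obtain ⟨v, hv, hZv⟩ := exists_summable_inverse hZr hne
  have hone : ∀ᵐ x ∂μ.variation,
      (∀ n, Integrable (fun y : Fin n → X => u.weight (Matrix.vecCons x y)) (absPi μ n)) ∧
      (Summable fun n => ‖ZTerm₁ μ u x n‖) ∧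
      (∀ n, Integrable (fun y : Fin n → X => u.conn (Matrix.vecCons x y)) (absPi μ n)) ∧
      (Summable fun n => ‖clusterTerm₁ μ u x n‖) ∧
      Z₁ μ u x = Zhat₁ μ u x * Z μ u := by
    filter_upwards [ae_all_iff.2 hstable.ae_norm_weight_vecCons_le,
      ae_all_iff.2 fun n => ae_integrable_vecCons (hC n)] with x hx hCx
    have hm : ∀ n, AEStronglyMeasurable (fun y : Fin n → X => u.weight (Matrix.vecCons x y))
        (absPi μ n) := fun n => (((u.measurable_weight (n + 1)).comp (measurable_vecCons n)).comp
      measurable_prodMk_left).aestronglyMeasurable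
    have hs := summable_norm_of_le_pow_div_factorial (f := ZTerm₁ μ u x)
      fun n => norm_iterInt_le_pow hexp (hm n) (hx n)
    have hc := summable_norm_of_convolution hv hZv hs (ZTerm₁_eq_sum u x hW hCx)
    exact ⟨fun n => integrable_of_ae_le_prod_exp hexp (hm n) (hx n), hs, hCx, hc,
      tsum_convolution hZs hc (ZTerm₁_eq_sum u x hW hCx)⟩
  refine ⟨⟨hW, hZs.of_norm⟩, hZ0, ?_, ?_⟩
  · filter_upwards [hone] with x hx
    obtain ⟨hWx, hs, hCx, hc, heq⟩ := hx
    exact ⟨⟨hWx, hs.of_norm, fun n => integrable_phi_of_conn (hCx n), hc.of_norm⟩,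
      by rw [heq, mul_div_cancel_right₀ _ hZ0]⟩
  · filter_upwards [Measure.quasiMeasurePreserving_fst.ae hone,
      Measure.quasiMeasurePreserving_snd.ae hone,
      ae_all_iff.2 hstable.ae_norm_weight_vecCons_vecCons_le,
      ae_all_iff.2 fun n => ae_integrable_vecCons_vecCons (hC (n + 1))] with p hp₁ hp₂ hp hCp
    obtain ⟨hW₁, hs₁, hC₁, hc₁, heq₁⟩ := hp₁
    obtain ⟨hW₂, hs₂, hC₂, hc₂, heq₂⟩ := hp₂
    have hm : ∀ n, AEStronglyMeasurable
        (fun y : Fin n → X => u.weight (Matrix.vecCons p.1 (Matrix.vecCons p.2 y)))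
        (absPi μ n) := fun n => (((u.measurable_weight (n + 2)).comp
      (measurePreserving_vecCons_vecCons μ.variation n).measurable).comp
        (measurable_prodMk_left (x := p))).aestronglyMeasurable
    have hs := summable_norm_of_le_pow_div_factorial (f := ZTerm₂ μ u p.1 p.2)
      fun n => norm_iterInt_le_pow hexp (hm n) (hp n)
    have hsum := ZTerm₂_eq_sum u p.1 p.2 hW hW₂ hC₁ hCp
    have hprod := summable_norm_sum_mul_antidiagonal_of_summable_norm hc₁ hs₂
    have hdiff : ∀ n, ZTerm₂ μ u p.1 p.2 n -
        ∑ q ∈ Finset.HasAntidiagonal.antidiagonal n, clusterTerm₁ μ u p.1 q.1 * ZTerm₁ μ u p.2 q.2 =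
        ∑ q ∈ Finset.HasAntidiagonal.antidiagonal n, clusterTerm₂ μ u p.1 p.2 q.1 * ZTerm μ u q.2 := fun n => by
      rw [hsum, add_sub_cancel_left]
    have hc := summable_norm_of_convolution hv hZv
      (Summable.of_nonneg_of_le (fun _ => norm_nonneg _) (fun n => norm_sub_le _ _)
        (hs.add hprod)) hdiff
    have heq : Z₂ μ u p.1 p.2 =
        Zhat₁ μ u p.1 * Z₁ μ u p.2 + Zhat₂ μ u p.1 p.2 * Z μ u := by
      have h := tsum_convolution hZs hc hdiff
      rw [Summable.tsum_sub hs.of_norm hprod.of_norm,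
        ← tsum_mul_tsum_eq_tsum_sum_antidiagonal_of_summable_norm hc₁ hs₂] at h
      simp only [Z₂, Zhat₁, Z₁, Zhat₂, Z]
      linear_combination h
    refine ⟨⟨fun n => integrable_of_ae_le_prod_exp hexp (hm n) (hp n), hs.of_norm,
      fun n => integrable_phi_of_conn (hCp n), hc.of_norm⟩, ?_, ?_⟩
    · rw [heq, heq₂]
      field_simp
    · rw [heq, heq₁, heq₂]
      field_simp
      ring
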